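/- Theorem. Let $0<\alpha\le 2$. Throughout, $(-\Delta)^{\alpha/2}$ on a nonempty open set $\Omega\subset\mathbb R^d$ ($d\ge1$) of finite volume, with Dirichlet condition outside $\Omega$, is the self-adjoint operator on $L^2(\Omega)$ of the form $$Q(u,v)=\int_{\mathbb R^d}|2\pi\xi|^{\alpha}\,\widehat u(\xi)\,\overline{\widehat v(\xi)}\,d\xi,\qquad u,v\in H^{\alpha/2}_0(\Omega),\qquad \widehat u(\xi)=\int u(x)e^{-2\pi i x\cdot\xi}\,dx,$$ where $H^{\alpha/2}_0(\Omega)$ is the closure of $C_c^\infty(\Omega)$ for the norm $(\|u\|_{L^2}^2+Q(u,u))^{1/2}$. It has discrete spectrum: $L^2(\Omega)$ has an orthonormal basis of eigenfunctions, with eigenvalues $\lambda_1\le\lambda_2\le\cdots$ (repeated by multiplicity). Write $V$ for the volume (in the plane $A$ for the area) and $I_2(\Omega)=\int_\Omega|x|^2dx$. (1) Let $d\ge1$, and let $\Omega\subset\mathbb R^d$ be a nonempty open set with $I_2(\Omega)<\infty$ (for example a bounded domain) such that the group of orthogonal transformations mapping $\Omega$ onto itself acts irreducibly on $\mathbb R^d$.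 Then for every $n$, among all invertible linear maps $T$ of $\mathbb R^d$, the quantity $$\Big(\lambda_1+\dots+\lambda_n\Big)^{2/\alpha}V^{2/d}\Big|_{T(\Omega)}\cdot\frac{V^{1+2/d}}{I_2}\Big|_{T^{-1}(\Omega)}$$ is maximal when $T$ is a scalar multiple of an orthogonal matrix. (2) If moreover $d=2$, then also $$\Big(\lambda_1+\dots+\lambda_n\Big)^{2/\alpha}A\cdot\frac{A^2}{I_2}\Big|_{T(\Omega)}$$ is maximal, among all invertible linear $T$, when $T$ is a scalar multiple of an orthogonal matrix. (3) In the plane, for every $n$, consider $(\lambda_1+\dots+\lambda_n)^{2/\alpha}A\cdot A^2/I_2$ with the moment $I_2$ now taken about the centroid of the set. Among the interiors of all ellipses it is maximal for disks, among the interiors of all parallelograms for squares, and among the interiors of all triangles for equilateral triangles. -/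

import Mathlib

open MeasureTheory FourierTransform
open scoped ENNReal ContDiff ComplexConjugate

noncomputable section

/-- Euclidean space `ℝ^d`. -/
abbrev Eucl (d : ℕ) : Type := EuclideanSpace ℝ (Fin d)

/-- The complex Hilbert space `L²(ℝ^d)`. -/
abbrev L2 (d : ℕ) : Type := Lp (α := Eucl d) ℂ 2

/-! ### The fractional Laplacian with Dirichlet condition -/

/-- The class in `L²(ℝ^d)` of a smooth function with compact support contained in `Ω`. -/
def IsTestFunction {d : ℕ} (Ω : Set (Eucl d)) (u : L2 d) : Prop :=
  ∃ f : Eucl d → ℂ, ContDiff ℝ ∞ f ∧ HasCompactSupport f ∧ tsupport f ⊆ Ω ∧ u =ᵐ[volume] f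

/-- The squared Sobolev seminorm of order `α / 2`, as a number in `[0, ∞]`:
`∫ |2πξ|^α |û(ξ)|² dξ`, where `û(ξ) = ∫ u(x) exp(-2πi x·ξ) dx`, so that `|2πξ|²` is the
symbol of `-Δ`. -/
def sobolevEnergy {d : ℕ} (α : ℝ) (u : L2 d) : ℝ≥0∞ :=
  ∫⁻ ξ : Eucl d, ENNReal.ofReal ((2 * Real.pi * ‖ξ‖) ^ α) * ‖(𝓕 u : L2 d) ξ‖ₑ ^ 2

/-- The Sobolev space `H₀^{α/2}(Ω)`: the closure of `C_c^∞(Ω)` for the norm whose square is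
`‖u‖² + ∫ |2πξ|^α |û(ξ)|² dξ`. -/
def sobolevZero {d : ℕ} (α : ℝ) (Ω : Set (Eucl d)) : Set (L2 d) :=
  {u | ∀ ε : ℝ≥0∞, 0 < ε →
    ∃ φ : L2 d, IsTestFunction Ω φ ∧ ‖u - φ‖ₑ ^ 2 + sobolevEnergy α (u - φ) < ε}

/-- The quadratic form of `(-Δ)^{α/2}`: `Q(u, v) = ∫ |2πξ|^α û(ξ) conj(v̂(ξ)) dξ`. -/
def fractionalForm {d : ℕ} (α : ℝ) (u v : L2 d) : ℂ :=
  ∫ ξ : Eucl d, (((2 * Real.pi * ‖ξ‖) ^ α : ℝ) : ℂ) *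
    ((𝓕 u : L2 d) ξ * conj ((𝓕 v : L2 d) ξ))

/-- `u` is an eigenfunction, with eigenvalue `lam`, of the self-adjoint operator `(-Δ)^{α/2}` on
`Ω` with Dirichlet condition outside `Ω`, i.e. the operator on `L²(Ω)` of the form
`fractionalForm α` with domain `H₀^{α/2}(Ω)`. Here `inner ℂ v u = ∫ u conj(v)`. -/
def IsDirichletEigenfunction {d : ℕ} (α : ℝ) (Ω : Set (Eucl d)) (lam : ℝ) (u : L2 d) : Prop :=
  u ≠ 0 ∧ u ∈ sobolevZero α Ω ∧
    ∀ v ∈ sobolevZero α Ω, fractionalForm α u v = (lam : ℂ) * inner ℂ v u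

/-- The `k`-th smallest eigenvalue (`k ≥ 1`), counted with multiplicity: the least `t` such that
there are `k` orthonormal eigenfunctions with eigenvalues at most `t`. -/
def dirichletEigenvalue {d : ℕ} (α : ℝ) (Ω : Set (Eucl d)) (k : ℕ) : ℝ :=
  sInf {t : ℝ | ∃ u : Fin k → L2 d, Orthonormal ℂ u ∧
    ∀ i, ∃ lam : ℝ, lam ≤ t ∧ IsDirichletEigenfunction α Ω lam (u i)}

/-- `lam 1 ≤ lam 2 ≤ …` is the complete list of the eigenvalues, with multiplicity: there is an
orthonormal basis of `L²(Ω)` that consists of eigenfunctions for these eigenvalues. -/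
def IsDirichletSpectrum {d : ℕ} (α : ℝ) (Ω : Set (Eucl d)) (lam : ℕ → ℝ) : Prop :=
  (∀ j k : ℕ, 1 ≤ j → j ≤ k → lam j ≤ lam k) ∧
  ∃ u : ℕ → L2 d, Orthonormal ℂ u ∧
    (∀ k, IsDirichletEigenfunction α Ω (lam (k + 1)) (u k)) ∧
    ∀ f : L2 d, (∀ᵐ x : Eucl d, x ∉ Ω → f x = 0) → (∀ k, inner ℂ (u k) f = 0) → f = 0

/-- `λ₁ + ⋯ + λ_n` on `Ω`. -/
def eigenvalueSum {d : ℕ} (α : ℝ) (n : ℕ) (Ω : Set (Eucl d)) : ℝ :=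
  ∑ k ∈ Finset.Icc 1 n, dirichletEigenvalue α Ω k

/-! ### Geometry -/

/-- Second moment of mass (polar moment of inertia) of `Ω` about the point `a`. -/
def secondMoment {d : ℕ} (a : Eucl d) (Ω : Set (Eucl d)) : ℝ :=
  ∫ x in Ω, ‖x - a‖ ^ 2

/-- The centroid (mean position) of `Ω`. -/
def centroidOf {d : ℕ} (Ω : Set (Eucl d)) : Eucl d :=
  ⨍ x in Ω, x

/-- The group of orthogonal transformations that map `Ω` onto itself acts irreducibly on `ℝ^d`. -/
def HasIrreducibleIsometryGroup {d : ℕ} (Ω : Set (Eucl d)) : Prop :=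
  ∀ W : Submodule ℝ (Eucl d),
    (∀ U : Eucl d ≃ₗᵢ[ℝ] Eucl d, U '' Ω = Ω → ∀ x ∈ W, U x ∈ W) → W = ⊥ ∨ W = ⊤

/-- `S` is a scalar multiple of an orthogonal transformation. -/
def IsMultipleOfOrthogonal {d : ℕ} (S : Eucl d ≃ₗ[ℝ] Eucl d) : Prop :=
  ∃ (c : ℝ) (R : Eucl d ≃ₗᵢ[ℝ] Eucl d), ∀ x, S x = c • R x

/-- `(λ₁ + ⋯ + λ_n)^{2/α} V^{2/d}` on `T(Ω)`, times `V^{1+2/d} / I₂` on `T⁻¹(Ω)`. -/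
def spectralFunctional {d : ℕ} (α : ℝ) (n : ℕ) (Ω : Set (Eucl d)) (T : Eucl d ≃ₗ[ℝ] Eucl d) : ℝ :=
  (eigenvalueSum α n (T '' Ω) ^ (2 / α) * volume.real (T '' Ω) ^ (2 / (d : ℝ))) *
    (volume.real (T.symm '' Ω) ^ (1 + 2 / (d : ℝ)) / secondMoment 0 (T.symm '' Ω))

/-- `(λ₁ + ⋯ + λ_n)^{2/α} A · A² / I₂` on a plane set, with `I₂` taken about the point `a`. -/
def planarFunctional (α : ℝ) (n : ℕ) (a : Eucl 2) (Ω : Set (Eucl 2)) : ℝ :=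
  eigenvalueSum α n Ω ^ (2 / α) * volume.real Ω * (volume.real Ω ^ 2 / secondMoment a Ω)

/-- The (open) ellipse with centre `c`, axes along the orthonormal basis `e`, semiaxes `a`, `b`. -/
def openEllipse (c : Eucl 2) (e : OrthonormalBasis (Fin 2) ℝ (Eucl 2)) (a b : ℝ) :
    Set (Eucl 2) :=
  {x | (inner ℝ (e 0) (x - c) / a) ^ 2 + (inner ℝ (e 1) (x - c) / b) ^ 2 < 1}

/-- The (open) parallelogram with vertex `p` and edge vectors `v`, `w`. -/
def openParallelogram (p v w : Eucl 2) : Set (Eucl 2) :=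
  {x | ∃ s t : ℝ, 0 < s ∧ s < 1 ∧ 0 < t ∧ t < 1 ∧ x = p + s • v + t • w}

end

/-! Write `B` for the transpose of the inverse of `T`. Composing the first `n` eigenfunctions of `Ω`
with the inverse of `T` and normalizing gives orthonormal trial functions on `T(Ω)`, whose energies
are those of `Ω` with the symbol `|2πξ|^α` replaced by `|2πBξ|^α`. Replacing `T` by `TU`, with `U` a
symmetry of `Ω`, leaves `T(Ω)` unchanged but turns `B` into `BU`, so the resulting bounds may be
averaged over symmetries. Since `α ≤ 2`, the function `t ↦ t^(α/2)` is concave, and by Jensen the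
averaged symbol is controlled by the average of `|BUξ|²`. The average of `UᵀBᵀBU` can be brought
arbitrarily close to an operator commuting with all symmetries, hence, by irreducibility, to a
scalar; the trace identifies it as `‖B‖²/d` in the Hilbert–Schmidt norm (`exists_average`).
Therefore `(λ₁+⋯+λ_n)^(2/α)` grows by at most the factor `‖T⁻¹‖²/d` (`eigenvalueSum_rpow_le`), and
by exactly this factor when `T` is a similarity.

The same averages show that the second moments of `Ω` are isotropic (`setIntegral_norm_sq_comp`), so
the moment of `T⁻¹(Ω)` carries exactly the factor `‖T⁻¹‖²/d`, up to a determinant that the volumes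
absorb. The two factors cancel, which proves the inequality in every dimension. In the plane `‖T‖ =
|det T| ‖T⁻¹‖`, so the moment of `T(Ω)` serves as well. Ellipses, parallelograms and triangles are
the affine images of a disk, a square and an equilateral triangle. A rotational symmetry of order 4
or 3 makes these model sets irreducible and places their centroids.

The spectral theory rests on the multiplier `(1+|2πξ|^α)^(-1/2)`. By `enorm_sq_eq_add_sobolevEnergy`
it maps a closed subspace of `L²` isometrically onto `H₀^{α/2}(Ω)` with the form norm. The resulting
embedding `J` into `L²` is compact because localization to finite volume in space and in frequency
is Hilbert–Schmidt. An eigenvalue `κ` of `J*J` corresponds to the Dirichlet eigenvalue `1/κ - 1`,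
and the expansions in the eigenbasis give the variational principle for eigenvalue sums. -/

open MeasureTheory FourierTransform
open scoped ENNReal ContDiff ComplexConjugate

noncomputable section

/-! ### Compact positive operators on a Hilbert space -/

section CompactPositive

open Filter Topology

variable {G : Type*} [NormedAddCommGroup G] [InnerProductSpace ℂ G]

/-- A compact positive operator attains its norm as an eigenvalue. -/
theorem exists_eigenvector_norm [CompleteSpace G] {M : G →L[ℂ] G} (hc : IsCompactOperator M)
    (hp : M.IsPositive) (h0 : M ≠ 0) : ∃ e : G, ‖e‖ = 1 ∧ M e = (‖M‖ : ℂ) • e := by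
  have hnt : Nontrivial G := by
    by_contra h
    rw [not_nontrivial_iff_subsingleton] at h
    exact h0 (ContinuousLinearMap.ext fun x => Subsingleton.elim _ _)
  -- If `‖M‖` were in the resolvent set, the Rayleigh quotients would stay below `‖M‖ - ε`. For a
  -- positive operator their supremum is `‖M‖`. Compactness then turns the nonzero spectral value
  -- into an eigenvalue.
  have hmem : ((‖M‖ : ℝ) : ℂ) ∈ spectrum ℂ M := by
    by_contra h
    have h' : algebraMap ℝ ℂ ‖M‖ ∈ resolventSet ℂ M := by
      simpa [spectrum] using h
    obtain ⟨ε, hε, hle⟩ := M.rayleighQuotient_le_of_norm_mem_resolventSet h'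
    have h1 : ‖M‖ ≤ ‖M‖ - ε := by
      conv_lhs => rw [M.norm_eq_iSup_rayleighQuotient hp.isSymmetric]
      refine ciSup_le fun x => ?_
      rw [abs_of_nonneg]
      · exact hle x
      · have := hp.re_inner_nonneg_left x
        unfold ContinuousLinearMap.rayleighQuotient ContinuousLinearMap.reApplyInnerSelf
        positivity
    linarith
  have hne : ((‖M‖ : ℝ) : ℂ) ≠ 0 := by
    simpa using h0
  obtain ⟨v, hv⟩ := ((hc.hasEigenvalue_iff_mem_spectrum hne).2 hmem).exists_hasEigenvector
  have hv0 : (‖v‖ : ℂ) ≠ 0 := by simpa using hv.2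
  refine ⟨(‖v‖ : ℂ)⁻¹ • v, ?_, ?_⟩
  · rw [norm_smul, norm_inv, Complex.norm_real, norm_norm, inv_mul_cancel₀]
    simpa using hv.2
  · have := hv.apply_eq_smul
    rw [map_smul, smul_comm]
    congr 1

open Classical in
/-- A unit eigenvector of `M` for the eigenvalue `‖M‖`, if there is one. -/
def topEigenvector (M : G →L[ℂ] G) : G :=
  if h : ∃ e : G, ‖e‖ = 1 ∧ M e = (‖M‖ : ℂ) • e then h.choose else 0

/-- `M` with the contribution of its top eigenvector removed. -/
def deflate (M : G →L[ℂ] G) : G →L[ℂ] G :=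
  M - (‖M‖ : ℂ) • (innerSL ℂ (topEigenvector M)).smulRight (topEigenvector M)

theorem deflate_apply (M : G →L[ℂ] G) (x : G) :
    deflate M x = M x - (‖M‖ : ℂ) • inner ℂ (topEigenvector M) x • topEigenvector M := by
  simp [deflate]

theorem deflate_of_inner_eq_zero {M : G →L[ℂ] G} {x : G}
    (hx : inner ℂ (topEigenvector M) x = 0) : deflate M x = M x := by
  simp [deflate_apply, hx]

/-- The norms of the images of an orthonormal sequence cannot stay away from zero when the images
are orthogonal and the operator is compact. -/
theorem exists_lt_of_isCompactOperator {M : G →L[ℂ] G} (hc : IsCompactOperator M) {e : ℕ → G}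
    (he : Orthonormal ℂ e) {κ : ℕ → ℝ} (hM : ∀ k, M (e k) = (κ k : ℂ) • e k) {ε : ℝ} (hε : 0 < ε) :
    ∃ k, |κ k| < ε := by
  by_contra! h
  obtain ⟨K, hK, hKs⟩ := hc.image_closedBall_subset_compact (f := (M : G →ₗ[ℂ] G)) 1
  have hmem : ∀ k, M (e k) ∈ K := fun k => hKs ⟨e k, by simp [he.1 k], rfl⟩
  obtain ⟨a, -, φ, hφ, hlim⟩ := hK.tendsto_subseq hmem
  have hcau := hlim.cauchySeq
  rw [Metric.cauchySeq_iff] at hcau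
  obtain ⟨N, hN⟩ := hcau ε hε
  have h1 := hN N le_rfl (N + 1) (by omega)
  have hne : φ N ≠ φ (N + 1) := (hφ (by omega : N < N + 1)).ne
  -- By orthogonality the squared distance between two images is `κ² + κ'² ≥ ε²`, so no subsequence
  -- can be Cauchy.
  have h2 := norm_sub_sq (𝕜 := ℂ) (M (e (φ N))) (M (e (φ (N + 1))))
  rw [hM, hM, inner_smul_left, inner_smul_right, he.2 hne, norm_smul, norm_smul, he.1, he.1] at h2
  simp only [Function.comp, dist_eq_norm, hM] at h1
  simp only [mul_zero, map_zero, sub_zero, mul_one, Complex.norm_real, Real.norm_eq_abs] at h2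
  have h3 := h (φ N)
  nlinarith [norm_nonneg ((κ (φ N) : ℂ) • e (φ N) - (κ (φ (N + 1)) : ℂ) • e (φ (N + 1))),
    abs_nonneg (κ (φ N)), sq_nonneg |κ (φ (N + 1))|]

variable {H : Type*} [NormedAddCommGroup H] [InnerProductSpace ℂ H] [CompleteSpace H]

/-- Hilbert–Schmidt operators are compact. -/
theorem isCompactOperator_of_sum_norm_sq_le {ι : Type*} (b : HilbertBasis ι ℂ G) (A : G →L[ℂ] H)
    {C : ℝ} (hA : ∀ F : Finset ι, ∑ i ∈ F, ‖A (b i)‖ ^ 2 ≤ C) : IsCompactOperator A := by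
  classical
  have hsum : Summable fun i => ‖A (b i)‖ ^ 2 :=
    summable_of_sum_le (fun i => sq_nonneg _) hA
  -- Finite rank truncations of `A`. By Cauchy–Schwarz and Bessel the error in operator norm is at
  -- most the square root of the tail of `∑ ‖A (b i)‖²`.
  let P : Finset ι → G →L[ℂ] H := fun F => ∑ i ∈ F, (innerSL ℂ (b i)).smulRight (A (b i))
  have hP : ∀ F x, P F x = ∑ i ∈ F, inner ℂ (b i) x • A (b i) := fun F x => by
    simp [P]
  have hPc : ∀ F, IsCompactOperator (P F) := by
    intro F
    have : P F ∈ compactOperator (RingHom.id ℂ) G H := by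
      refine Submodule.sum_mem _ fun i _ => ?_
      have h : IsCompactOperator (innerSL ℂ (b i)) :=
        isCompactOperator_of_locallyCompactSpace_dom (innerSL ℂ (b i) : G →L[ℂ] ℂ)
      exact h.clm_comp ((ContinuousLinearMap.id ℂ ℂ).smulRight (A (b i)))
    exact this
  refine isCompactOperator_of_tendsto (l := atTop) (F := P) ?_ (Eventually.of_forall hPc)
  rw [Metric.tendsto_atTop]
  intro ε hε
  obtain ⟨F₀, hF₀⟩ := (summable_iff_vanishing_norm.1 hsum) ((ε / 2) ^ 2) (by positivity)
  refine ⟨F₀, fun F hF => ?_⟩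
  rw [dist_eq_norm, norm_sub_rev]
  refine lt_of_le_of_lt (ContinuousLinearMap.opNorm_le_bound _ (by positivity : 0 ≤ ε / 2)
    fun x => ?_) (by linarith)
  have hx : HasSum (fun i => inner ℂ (b i) x • A (b i)) (A x) := by
    have := (b.hasSum_repr x).mapL A
    simpa [b.repr_apply_apply] using this
  have hlim : Tendsto (fun F' : Finset ι => ‖∑ i ∈ F', inner ℂ (b i) x • A (b i) - P F x‖) atTop
      (𝓝 ‖A x - P F x‖) := (Tendsto.sub_const hx _).norm
  rw [sub_apply]
  refine le_of_tendsto hlim ?_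
  filter_upwards [eventually_ge_atTop F] with F' hF'
  rw [hP, ← Finset.sum_sdiff hF', add_sub_cancel_right]
  have hd : Disjoint (F' \ F) F₀ :=
    Finset.disjoint_of_subset_right hF Finset.sdiff_disjoint
  have hs := hF₀ _ hd
  rw [Real.norm_of_nonneg (Finset.sum_nonneg fun i _ => sq_nonneg _)] at hs
  have hb : ∑ i ∈ F' \ F, ‖inner ℂ (b i) x‖ ^ 2 ≤ ‖x‖ ^ 2 :=
    b.orthonormal.sum_inner_products_le x
  calc ‖∑ i ∈ F' \ F, inner ℂ (b i) x • A (b i)‖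
      ≤ ∑ i ∈ F' \ F, ‖inner ℂ (b i) x‖ * ‖A (b i)‖ := by
        refine (norm_sum_le _ _).trans (Finset.sum_le_sum fun i _ => (norm_smul_le _ _))
    _ ≤ √(∑ i ∈ F' \ F, ‖inner ℂ (b i) x‖ ^ 2) * √(∑ i ∈ F' \ F, ‖A (b i)‖ ^ 2) :=
        Real.sum_mul_le_sqrt_mul_sqrt _ _ _
    _ ≤ √(‖x‖ ^ 2) * √((ε / 2) ^ 2) := by gcongr
    _ = ε / 2 * ‖x‖ := by
        rw [Real.sqrt_sq (norm_nonneg _), Real.sqrt_sq (by positivity), mul_comm]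

variable [CompleteSpace G]

theorem topEigenvector_spec {M : G →L[ℂ] G} (hc : IsCompactOperator M)
    (hp : M.IsPositive) (h0 : M ≠ 0) :
    ‖topEigenvector M‖ = 1 ∧ M (topEigenvector M) = (‖M‖ : ℂ) • topEigenvector M := by
  have h := exists_eigenvector_norm hc hp h0
  rw [topEigenvector, dif_pos h]
  exact h.choose_spec

theorem deflate_topEigenvector {M : G →L[ℂ] G} (hc : IsCompactOperator M)
    (hp : M.IsPositive) (h0 : M ≠ 0) : deflate M (topEigenvector M) = 0 := by
  obtain ⟨h1, h2⟩ := topEigenvector_spec hc hp h0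
  rw [deflate_apply, h2, inner_self_eq_norm_sq_to_K, h1]
  simp

theorem inner_topEigenvector_of_apply_eq_zero {M : G →L[ℂ] G} (hc : IsCompactOperator M)
    (hp : M.IsPositive) (h0 : M ≠ 0) {x : G} (hx : M x = 0) :
    inner ℂ (topEigenvector M) x = 0 := by
  obtain ⟨h1, h2⟩ := topEigenvector_spec hc hp h0
  have h := hp.isSymmetric (topEigenvector M) x
  simp only [ContinuousLinearMap.coe_coe] at h
  rw [h2, hx, inner_smul_left, inner_zero_right] at h
  simpa [h0] using h

/-- Deflation is `M` precomposed with the projection onto the orthogonal complement of its top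
eigenvector. In this form compactness and the bound on the norm are inherited from `M`. -/
theorem deflate_eq_apply_sub {M : G →L[ℂ] G} (hc : IsCompactOperator M)
    (hp : M.IsPositive) (h0 : M ≠ 0) (x : G) :
    deflate M x = M (x - inner ℂ (topEigenvector M) x • topEigenvector M) := by
  rw [map_sub, map_smul, (topEigenvector_spec hc hp h0).2, deflate_apply, smul_comm]

theorem inner_sub_topEigenvector {M : G →L[ℂ] G} (hc : IsCompactOperator M)
    (hp : M.IsPositive) (h0 : M ≠ 0) (x : G) :
    inner ℂ (topEigenvector M) (x - inner ℂ (topEigenvector M) x • topEigenvector M) = 0 := by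
  rw [inner_sub_right, inner_smul_right, inner_self_eq_norm_sq_to_K,
    (topEigenvector_spec hc hp h0).1]
  simp

theorem isCompactOperator_deflate {M : G →L[ℂ] G} (hc : IsCompactOperator M)
    (hp : M.IsPositive) (h0 : M ≠ 0) : IsCompactOperator (deflate M) := by
  have : ⇑(deflate M) = M ∘ (ContinuousLinearMap.id ℂ G -
      (innerSL ℂ (topEigenvector M)).smulRight (topEigenvector M)) := by
    ext x
    simp [deflate_eq_apply_sub hc hp h0]
  rw [this]
  exact hc.comp_clm _

/-- The complement of an eigenvector of a symmetric operator is invariant. The quadratic form of the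
deflation at `x` is therefore that of `M` at the projection of `x`. -/
theorem isPositive_deflate {M : G →L[ℂ] G} (hc : IsCompactOperator M)
    (hp : M.IsPositive) (h0 : M ≠ 0) : (deflate M).IsPositive := by
  have hkey : ∀ x, inner ℂ (deflate M x) x =
      inner ℂ (M (x - inner ℂ (topEigenvector M) x • topEigenvector M))
        (x - inner ℂ (topEigenvector M) x • topEigenvector M) := by
    intro x
    rw [deflate_eq_apply_sub hc hp h0]
    have hy := inner_sub_topEigenvector hc hp h0 x
    set e := topEigenvector M with he
    set y := x - inner ℂ e x • e with hyd
    have h := hp.isSymmetric y e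
    simp only [ContinuousLinearMap.coe_coe] at h
    rw [(topEigenvector_spec hc hp h0).2, inner_smul_right, ← he, ← inner_conj_symm y e, hy,
      map_zero, mul_zero] at h
    have hxy : x = y + inner ℂ e x • e := by simp [hyd]
    conv_lhs => rw [hxy]
    rw [inner_add_right, inner_smul_right, h, mul_zero, add_zero]
  rw [ContinuousLinearMap.isPositive_iff_complex]
  intro x
  rw [hkey]
  exact (ContinuousLinearMap.isPositive_iff_complex M).1 hp _

theorem norm_deflate_le {M : G →L[ℂ] G} (hc : IsCompactOperator M)
    (hp : M.IsPositive) (h0 : M ≠ 0) : ‖deflate M‖ ≤ ‖M‖ := by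
  refine ContinuousLinearMap.opNorm_le_bound _ (norm_nonneg _) fun x => ?_
  rw [deflate_eq_apply_sub hc hp h0]
  refine (M.le_opNorm _).trans (mul_le_mul_of_nonneg_left ?_ (norm_nonneg _))
  set e := topEigenvector M
  set y := x - inner ℂ e x • e with hy
  have hxy : x = y + inner ℂ e x • e := by simp [hy]
  have h0' : inner ℂ y (inner ℂ e x • e) = 0 := by
    rw [inner_smul_right, ← inner_conj_symm y e, inner_sub_topEigenvector hc hp h0]
    simp
  have := norm_add_sq_eq_norm_sq_add_norm_sq_of_inner_eq_zero _ _ h0'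
  rw [← hxy] at this
  nlinarith [norm_nonneg x, norm_nonneg y, norm_nonneg (inner ℂ e x • e)]

/-- An injective compact positive operator on a Hilbert space of infinite dimension has an
orthonormal basis of eigenvectors whose eigenvalues decrease. -/
theorem exists_hilbertBasis_eigenvectors {M : G →L[ℂ] G} (hc : IsCompactOperator M)
    (hp : M.IsPositive) (hinj : Function.Injective M) (hinf : ¬ FiniteDimensional ℂ G) :
    ∃ (b : HilbertBasis ℕ ℂ G) (κ : ℕ → ℝ), Antitone κ ∧ (∀ k, 0 < κ k) ∧
      ∀ k, M (b k) = (κ k : ℂ) • b k := by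
  set N : ℕ → G →L[ℂ] G := fun k => deflate^[k] M with hN
  have hNs : ∀ k, N (k + 1) = deflate (N k) := fun k => Function.iterate_succ_apply' _ _ _
  -- The deflation never terminates: otherwise the injective operator `M` would have finite rank on
  -- a space of infinite dimension.
  have hfin : ∀ A : G →L[ℂ] G, (∃ W : Submodule ℂ G, FiniteDimensional ℂ W ∧
      ∀ x, M x - A x ∈ W) → A ≠ 0 := by
    rintro A ⟨W, hW, hx⟩ rfl
    apply hinf
    let L : G →ₗ[ℂ] W := LinearMap.codRestrict W (M : G →ₗ[ℂ] G) fun x => by simpa using hx x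
    exact Module.Finite.of_injective L fun x y hxy => hinj (congrArg Subtype.val hxy)
  have hgood : ∀ k, IsCompactOperator (N k) ∧ (N k).IsPositive ∧
      ∃ W : Submodule ℂ G, FiniteDimensional ℂ W ∧ ∀ x, M x - N k x ∈ W := by
    intro k
    induction k with
    | zero => exact ⟨hc, hp, ⊥, inferInstance, by simp [hN]⟩
    | succ k ih =>
      obtain ⟨h1, h2, hW⟩ := ih
      have h3 := hfin _ hW
      obtain ⟨W, hWf, hW⟩ := hW
      rw [hNs]
      refine ⟨isCompactOperator_deflate h1 h2 h3, isPositive_deflate h1 h2 h3,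
        W ⊔ Submodule.span ℂ {topEigenvector (N k)}, inferInstance, fun x => ?_⟩
      rw [deflate_apply, ← sub_add]
      refine Submodule.add_mem_sup (hW x) ?_
      exact Submodule.smul_mem _ _ (Submodule.smul_mem _ _ (Submodule.mem_span_singleton_self _))
  have h1 := fun k => (hgood k).1
  have h2 := fun k => (hgood k).2.1
  have h3 := fun k => hfin _ (hgood k).2.2
  set e : ℕ → G := fun k => topEigenvector (N k) with he
  set κ : ℕ → ℝ := fun k => ‖N k‖ with hκ
  have hspec := fun k => topEigenvector_spec (h1 k) (h2 k) (h3 k)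
  -- An eigenvector once removed stays in the kernel of all later deflations. Later top
  -- eigenvectors, having nonzero eigenvalues, are then orthogonal to it.
  have hker : ∀ i j, N (i + 1 + j) (e i) = 0 := by
    intro i j
    induction j with
    | zero =>
      rw [add_zero, hNs]
      exact deflate_topEigenvector (h1 i) (h2 i) (h3 i)
    | succ j ih =>
      rw [← add_assoc, hNs, deflate_of_inner_eq_zero, ih]
      exact inner_topEigenvector_of_apply_eq_zero (h1 _) (h2 _) (h3 _) ih
  have hlt : ∀ i j, i < j → inner ℂ (e j) (e i) = 0 := by
    intro i j hij
    obtain ⟨l, rfl⟩ := Nat.exists_eq_add_of_le (Nat.succ_le_of_lt hij)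
    exact inner_topEigenvector_of_apply_eq_zero (h1 _) (h2 _) (h3 _) (hker i l)
  have hort : Orthonormal ℂ e := by
    refine ⟨fun k => (hspec k).1, fun i j hij => ?_⟩
    rcases lt_or_gt_of_ne hij with h | h
    · rw [← inner_conj_symm, hlt i j h, map_zero]
    · exact hlt j i h
  have hagree : ∀ k x, (∀ i < k, inner ℂ (e i) x = 0) → N k x = M x := by
    intro k x
    induction k with
    | zero => simp [hN]
    | succ k ih =>
      intro hx
      rw [hNs, deflate_of_inner_eq_zero (hx k (by omega)), ih fun i hi => hx i (by omega)]
  have heig : ∀ k, M (e k) = (κ k : ℂ) • e k := by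
    intro k
    rw [← hagree k (e k) fun i hi => by rw [← inner_conj_symm, hlt i k hi, map_zero]]
    exact (hspec k).2
  have hκp : ∀ k, 0 < κ k := fun k => norm_pos_iff.2 (h3 k)
  -- On a vector orthogonal to all `e k`, every deflation agrees with `M`. Hence `‖M x‖ ≤ κ k * ‖x‖`
  -- for all `k`, and the `κ k` come arbitrarily close to zero.
  have hbot : (Submodule.span ℂ (Set.range e))ᗮ = ⊥ := by
    rw [Submodule.eq_bot_iff]
    intro x hx
    have hx' : ∀ k, inner ℂ (e k) x = 0 := fun k =>
      (Submodule.mem_orthogonal _ _).1 hx _ (Submodule.subset_span ⟨k, rfl⟩)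
    have hle : ∀ k, ‖M x‖ ≤ κ k * ‖x‖ := fun k => by
      rw [← hagree k x fun i _ => hx' i]
      exact (N k).le_opNorm x
    apply hinj
    rw [map_zero]
    by_contra hM
    have hx0 : 0 < ‖x‖ := by
      rw [norm_pos_iff]
      rintro rfl
      simp at hM
    obtain ⟨k, hk⟩ := exists_lt_of_isCompactOperator hc hort heig
      (div_pos (norm_pos_iff.2 hM) hx0)
    rw [abs_of_pos (hκp k), lt_div_iff₀ hx0] at hk
    exact absurd (hle k) (not_le.2 hk)
  refine ⟨HilbertBasis.mkOfOrthogonalEqBot hort hbot, κ, ?_, hκp, ?_⟩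
  · refine antitone_nat_of_succ_le fun k => ?_
    simp only [hκ, hNs]
    exact norm_deflate_le (h1 k) (h2 k) (h3 k)
  · intro k
    rw [HilbertBasis.coe_mkOfOrthogonalEqBot]
    exact heig k

end CompactPositive

/-! ### Multiplication and composition operators on `L²` -/

section L2Operators

variable {d : ℕ}

theorem enorm_sq_eq_lintegral (u : L2 d) : ‖u‖ₑ ^ 2 = ∫⁻ x, ‖u x‖ₑ ^ 2 := by
  have h := eLpNorm_nnreal_pow_eq_lintegral (μ := volume) (f := (u : Eucl d → ℂ)) (p := 2) (by simp)
  rw [Lp.enorm_def]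
  simpa using h

theorem memLp_two_iff_lintegral {f : Eucl d → ℂ} (hf : AEStronglyMeasurable f volume) :
    MemLp f 2 volume ↔ ∫⁻ x, ‖f x‖ₑ ^ 2 < ⊤ := by
  have h := eLpNorm_nnreal_pow_eq_lintegral (μ := volume) (f := f) (p := 2) (by simp)
  have h' : eLpNorm f 2 volume ^ 2 = ∫⁻ x, ‖f x‖ₑ ^ 2 := by simpa using h
  rw [← h', MemLp]
  simp [hf]

theorem norm_sq_eq_toReal_lintegral (u : L2 d) : ‖u‖ ^ 2 = (∫⁻ x, ‖u x‖ₑ ^ 2).toReal := by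
  rw [← enorm_sq_eq_lintegral, ENNReal.toReal_pow, toReal_enorm]

/-- Multiplication by a bounded function, as an operator on `L²`. -/
def mulOp (θ : Eucl d → ℂ) (hθ : MemLp θ ⊤ volume) : L2 d →L[ℂ] L2 d :=
  (ContinuousLinearMap.mul ℂ ℂ).holderL volume ⊤ 2 2 (hθ.toLp θ)

theorem coeFn_mulOp (θ : Eucl d → ℂ) (hθ : MemLp θ ⊤ volume) (u : L2 d) :
    mulOp θ hθ u =ᵐ[volume] fun x => θ x * u x := by
  have h := (ContinuousLinearMap.mul ℂ ℂ).coeFn_holder (r := 2) (hθ.toLp θ) u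
  filter_upwards [h, hθ.coeFn_toLp] with x hx hx'
  rw [mulOp, ContinuousLinearMap.holderL_apply_apply, hx, hx']
  rfl

/-- Composition with a map that scales the volume, followed by multiplication by a function of the
compensating modulus, is an isometry of `L²`. -/
theorem exists_weightedComposition {θ : Eucl d → ℂ} (hθ : Measurable θ) {e : Eucl d → Eucl d}
    (he : Measurable e) {K : ℝ≥0∞} (hmap : Measure.map e volume = K • volume)
    (hK : ∀ x, ‖θ x‖ₑ ^ 2 * K = 1) :
    ∃ Φ : L2 d →ₗᵢ[ℂ] L2 d, ∀ u, Φ u =ᵐ[volume] fun x => θ x * u (e x) := by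
  have hq : Measure.QuasiMeasurePreserving e volume volume :=
    ⟨he, by rw [hmap]; exact Measure.smul_absolutelyContinuous⟩
  have hm : ∀ u : L2 d, AEStronglyMeasurable (fun x => θ x * u (e x)) volume := fun u =>
    hθ.aestronglyMeasurable.mul ((Lp.aestronglyMeasurable u).comp_quasiMeasurePreserving hq)
  have hint : ∀ u : L2 d, ∫⁻ x, ‖θ x * u (e x)‖ₑ ^ 2 = ∫⁻ x, ‖u x‖ₑ ^ 2 := by
    intro u
    obtain ⟨w, hw⟩ : ∃ w : ℝ≥0∞, ∀ x, ‖θ x‖ₑ ^ 2 = w := ⟨K⁻¹, fun x =>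
      ENNReal.eq_inv_of_mul_eq_one_left (hK x)⟩
    have hwK : w * K = 1 := by rw [← hw 0]; exact hK 0
    have hum : AEMeasurable (fun x => ‖u x‖ₑ ^ 2) volume :=
      (Lp.aestronglyMeasurable u).enorm.pow_const 2
    simp_rw [enorm_mul, mul_pow, hw]
    rw [lintegral_const_mul'']
    · have h1 := lintegral_map' (f := fun x => ‖u x‖ₑ ^ 2) (g := e) (μ := volume)
        (by rw [hmap]; exact hum.smul_measure K) he.aemeasurable
      rw [← h1, hmap, lintegral_smul_measure, smul_eq_mul, ← mul_assoc, hwK, one_mul]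
    · exact hum.comp_quasiMeasurePreserving hq
  have hL : ∀ u : L2 d, MemLp (fun x => θ x * u (e x)) 2 volume := fun u => by
    rw [memLp_two_iff_lintegral (hm u), hint, ← enorm_sq_eq_lintegral]
    exact ENNReal.pow_lt_top enorm_lt_top
  let L : L2 d →ₗ[ℂ] L2 d :=
    { toFun := fun u => (hL u).toLp _
      map_add' := fun u v => by
        ext1
        filter_upwards [(hL (u + v)).coeFn_toLp, (hL u).coeFn_toLp, (hL v).coeFn_toLp,
          Lp.coeFn_add ((hL u).toLp _) ((hL v).toLp _), hq.ae_eq_comp (Lp.coeFn_add u v)]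
          with x h1 h2 h3 h4 h5
        simp only [Function.comp, Pi.add_apply] at h4 h5
        rw [h1, h4, h2, h3, h5, mul_add]
      map_smul' := fun c u => by
        ext1
        filter_upwards [(hL (c • u)).coeFn_toLp, (hL u).coeFn_toLp,
          Lp.coeFn_smul c ((hL u).toLp _), hq.ae_eq_comp (Lp.coeFn_smul c u)]
          with x h1 h2 h3 h4
        simp only [Function.comp, Pi.smul_apply, smul_eq_mul] at h3 h4
        rw [h1, RingHom.id_apply, h3, h2, h4]
        ring }
  have hLc : ∀ u, L u =ᵐ[volume] fun x => θ x * u (e x) := fun u => (hL u).coeFn_toLp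
  refine ⟨⟨L, fun u => ?_⟩, hLc⟩
  rw [← sq_eq_sq₀ (norm_nonneg _) (norm_nonneg _), norm_sq_eq_toReal_lintegral,
    norm_sq_eq_toReal_lintegral, ← hint u]
  congr 1
  refine lintegral_congr_ae ?_
  filter_upwards [hLc u] with x hx
  rw [hx]

end L2Operators

/-! ### The Fourier transform on `L²` -/

section FourierL2

variable {d : ℕ}

/-- The Fourier transform of `L²` agrees with the integral on integrable functions. -/
theorem fourier_ae_eq_of_integrable (u : L2 d) (hu : Integrable u volume) :
    (𝓕 u : L2 d) =ᵐ[volume] 𝓕 (u : Eucl d → ℂ) := by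
  have hcont : Continuous (𝓕 (u : Eucl d → ℂ)) :=
    VectorFourier.fourierIntegral_continuous Real.continuous_fourierChar
      (innerSL ℝ).continuous₂ hu
  refine ae_eq_of_integral_contDiff_smul_eq
    ((Lp.memLp (𝓕 u : L2 d)).locallyIntegrable (by norm_num)) hcont.locallyIntegrable ?_
  intro g hg hgc
  have hgc' : HasCompactSupport (fun x => (g x : ℂ)) := hgc.comp_left (g := Complex.ofReal) rfl
  let G : SchwartzMap (Eucl d) ℂ := hgc'.toSchwartzMap (Complex.ofRealCLM.contDiff.comp hg)
  have hG : ∀ x, G x = (g x : ℂ) := fun x => rfl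
  -- The two transforms are compared as distributions: both satisfy the multiplication formula that
  -- moves the transform onto the test function.
  have h1 := congrArg (fun t => t G) (Lp.fourier_toTemperedDistribution_eq u)
  simp only [TemperedDistribution.fourier_apply, Lp.toTemperedDistribution_apply] at h1
  have h2 := VectorFourier.integral_fourierIntegral_smul_eq_flip (μ := volume) (ν := volume)
    (f := G) (g := (u : Eucl d → ℂ)) (L := innerₗ (Eucl d)) Real.continuous_fourierChar
    (innerSL ℝ).continuous₂ G.integrable hu
  rw [flip_innerₗ] at h2
  calc ∫ x, g x • (𝓕 u : L2 d) x = ∫ x, G x • (𝓕 u : L2 d) x := by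
        simp [hG]
    _ = ∫ x, (𝓕 G) x • u x := h1.symm
    _ = ∫ x, G x • 𝓕 (u : Eucl d → ℂ) x := h2
    _ = _ := by simp [hG]

theorem map_affine_volume (T : Eucl d ≃L[ℝ] Eucl d) (c : Eucl d) :
    Measure.map (fun x => T.symm (x - c)) volume =
      ENNReal.ofReal |LinearMap.det (T : Eucl d →ₗ[ℝ] Eucl d)| • volume := by
  have h1 : LinearMap.det (T.symm : Eucl d →ₗ[ℝ] Eucl d) =
      (LinearMap.det (T : Eucl d →ₗ[ℝ] Eucl d))⁻¹ := by
    exact LinearEquiv.det_coe_symm T.toLinearEquiv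
  have h0 : LinearMap.det (T : Eucl d →ₗ[ℝ] Eucl d) ≠ 0 :=
    (LinearEquiv.isUnit_det' T.toLinearEquiv).ne_zero
  have h2 := Measure.map_linearMap_addHaar_eq_smul_addHaar (volume : Measure (Eucl d))
    (f := (T.symm : Eucl d →ₗ[ℝ] Eucl d)) (by rw [h1]; exact inv_ne_zero h0)
  have h3 : Measure.map (fun x : Eucl d => x - c) volume = volume :=
    (measurePreserving_sub_right volume c).map_eq
  have h4 : (fun x => T.symm (x - c)) = (T.symm : Eucl d →ₗ[ℝ] Eucl d) ∘ fun x => x - c := rfl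
  rw [h4, ← Measure.map_map (g := ⇑(T.symm : Eucl d →ₗ[ℝ] Eucl d)) T.symm.continuous.measurable
    (measurable_id'.sub_const c), h3, h2, h1,
    inv_inv]

theorem integral_comp_affine {F : Type*} [NormedAddCommGroup F] [NormedSpace ℝ F]
    (T : Eucl d ≃L[ℝ] Eucl d) (c : Eucl d) (g : Eucl d → F) :
    ∫ x, g (T.symm (x - c)) = |LinearMap.det (T : Eucl d →ₗ[ℝ] Eucl d)| • ∫ x, g x := by
  have he : MeasurableEmbedding fun x => T.symm (x - c) :=
    ((Homeomorph.subRight c).trans T.symm.toHomeomorph).measurableEmbedding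
  rw [← he.integral_map, map_affine_volume, integral_smul_measure,
    ENNReal.toReal_ofReal (abs_nonneg _)]

theorem det_adjoint_eq (T : Eucl d →L[ℝ] Eucl d) :
    LinearMap.det (ContinuousLinearMap.adjoint T : Eucl d →ₗ[ℝ] Eucl d) =
      LinearMap.det (T : Eucl d →ₗ[ℝ] Eucl d) := by
  let b := EuclideanSpace.basisFun (Fin d) ℝ
  have h := LinearMap.toMatrix_adjoint b b (T : Eucl d →ₗ[ℝ] Eucl d)
  rw [← LinearMap.det_toMatrix b.toBasis,
    ← LinearMap.det_toMatrix b.toBasis (T : Eucl d →ₗ[ℝ] Eucl d),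
    show (ContinuousLinearMap.adjoint T : Eucl d →ₗ[ℝ] Eucl d) =
      LinearMap.adjoint (T : Eucl d →ₗ[ℝ] Eucl d) from rfl, h]
  simp

/-- Normalized composition with an affine bijection is an isometry of `L²`, and the modulus of the
Fourier transform is composed with the adjoint of the linear part. -/
theorem exists_affineIsometry (T : Eucl d ≃L[ℝ] Eucl d) (c : Eucl d) :
    ∃ (Φ : L2 d →ₗᵢ[ℂ] L2 d) (s : ℝ), 0 < s ∧
      s ^ 2 = |LinearMap.det (T : Eucl d →ₗ[ℝ] Eucl d)| ∧
      (∀ u, Φ u =ᵐ[volume] fun x => ((s⁻¹ : ℝ) : ℂ) * u (T.symm (x - c))) ∧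
      ∀ u, ∀ᵐ ξ, ‖(𝓕 (Φ u) : L2 d) ξ‖ₑ =
        ENNReal.ofReal s * ‖(𝓕 u : L2 d) (ContinuousLinearMap.adjoint (T : Eucl d →L[ℝ] Eucl d) ξ)‖ₑ := by
  set D : ℝ := |LinearMap.det (T : Eucl d →ₗ[ℝ] Eucl d)| with hD
  have hD0 : 0 < D := abs_pos.2 (LinearEquiv.isUnit_det' T.toLinearEquiv).ne_zero
  set s : ℝ := √D with hs
  have hs0 : 0 < s := Real.sqrt_pos.2 hD0
  have hsq : s ^ 2 = D := Real.sq_sqrt hD0.le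
  set A : Eucl d →L[ℝ] Eucl d := ContinuousLinearMap.adjoint (T : Eucl d →L[ℝ] Eucl d) with hA
  have hmapA : Measure.map A volume = ENNReal.ofReal D⁻¹ • (volume : Measure (Eucl d)) := by
    have := Measure.map_linearMap_addHaar_eq_smul_addHaar (volume : Measure (Eucl d))
      (f := (A : Eucl d →ₗ[ℝ] Eucl d))
      (by rw [det_adjoint_eq]; exact (LinearEquiv.isUnit_det' T.toLinearEquiv).ne_zero)
    rw [det_adjoint_eq, abs_inv] at this
    exact this
  obtain ⟨Φ, hΦ⟩ := exists_weightedComposition (d := d) (θ := fun _ => ((s⁻¹ : ℝ) : ℂ))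
    measurable_const (e := fun x => T.symm (x - c))
    (T.symm.continuous.comp (continuous_id.sub continuous_const)).measurable
    (map_affine_volume T c) (fun x => by
      rw [← ofReal_norm, Complex.norm_real, Real.norm_of_nonneg (by positivity),
        ← ENNReal.ofReal_pow (by positivity), ← ENNReal.ofReal_mul (by positivity), inv_pow,
        hsq, inv_mul_cancel₀ hD0.ne', ENNReal.ofReal_one])
  -- The expected action on the Fourier side: a phase from the translation by `c`, the normalization
  -- `s`, and composition with the adjoint. It is verified on Schwartz functions by substitution and
  -- extended by density. The phase has modulus one and disappears from the conclusion.
  obtain ⟨Ψ, hΨ⟩ := exists_weightedComposition (d := d)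
    (θ := fun ξ => (s : ℂ) * (Real.fourierChar (-inner ℝ c ξ) : ℂ))
    (by fun_prop) (e := A) A.continuous.measurable hmapA (fun x => by
      rw [← ofReal_norm, norm_mul, Complex.norm_real, Circle.norm_coe, mul_one,
        Real.norm_of_nonneg hs0.le, ← ENNReal.ofReal_pow hs0.le,
        ← ENNReal.ofReal_mul (by positivity), hsq, mul_inv_cancel₀ hD0.ne', ENNReal.ofReal_one])
  have key : ∀ u : L2 d, (𝓕 (Φ u) : L2 d) = Ψ (𝓕 u) := by
    intro u
    refine DenseRange.induction_on (p := fun u : L2 d => (𝓕 (Φ u) : L2 d) = Ψ (𝓕 u))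
      (SchwartzMap.denseRange_toLpCLM (F := ℂ) (E := Eucl d) (p := 2) (μ := volume)
        ENNReal.ofNat_ne_top) u ?_ ?_
    · exact isClosed_eq ((Lp.fourierTransformₗᵢ (Eucl d) ℂ).continuous.comp Φ.continuous)
        (Ψ.continuous.comp (Lp.fourierTransformₗᵢ (Eucl d) ℂ).continuous)
    · intro f
      rw [SchwartzMap.toLpCLM_apply]
      let g : SchwartzMap (Eucl d) ℂ := ((s⁻¹ : ℝ) : ℂ) • SchwartzMap.compSubConstCLM ℝ c
        (SchwartzMap.compCLMOfContinuousLinearEquiv ℝ T.symm f)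
      have hg : ∀ x, g x = ((s⁻¹ : ℝ) : ℂ) * f (T.symm (x - c)) := fun x => rfl
      have hΦg : Φ (f.toLp 2) = g.toLp 2 := by
        ext1
        have hq : Measure.QuasiMeasurePreserving (fun x => T.symm (x - c)) volume volume :=
          ⟨(T.symm.continuous.comp (continuous_id.sub continuous_const)).measurable,
            by rw [map_affine_volume]; exact Measure.smul_absolutelyContinuous⟩
        filter_upwards [hΦ (f.toLp 2), g.coeFn_toLp 2 volume,
          hq.ae_eq_comp (f.coeFn_toLp 2 volume)] with x h1 h2 h3
        simp only [Function.comp] at h3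
        rw [h1, h2, h3, hg]
      rw [hΦg, SchwartzMap.toLp_fourier_eq, SchwartzMap.toLp_fourier_eq]
      ext1
      have hqA : Measure.QuasiMeasurePreserving A volume volume :=
          ⟨A.continuous.measurable, by rw [hmapA]; exact Measure.smul_absolutelyContinuous⟩
      filter_upwards [hΨ ((𝓕 f).toLp 2), (𝓕 g).coeFn_toLp 2 volume,
        hqA.ae_eq_comp ((𝓕 f).coeFn_toLp 2 volume)] with ξ h1 h2 h3
      simp only [Function.comp] at h3
      rw [h1, h2, h3, SchwartzMap.fourier_coe, SchwartzMap.fourier_coe, Real.fourier_eq,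
        Real.fourier_eq]
      have h4 := integral_comp_affine T c
        (fun y => Real.fourierChar (-inner ℝ (T y + c) ξ) • (((s⁻¹ : ℝ) : ℂ) * f y))
      simp only [ContinuousLinearEquiv.apply_symm_apply, sub_add_cancel] at h4
      simp only [hg]
      rw [h4, ← integral_smul, ← integral_const_mul]
      congr 1
      ext y
      rw [hA, ContinuousLinearMap.adjoint_inner_right, inner_add_left, neg_add,
        AddChar.map_add_eq_mul, Circle.smul_def, Circle.smul_def, Circle.coe_mul,
        Complex.real_smul, ← hD, ← hsq]
      push_cast
      have : (s : ℂ) ≠ 0 := by exact_mod_cast hs0.ne'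
      simp only [smul_eq_mul]
      field_simp
  refine ⟨Φ, s, hs0, hsq, hΦ, fun u => ?_⟩
  rw [key]
  filter_upwards [hΨ (𝓕 u)] with ξ h
  rw [h, enorm_mul, enorm_mul, ← ofReal_norm (s : ℂ), Complex.norm_real,
    Real.norm_of_nonneg hs0.le, ← ofReal_norm (Real.fourierChar _ : ℂ), Circle.norm_coe]
  simp

end FourierL2

/-! ### The Sobolev space as the image of a closed subspace of `L²` -/

section EnergySpace

variable {d : ℕ}

/-- The symbol `|2πξ|^α` of the fractional Laplacian. -/
def fracSymbol (α : ℝ) (ξ : Eucl d) : ℝ := (2 * Real.pi * ‖ξ‖) ^ α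

theorem fracSymbol_nonneg (α : ℝ) (ξ : Eucl d) : 0 ≤ fracSymbol α ξ := by
  unfold fracSymbol; positivity

theorem measurable_fracSymbol (α : ℝ) : Measurable (fracSymbol (d := d) α) := by
  unfold fracSymbol; fun_prop

/-- The multiplier `(1 + |2πξ|^α)^{-1/2}`. -/
def besselMultiplier (α : ℝ) (ξ : Eucl d) : ℝ := (√(1 + fracSymbol α ξ))⁻¹

theorem besselMultiplier_pos (α : ℝ) (ξ : Eucl d) : 0 < besselMultiplier α ξ := by
  have := fracSymbol_nonneg α ξ
  unfold besselMultiplier; positivity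

theorem besselMultiplier_sq (α : ℝ) (ξ : Eucl d) :
    besselMultiplier α ξ ^ 2 * (1 + fracSymbol α ξ) = 1 := by
  have := fracSymbol_nonneg α ξ
  rw [besselMultiplier, inv_pow, Real.sq_sqrt (by positivity), inv_mul_cancel₀ (by positivity)]

theorem besselMultiplier_le_one (α : ℝ) (ξ : Eucl d) : besselMultiplier α ξ ≤ 1 := by
  have h := fracSymbol_nonneg α ξ
  exact inv_le_one_of_one_le₀ (Real.one_le_sqrt.2 (by linarith))

theorem measurable_besselMultiplier (α : ℝ) : Measurable (besselMultiplier (d := d) α) := by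
  have := measurable_fracSymbol (d := d) α
  unfold besselMultiplier; fun_prop

theorem memLp_besselMultiplier (α : ℝ) :
    MemLp (fun ξ : Eucl d => (besselMultiplier α ξ : ℂ)) ⊤ volume := by
  refine memLp_top_of_bound
    (Complex.measurable_ofReal.comp (measurable_besselMultiplier α)).aestronglyMeasurable 1 ?_
  refine Filter.Eventually.of_forall fun ξ => ?_
  rw [Complex.norm_real, Real.norm_of_nonneg (besselMultiplier_pos α ξ).le]
  exact besselMultiplier_le_one α ξ

/-- The operator `(1 + (-Δ)^{α/2})^{-1/2}` on `L²(ℝ^d)`. -/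
def besselPotential (α : ℝ) : L2 d →L[ℂ] L2 d :=
  ((Lp.fourierTransformₗᵢ (Eucl d) ℂ).symm.toLinearIsometry.toContinuousLinearMap).comp
    (mulOp _ (memLp_besselMultiplier α))

theorem fourier_besselPotential (α : ℝ) (h : L2 d) :
    (𝓕 (besselPotential α h) : L2 d) = mulOp _ (memLp_besselMultiplier α) h :=
  (Lp.fourierTransformₗᵢ (Eucl d) ℂ).apply_symm_apply _

theorem coeFn_fourier_besselPotential (α : ℝ) (h : L2 d) :
    (𝓕 (besselPotential α h) : L2 d) =ᵐ[volume] fun ξ => (besselMultiplier α ξ : ℂ) * h ξ := by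
  rw [fourier_besselPotential]
  exact coeFn_mulOp _ _ h

theorem enorm_fourier (u : L2 d) : ‖(𝓕 u : L2 d)‖ₑ = ‖u‖ₑ := by
  rw [← ofReal_norm, ← ofReal_norm, Lp.norm_fourier_eq]

/-- The multiplier `m` satisfies `m² (1 + |2πξ|^α) = 1`, so `besselPotential α` is an isometry from
`L²` with its own norm to the form norm. Approximation in `H₀^{α/2}` thus becomes approximation in
`L²`. -/
theorem enorm_sq_eq_add_sobolevEnergy (α : ℝ) (h : L2 d) :
    ‖h‖ₑ ^ 2 = ‖besselPotential α h‖ₑ ^ 2 + sobolevEnergy α (besselPotential α h) := by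
  rw [← enorm_fourier (besselPotential α h), enorm_sq_eq_lintegral, enorm_sq_eq_lintegral,
    sobolevEnergy, ← lintegral_add_left' ((Lp.aestronglyMeasurable _).enorm.pow_const 2)]
  refine lintegral_congr_ae ?_
  filter_upwards [coeFn_fourier_besselPotential α h] with ξ hξ
  have hs := fracSymbol_nonneg α ξ
  have hb := besselMultiplier_pos α ξ
  change _ = _ + ENNReal.ofReal (fracSymbol α ξ) * _
  rw [hξ, enorm_mul, ← ofReal_norm (besselMultiplier α ξ : ℂ), Complex.norm_real,
    Real.norm_of_nonneg hb.le, ← one_add_mul, mul_pow, ← ENNReal.ofReal_pow hb.le,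
    ← ENNReal.ofReal_one, ← ENNReal.ofReal_add zero_le_one hs, ← mul_assoc,
    ← ENNReal.ofReal_mul (by positivity), mul_comm (1 + _), besselMultiplier_sq]
  simp

theorem exists_besselPotential_eq {α : ℝ} {u : L2 d} (hu : sobolevEnergy α u ≠ ⊤) :
    ∃ h : L2 d, besselPotential α h = u := by
  have hm : AEStronglyMeasurable
      (fun ξ => ((besselMultiplier α ξ)⁻¹ : ℂ) * (𝓕 u : L2 d) ξ) volume := by
    refine AEStronglyMeasurable.mul ?_ (Lp.aestronglyMeasurable _)
    exact (Complex.measurable_ofReal.comp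
      (measurable_besselMultiplier α)).inv.aestronglyMeasurable
  have hL : MemLp (fun ξ => ((besselMultiplier α ξ)⁻¹ : ℂ) * (𝓕 u : L2 d) ξ) 2 volume := by
    rw [memLp_two_iff_lintegral hm]
    have : ∫⁻ ξ, ‖((besselMultiplier α ξ)⁻¹ : ℂ) * (𝓕 u : L2 d) ξ‖ₑ ^ 2 =
        ‖(𝓕 u : L2 d)‖ₑ ^ 2 + sobolevEnergy α u := by
      rw [enorm_sq_eq_lintegral, sobolevEnergy,
        ← lintegral_add_left' ((Lp.aestronglyMeasurable _).enorm.pow_const 2)]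
      refine lintegral_congr fun ξ => ?_
      have hs := fracSymbol_nonneg α ξ
      have hb := besselMultiplier_pos α ξ
      change _ = _ + ENNReal.ofReal (fracSymbol α ξ) * _
      rw [enorm_mul, ← ofReal_norm (_⁻¹ : ℂ), norm_inv, Complex.norm_real,
        Real.norm_of_nonneg hb.le, ← one_add_mul, mul_pow, ← ENNReal.ofReal_pow (by positivity),
        ← ENNReal.ofReal_one, ← ENNReal.ofReal_add zero_le_one hs, inv_pow,
        inv_eq_of_mul_eq_one_right (besselMultiplier_sq α ξ)]
    rw [this]
    exact ENNReal.add_lt_top.2 ⟨ENNReal.pow_lt_top enorm_lt_top, hu.lt_top⟩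
  refine ⟨hL.toLp _, (Lp.fourierTransformₗᵢ (Eucl d) ℂ).injective ?_⟩
  change (𝓕 (besselPotential α (hL.toLp _)) : L2 d) = 𝓕 u
  ext1
  filter_upwards [coeFn_fourier_besselPotential α (hL.toLp _), hL.coeFn_toLp] with ξ h1 h2
  rw [h1, h2, mul_inv_cancel_left₀]
  exact_mod_cast (besselMultiplier_pos α ξ).ne'

theorem besselPotential_injective (α : ℝ) : Function.Injective (besselPotential (d := d) α) := by
  rw [injective_iff_map_eq_zero]
  intro h hh
  have h1 := enorm_sq_eq_add_sobolevEnergy α h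
  have h2 : sobolevEnergy α (0 : L2 d) = 0 := by
    have h3 : (𝓕 (0 : L2 d) : L2 d) = 0 := (Lp.fourierTransformₗᵢ (Eucl d) ℂ).map_zero
    rw [sobolevEnergy, h3]
    refine (lintegral_congr_ae (g := fun _ => 0) ?_).trans lintegral_zero
    filter_upwards [Lp.coeFn_zero ℂ 2 (volume : Measure (Eucl d))] with ξ hξ
    rw [hξ]
    simp
  rw [hh, h2] at h1
  simpa using h1

/-- This is `|2πξ|^α m² = 1 - m²` under the integral. It translates the weak eigenvalue equation
into one for the operator `J*J` of the embedding. -/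
theorem fractionalForm_besselPotential (α : ℝ) (h g : L2 d) :
    fractionalForm α (besselPotential α h) (besselPotential α g) =
      inner ℂ g h - inner ℂ (besselPotential α g) (besselPotential α h) := by
  rw [← Lp.inner_fourier_eq (besselPotential α g) (besselPotential α h), L2.inner_def, L2.inner_def,
    ← integral_sub (L2.integrable_inner g h) (L2.integrable_inner _ _), fractionalForm]
  refine integral_congr_ae ?_
  filter_upwards [coeFn_fourier_besselPotential α h, coeFn_fourier_besselPotential α g]
    with ξ h1 h2
  change (fracSymbol α ξ : ℂ) * _ = _
  have hb : (besselMultiplier α ξ : ℂ) ^ 2 * (1 + fracSymbol α ξ) = 1 := by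
    exact_mod_cast besselMultiplier_sq α ξ
  rw [h1, h2]
  simp only [RCLike.inner_apply, map_mul, Complex.conj_ofReal]
  linear_combination (h ξ * conj (g ξ)) * hb

theorem fractionalForm_self (α : ℝ) (u : L2 d) (hu : sobolevEnergy α u ≠ ⊤) :
    fractionalForm α u u = ((sobolevEnergy α u).toReal : ℂ) := by
  obtain ⟨h, rfl⟩ := exists_besselPotential_eq hu
  rw [fractionalForm_besselPotential, inner_self_eq_norm_sq_to_K, inner_self_eq_norm_sq_to_K]
  have h1 := congrArg ENNReal.toReal (enorm_sq_eq_add_sobolevEnergy α h)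
  rw [ENNReal.toReal_add (ENNReal.pow_lt_top enorm_lt_top).ne hu, ENNReal.toReal_pow,
    ENNReal.toReal_pow, toReal_enorm, toReal_enorm] at h1
  have h2 : (sobolevEnergy α (besselPotential α h)).toReal =
      ‖h‖ ^ 2 - ‖besselPotential α h‖ ^ 2 := by linarith
  rw [h2]
  push_cast
  rfl

/-- The test functions on `Ω`, as a subspace of `L²`. -/
def testSubmodule (Ω : Set (Eucl d)) : Submodule ℂ (L2 d) where
  carrier := {u | IsTestFunction Ω u}
  add_mem' := by
    rintro u v ⟨f, hf, hfc, hfs, hfu⟩ ⟨g, hg, hgc, hgs, hgu⟩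
    refine ⟨f + g, hf.add hg, hfc.add hgc,
      (tsupport_add f g).trans (Set.union_subset hfs hgs), ?_⟩
    exact (Lp.coeFn_add u v).trans (hfu.add hgu)
  zero_mem' := ⟨0, contDiff_const, HasCompactSupport.zero, by simp [tsupport], Lp.coeFn_zero _ _ _⟩
  smul_mem' := by
    rintro c u ⟨f, hf, hfc, hfs, hfu⟩
    refine ⟨fun x => c • f x, hf.const_smul c, hfc.smul_left (f := fun _ => c),
      (closure_mono (Function.support_const_smul_subset c f)).trans hfs, ?_⟩
    exact (Lp.coeFn_smul c u).trans (hfu.const_smul c)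

theorem sobolevEnergy_lt_top_of_isTestFunction {α : ℝ} (hα : 0 < α) (hα2 : α ≤ 2)
    {Ω : Set (Eucl d)} {u : L2 d} (hu : IsTestFunction Ω u) : sobolevEnergy α u ≠ ⊤ := by
  obtain ⟨f, hf, hfc, -, hfu⟩ := hu
  let F : SchwartzMap (Eucl d) ℂ := hfc.toSchwartzMap hf
  have hFu : u = F.toLp 2 := by
    ext1
    exact hfu.trans (F.coeFn_toLp 2 volume).symm
  have h1 : (𝓕 u : L2 d) =ᵐ[volume] (𝓕 F : SchwartzMap (Eucl d) ℂ) := by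
    rw [hFu, SchwartzMap.toLp_fourier_eq]
    exact (𝓕 F).coeFn_toLp 2 volume
  obtain ⟨C, hC0, hC⟩ := (𝓕 F).decay 0 0
  have h2 : Integrable (fun ξ => C * ‖(𝓕 F) ξ‖ + (2 * Real.pi) ^ 2 * C * (‖ξ‖ ^ 2 * ‖(𝓕 F) ξ‖))
      (volume : Measure (Eucl d)) :=
    ((𝓕 F).integrable.norm.const_mul C).add (((𝓕 F).integrable_pow_mul volume 2).const_mul _)
  refine ne_top_of_le_ne_top h2.lintegral_lt_top.ne ?_
  unfold sobolevEnergy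
  refine lintegral_mono_ae ?_
  filter_upwards [h1] with ξ hξ
  rw [hξ, ← ofReal_norm, ← ENNReal.ofReal_pow (norm_nonneg _), ← ENNReal.ofReal_mul (by positivity)]
  refine ENNReal.ofReal_le_ofReal ?_
  have h3 : ‖(𝓕 F) ξ‖ ≤ C := by simpa using hC ξ
  -- With `0 < α ≤ 2` the symbol is at most 1 on low frequencies and at most the symbol of `-Δ` on
  -- high ones.
  have h4 : (2 * Real.pi * ‖ξ‖) ^ α ≤ 1 + (2 * Real.pi * ‖ξ‖) ^ 2 := by
    have h0 : 0 ≤ 2 * Real.pi * ‖ξ‖ := by positivity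
    rcases le_total (2 * Real.pi * ‖ξ‖) 1 with h | h
    · have := Real.rpow_le_one h0 h hα.le
      nlinarith [sq_nonneg (2 * Real.pi * ‖ξ‖)]
    · have := Real.rpow_le_rpow_of_exponent_le h hα2
      rw [Real.rpow_two] at this
      linarith
  calc (2 * Real.pi * ‖ξ‖) ^ α * ‖(𝓕 F) ξ‖ ^ 2
      ≤ (1 + (2 * Real.pi * ‖ξ‖) ^ 2) * (C * ‖(𝓕 F) ξ‖) := by
        refine mul_le_mul h4 ?_ (by positivity) (by positivity)
        nlinarith [norm_nonneg ((𝓕 F) ξ)]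
    _ = _ := by ring

/-- The closed subspace of `L²` that `besselPotential α` maps onto `H₀^{α/2}(Ω)`. -/
def energySpace (α : ℝ) (Ω : Set (Eucl d)) : Submodule ℂ (L2 d) :=
  ((testSubmodule Ω).comap (besselPotential α).toLinearMap).topologicalClosure

instance (α : ℝ) (Ω : Set (Eucl d)) : CompleteSpace (energySpace α Ω) :=
  (Submodule.isClosed_topologicalClosure _).completeSpace_coe

theorem mem_energySpace_iff {α : ℝ} {Ω : Set (Eucl d)} {h : L2 d} :
    h ∈ energySpace α Ω ↔
      ∀ ε : ℝ≥0∞, 0 < ε → ∃ g, IsTestFunction Ω (besselPotential α g) ∧ ‖h - g‖ₑ ^ 2 < ε := by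
  rw [energySpace, ← SetLike.mem_coe, Submodule.topologicalClosure_coe, EMetric.mem_closure_iff]
  constructor
  · intro H ε hε
    -- A distance of at most 1 dominates its own square.
    obtain ⟨g, hg, hd⟩ := H (min ε 1) (lt_min hε one_pos)
    refine ⟨g, hg, ?_⟩
    rw [edist_eq_enorm_sub] at hd
    calc ‖h - g‖ₑ ^ 2 ≤ ‖h - g‖ₑ * 1 := by
          rw [sq]; gcongr; exact (hd.trans_le (min_le_right _ _)).le
      _ < ε := by rw [mul_one]; exact hd.trans_le (min_le_left _ _)
  · intro H ε hε
    obtain ⟨g, hg, hd⟩ := H (ε ^ 2) (by positivity)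
    refine ⟨g, hg, ?_⟩
    rw [edist_eq_enorm_sub]
    exact (ENNReal.pow_right_strictMono two_ne_zero).lt_iff_lt.1 hd

theorem mem_sobolevZero_iff {α : ℝ} (hα : 0 < α) (hα2 : α ≤ 2) {Ω : Set (Eucl d)} {u : L2 d} :
    u ∈ sobolevZero α Ω ↔ ∃ h ∈ energySpace α Ω, besselPotential α h = u := by
  constructor
  · intro hu
    -- The tolerance 1 serves only to show that `u` differs from a test function by something of
    -- finite energy, which puts `u` in the range of `besselPotential α`.
    obtain ⟨φ, hφ, hlt⟩ := hu 1 one_pos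
    obtain ⟨h₁, hh₁⟩ := exists_besselPotential_eq (α := α) (u := u - φ)
      (ne_top_of_le_ne_top ENNReal.one_ne_top (le_add_self.trans hlt.le))
    obtain ⟨h₂, hh₂⟩ := exists_besselPotential_eq
      (sobolevEnergy_lt_top_of_isTestFunction hα hα2 hφ)
    have hu' : besselPotential α (h₁ + h₂) = u := by rw [map_add, hh₁, hh₂, sub_add_cancel]
    refine ⟨h₁ + h₂, mem_energySpace_iff.2 fun ε hε => ?_, hu'⟩
    obtain ⟨ψ, hψ, hlt⟩ := hu ε hε
    obtain ⟨g, hg⟩ := exists_besselPotential_eq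
      (sobolevEnergy_lt_top_of_isTestFunction hα hα2 hψ)
    refine ⟨g, by rwa [hg], ?_⟩
    rwa [enorm_sq_eq_add_sobolevEnergy α, map_sub, hu', hg]
  · rintro ⟨h, hh, rfl⟩ ε hε
    obtain ⟨g, hg, hlt⟩ := mem_energySpace_iff.1 hh ε hε
    refine ⟨_, hg, ?_⟩
    rwa [← map_sub, ← enorm_sq_eq_add_sobolevEnergy]

theorem sobolevEnergy_ne_top_of_mem {α : ℝ} (hα : 0 < α) (hα2 : α ≤ 2) {Ω : Set (Eucl d)} {u : L2 d}
    (hu : u ∈ sobolevZero α Ω) : sobolevEnergy α u ≠ ⊤ := by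
  obtain ⟨h, -, rfl⟩ := (mem_sobolevZero_iff hα hα2).1 hu
  refine ne_top_of_le_ne_top (ENNReal.pow_lt_top (n := 2) (enorm_lt_top (x := h))).ne ?_
  rw [enorm_sq_eq_add_sobolevEnergy α h]
  exact le_add_self

theorem memLp_indicator_one {s : Set (Eucl d)} (hs : MeasurableSet s) :
    MemLp (s.indicator fun _ => (1 : ℂ)) ⊤ volume :=
  memLp_top_of_bound ((measurable_const.indicator hs).aestronglyMeasurable) 1
    (Filter.Eventually.of_forall fun x => (norm_indicator_le_norm_self _ x).trans (by simp))

/-- Multiplication by the indicator function of a set. -/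
def cutoff (s : Set (Eucl d)) (hs : MeasurableSet s) : L2 d →L[ℂ] L2 d :=
  mulOp _ (memLp_indicator_one hs)

theorem coeFn_cutoff (s : Set (Eucl d)) (hs : MeasurableSet s) (u : L2 d) :
    cutoff s hs u =ᵐ[volume] s.indicator u := by
  filter_upwards [coeFn_mulOp _ (memLp_indicator_one hs) u] with x hx
  rw [cutoff, hx]
  by_cases h : x ∈ s <;> simp [h]

theorem cutoff_eq_self_iff (s : Set (Eucl d)) (hs : MeasurableSet s) (u : L2 d) :
    cutoff s hs u = u ↔ ∀ᵐ x, x ∉ s → u x = 0 := by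
  constructor
  · intro h
    have h1 := coeFn_cutoff s hs u
    rw [h] at h1
    filter_upwards [h1] with x hx hxs
    rw [hx, Set.indicator_of_notMem hxs]
  · intro h
    ext1
    filter_upwards [h, coeFn_cutoff s hs u] with x hx h1
    rw [h1]
    by_cases hxs : x ∈ s
    · simp [hxs]
    · simp [hxs, hx hxs]

/-- Vanishing outside `Ω` is a closed condition that holds for test functions, so it passes to all
of `H₀^{α/2}(Ω)`. -/
theorem cutoff_besselPotential {α : ℝ} {Ω : Set (Eucl d)} (hΩ : MeasurableSet Ω) {h : L2 d}
    (hh : h ∈ energySpace α Ω) : cutoff Ω hΩ (besselPotential α h) = besselPotential α h := by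
  have hcl : IsClosed {h : L2 d | cutoff Ω hΩ (besselPotential α h) = besselPotential α h} :=
    isClosed_eq ((cutoff Ω hΩ).continuous.comp (besselPotential α).continuous)
      (besselPotential α).continuous
  refine closure_minimal ?_ hcl hh
  rintro g ⟨f, -, -, hfs, hfu⟩
  change cutoff Ω hΩ (besselPotential α g) = besselPotential α g
  rw [cutoff_eq_self_iff]
  filter_upwards [hfu] with x hx hxs
  rw [ContinuousLinearMap.coe_coe] at hx
  rw [hx]
  exact image_eq_zero_of_notMem_tsupport fun h => hxs (hfs h)

/-- Test functions are dense in `L²(Ω)`. -/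
theorem eq_zero_of_forall_inner_testFunction {Ω : Set (Eucl d)} (hΩ : IsOpen Ω) {f : L2 d}
    (hf : ∀ᵐ x, x ∉ Ω → f x = 0) (h : ∀ φ, IsTestFunction Ω φ → inner ℂ φ f = 0) : f = 0 := by
  have h1 : ∀ᵐ x, x ∈ Ω → f x = 0 := by
    refine hΩ.ae_eq_zero_of_integral_contDiff_smul_eq_zero
      (((Lp.memLp f).locallyIntegrable (by norm_num)).locallyIntegrableOn Ω) ?_
    intro g hg hgc hgs
    have hgc' : HasCompactSupport (fun x => (g x : ℂ)) := hgc.comp_left (g := Complex.ofReal) rfl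
    have hgd : ContDiff ℝ ∞ (fun x => (g x : ℂ)) := Complex.ofRealCLM.contDiff.comp hg
    let G : SchwartzMap (Eucl d) ℂ := hgc'.toSchwartzMap hgd
    have h2 := h (G.toLp 2) ⟨_, hgd, hgc', ?_, G.coeFn_toLp 2 volume⟩
    · rw [L2.inner_def] at h2
      rw [← h2]
      refine integral_congr_ae ?_
      filter_upwards [G.coeFn_toLp 2 volume] with x hx
      rw [hx]
      change _ = inner ℂ (g x : ℂ) _
      simp [mul_comm]
    · refine (closure_mono ?_).trans hgs
      intro x hx
      simpa using hx
  ext1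
  filter_upwards [hf, h1, Lp.coeFn_zero ℂ 2 (volume : Measure (Eucl d))] with x h2 h3 h4
  rw [h4]
  by_cases hx : x ∈ Ω
  · exact h3 hx
  · exact h2 hx

end EnergySpace

/-! ### Compactness of the embedding of the Sobolev space -/

section Compactness

open Filter Topology

variable {d : ℕ}

theorem integrable_cutoff {Ω : Set (Eucl d)} (hΩ : MeasurableSet Ω) (hV : volume Ω ≠ ⊤) (u : L2 d) :
    Integrable (cutoff Ω hΩ u) volume := by
  have h1 : IntegrableOn u Ω volume := by
    have : IsFiniteMeasure (volume.restrict Ω) := ⟨by simpa using hV.lt_top⟩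
    exact ((Lp.memLp u).restrict Ω).integrable (by norm_num)
  exact (h1.integrable_indicator hΩ).congr (coeFn_cutoff Ω hΩ u).symm

/-- At a fixed frequency the transform is, up to conjugation, an inner product with a plane wave
restricted to `Ω`, whose squared norm is the volume of `Ω`; Bessel's inequality does the rest.
Integrated over a set of frequencies this bounds a Hilbert–Schmidt norm. -/
theorem sum_enorm_sq_fourier_cutoff_le {Ω : Set (Eucl d)} (hΩ : MeasurableSet Ω)
    (hV : volume Ω ≠ ⊤) {ι : Type*} {v : ι → L2 d} (hv : Orthonormal ℂ v) (F : Finset ι)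
    (ξ : Eucl d) :
    ∑ i ∈ F, ‖𝓕 (cutoff Ω hΩ (v i) : Eucl d → ℂ) ξ‖ₑ ^ 2 ≤ volume Ω := by
  have hm : MemLp (Ω.indicator fun x => (Real.fourierChar (inner ℝ x ξ) : ℂ)) 2 volume := by
    rw [memLp_indicator_iff_restrict hΩ]
    have : IsFiniteMeasure (volume.restrict Ω) := ⟨by simpa using hV.lt_top⟩
    refine MemLp.of_bound (by fun_prop) 1 (Eventually.of_forall fun x => ?_)
    rw [Circle.norm_coe]
  have h1 : ∀ i, ‖𝓕 (cutoff Ω hΩ (v i) : Eucl d → ℂ) ξ‖ = ‖inner ℂ (v i) (hm.toLp _)‖ := by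
    intro i
    rw [← inner_conj_symm, RCLike.norm_conj, L2.inner_def, Real.fourier_eq]
    congr 1
    refine integral_congr_ae ?_
    filter_upwards [hm.coeFn_toLp, coeFn_cutoff Ω hΩ (v i)] with x h1 h2
    rw [h1, h2, Circle.smul_def]
    by_cases hx : x ∈ Ω
    · simp [hx, AddChar.map_neg_eq_inv, mul_comm]
    · simp [hx]
  have h2 : ‖hm.toLp _‖ₑ ^ 2 = volume Ω := by
    rw [enorm_sq_eq_lintegral, ← lintegral_indicator_one hΩ]
    refine lintegral_congr_ae ?_
    filter_upwards [hm.coeFn_toLp] with x hx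
    rw [hx]
    by_cases hx : x ∈ Ω
    · rw [Set.indicator_of_mem hx, Set.indicator_of_mem hx, ← ofReal_norm, Circle.norm_coe]
      simp
    · simp [hx]
  rw [← h2, ← ofReal_norm, ← ENNReal.ofReal_pow (norm_nonneg _)]
  refine le_trans (le_of_eq ?_) (ENNReal.ofReal_le_ofReal
    (hv.sum_inner_products_le (hm.toLp _) (s := F)))
  rw [ENNReal.ofReal_sum_of_nonneg fun i _ => sq_nonneg _]
  refine Finset.sum_congr rfl fun i _ => ?_
  rw [← h1, ENNReal.ofReal_pow (norm_nonneg _), ofReal_norm]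

/-- Localization in space and in frequency is a compact operator. -/
theorem isCompactOperator_cutoff_fourier_cutoff {Ω B : Set (Eucl d)} (hΩ : MeasurableSet Ω)
    (hV : volume Ω ≠ ⊤) (hB : MeasurableSet B) (hBV : volume B ≠ ⊤) :
    IsCompactOperator ((cutoff B hB).comp
      ((Lp.fourierTransformₗᵢ (Eucl d) ℂ).toLinearIsometry.toContinuousLinearMap.comp
        (cutoff Ω hΩ))) := by
  obtain ⟨w, b, -⟩ := exists_hilbertBasis ℂ (L2 d)
  refine isCompactOperator_of_sum_norm_sq_le b _ (C := (volume Ω * volume B).toReal) fun F => ?_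
  have h1 : ∀ i, ‖cutoff B hB (𝓕 (cutoff Ω hΩ (b i)) : L2 d)‖ₑ ^ 2 =
      ∫⁻ ξ in B, ‖𝓕 (cutoff Ω hΩ (b i) : Eucl d → ℂ) ξ‖ₑ ^ 2 := by
    intro i
    rw [enorm_sq_eq_lintegral, ← lintegral_indicator hB]
    refine lintegral_congr_ae ?_
    filter_upwards [coeFn_cutoff B hB (𝓕 (cutoff Ω hΩ (b i)) : L2 d),
      fourier_ae_eq_of_integrable _ (integrable_cutoff hΩ hV (b i))] with ξ h1 h2
    rw [h1]
    by_cases hξ : ξ ∈ B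
    · simp [hξ, h2]
    · simp [hξ]
  have h2 : ∑ i ∈ F, ‖cutoff B hB (𝓕 (cutoff Ω hΩ (b i)) : L2 d)‖ₑ ^ 2 ≤
      volume Ω * volume B := by
    simp_rw [h1]
    rw [← lintegral_finsetSum']
    · refine (lintegral_mono fun ξ =>
        sum_enorm_sq_fourier_cutoff_le hΩ hV b.orthonormal F ξ).trans ?_
      simp
    · intro i _
      refine AEMeasurable.pow_const (Continuous.aemeasurable ?_).enorm 2
      exact VectorFourier.fourierIntegral_continuous Real.continuous_fourierChar
        (innerSL ℝ).continuous₂ (integrable_cutoff hΩ hV (b i))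
  refine le_trans (le_of_eq ?_) (ENNReal.toReal_mono (ENNReal.mul_ne_top hV hBV) h2)
  rw [ENNReal.toReal_sum fun i _ => (ENNReal.pow_lt_top enorm_lt_top).ne]
  refine Finset.sum_congr rfl fun i _ => ?_
  rw [ENNReal.toReal_pow, toReal_enorm]
  rfl

/-- `besselPotential α` followed by removal of the frequencies in the ball of radius `R` has small
norm. -/
theorem norm_fourier_sub_cutoff_le {α : ℝ} (hα : 0 ≤ α) {R : ℝ} (hR : 0 ≤ R) (h : L2 d) :
    ‖(𝓕 (besselPotential α h) : L2 d) - cutoff (Metric.closedBall 0 R) measurableSet_closedBall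
      (𝓕 (besselPotential α h))‖ ≤ (√(1 + (2 * Real.pi * R) ^ α))⁻¹ * ‖h‖ := by
  refine Lp.norm_le_mul_norm_of_ae_le_mul ?_
  filter_upwards [Lp.coeFn_sub (𝓕 (besselPotential α h) : L2 d)
    (cutoff (Metric.closedBall 0 R) measurableSet_closedBall (𝓕 (besselPotential α h))),
    coeFn_cutoff (Metric.closedBall 0 R) measurableSet_closedBall (𝓕 (besselPotential α h)),
    coeFn_fourier_besselPotential α h] with ξ h1 h2 h3
  rw [h1, Pi.sub_apply, h2]
  by_cases hξ : ξ ∈ Metric.closedBall 0 R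
  · rw [Set.indicator_of_mem hξ, sub_self, norm_zero]
    positivity
  · rw [Set.indicator_of_notMem hξ, sub_zero, h3, norm_mul, Complex.norm_real,
      Real.norm_of_nonneg (besselMultiplier_pos α ξ).le]
    refine mul_le_mul_of_nonneg_right ?_ (norm_nonneg _)
    rw [Metric.mem_closedBall, dist_zero_right, not_le] at hξ
    unfold besselMultiplier fracSymbol
    gcongr

/-- The embedding of `H₀^{α/2}(Ω)` in `L²` is compact when `Ω` has finite volume. -/
theorem isCompactOperator_besselPotential {α : ℝ} (hα : 0 < α) {Ω : Set (Eucl d)}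
    (hΩ : MeasurableSet Ω) (hV : volume Ω ≠ ⊤) :
    IsCompactOperator ((besselPotential α).comp (energySpace α Ω).subtypeL) := by
  let Fi : L2 d →L[ℂ] L2 d :=
    (Lp.fourierTransformₗᵢ (Eucl d) ℂ).symm.toLinearIsometry.toContinuousLinearMap
  let J : energySpace α Ω →L[ℂ] L2 d := (besselPotential α).comp (energySpace α Ω).subtypeL
  -- Restriction to `Ω` does not affect the range of `J`, so `Fi ∘ A n ∘ J` only discards the
  -- frequencies beyond `n`. It is compact, and its distance to `J` is at most `(1 +
  -- (2πn)^α)^(-1/2)`.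
  let A : ℕ → L2 d →L[ℂ] L2 d := fun n =>
    (cutoff (Metric.closedBall 0 n) measurableSet_closedBall).comp
      ((Lp.fourierTransformₗᵢ (Eucl d) ℂ).toLinearIsometry.toContinuousLinearMap.comp
        (cutoff Ω hΩ))
  have hA : ∀ n, IsCompactOperator ((Fi.comp (A n)).comp J) := fun n =>
    ((isCompactOperator_cutoff_fourier_cutoff hΩ hV measurableSet_closedBall
      measure_closedBall_lt_top.ne).clm_comp Fi).comp_clm J
  refine isCompactOperator_of_tendsto (l := atTop) (F := fun n => (Fi.comp (A n)).comp J) ?_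
    (Eventually.of_forall hA)
  refine (tendsto_iff_norm_sub_tendsto_zero (E := energySpace α Ω →L[ℂ] L2 d)).2 ?_
  have hlim : Tendsto (fun n : ℕ => (√(1 + (2 * Real.pi * (n : ℝ)) ^ α))⁻¹) atTop (𝓝 0) := by
    refine Tendsto.inv_tendsto_atTop (Real.tendsto_sqrt_atTop.comp ?_)
    refine tendsto_atTop_add_const_left _ _ ((tendsto_rpow_atTop hα).comp ?_)
    exact tendsto_natCast_atTop_atTop.const_mul_atTop (by positivity)
  refine squeeze_zero (fun n => ContinuousLinearMap.opNorm_nonneg _) (fun n => ?_) hlim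
  refine ContinuousLinearMap.opNorm_le_bound _ (by positivity) fun h => ?_
  have h1 := norm_fourier_sub_cutoff_le hα.le (Nat.cast_nonneg n) (h : L2 d)
  have h2 : ((Fi.comp (A n)).comp J - J) h = -Fi ((𝓕 (besselPotential α (h : L2 d)) : L2 d) -
      cutoff (Metric.closedBall 0 n) measurableSet_closedBall
        (𝓕 (besselPotential α (h : L2 d)))) := by
    have h3 : Fi (𝓕 (besselPotential α (h : L2 d)) : L2 d) = besselPotential α (h : L2 d) :=
      (Lp.fourierTransformₗᵢ (Eucl d) ℂ).symm_apply_apply _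
    rw [map_sub, h3, neg_sub]
    change Fi (cutoff (Metric.closedBall 0 n) measurableSet_closedBall
      (𝓕 (cutoff Ω hΩ (besselPotential α (h : L2 d))) : L2 d)) - _ = _
    rw [cutoff_besselPotential hΩ h.2]
    rfl
  change ‖((Fi.comp (A n)).comp J - J) h‖ ≤ _
  rw [h2, norm_neg]
  refine le_trans (le_of_eq ?_) h1
  exact (Lp.fourierTransformₗᵢ (Eucl d) ℂ).symm.norm_map _

/-- `L²(Ω)` contains a nonzero function orthogonal to any given finite family. -/
theorem exists_ne_zero_forall_inner_eq_zero [NeZero d] {Ω : Set (Eucl d)} (hΩ : IsOpen Ω)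
    (hne : Ω.Nonempty) {k : ℕ} (v : Fin k → L2 d) :
    ∃ f : L2 d, f ≠ 0 ∧ (∀ᵐ x, x ∉ Ω → f x = 0) ∧ ∀ i, inner ℂ (v i) f = 0 := by
  classical
  have : Nonempty (Fin d) := ⟨0⟩
  have hinf : Ω.Infinite := infinite_of_mem_nhds _ (hΩ.mem_nhds hne.some_mem)
  obtain ⟨t, htΩ, htc⟩ := hinf.exists_subset_card_eq (k + 1)
  obtain ⟨U, hU, hUd⟩ := t.finite_toSet.t2_separation
  let s : t → Set (Eucl d) := fun x => U x ∩ Ω ∩ Metric.ball (x : Eucl d) 1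
  have hso : ∀ x, IsOpen (s x) := fun x => ((hU x).2.inter hΩ).inter Metric.isOpen_ball
  have hsm : ∀ x, MeasurableSet (s x) := fun x => (hso x).measurableSet
  have hs0 : ∀ x, volume (s x) ≠ 0 := fun x =>
    ((hso x).measure_pos volume ⟨x, ⟨(hU x).1, htΩ x.2⟩, by simp⟩).ne'
  have hst : ∀ x, volume (s x) ≠ ⊤ := fun x =>
    ne_top_of_le_ne_top measure_ball_lt_top.ne (measure_mono Set.inter_subset_right)
  have hsd : ∀ x y, x ≠ y → Disjoint (s x) (s y) := fun x y hxy => by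
    have := hUd x.2 y.2 (fun h => hxy (Subtype.ext h))
    exact this.mono (fun z hz => hz.1.1) (fun z hz => hz.1.1)
  let g : t → L2 d := fun x => indicatorConstLp 2 (hsm x) (hst x) (1 : ℂ)
  -- Orthogonality to `k` vectors imposes `k` linear conditions on combinations of `k + 1`
  -- indicators of disjoint subsets of `Ω`, so a nonzero combination survives.
  let L : (t → ℂ) →ₗ[ℂ] (Fin k → ℂ) :=
    { toFun := fun c i => inner ℂ (v i) (∑ x, c x • g x)
      map_add' := fun c c' => by
        ext i
        simp [add_smul, Finset.sum_add_distrib, inner_add_right]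
      map_smul' := fun a c => by
        ext i
        simp [mul_smul, ← Finset.smul_sum, inner_smul_right] }
  obtain ⟨c, hc, hc0⟩ := Submodule.exists_mem_ne_zero_of_ne_bot
    (LinearMap.ker_ne_bot_of_finrank_lt (f := L) (by simp [htc]))
  refine ⟨∑ x, c x • g x, ?_, ?_, fun i => congrFun hc i⟩
  · intro h0
    apply hc0
    ext y
    have h1 : inner ℂ (g y) (∑ x, c x • g x) = 0 := by rw [h0, inner_zero_right]
    rw [inner_sum, Finset.sum_eq_single y] at h1
    · rw [inner_smul_right, L2.inner_indicatorConstLp_indicatorConstLp] at h1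
      have h3 : volume.real (s y) ≠ 0 := (measureReal_ne_zero_iff (hst y)).2 (hs0 y)
      simpa [h3] using h1
    · intro x _ hxy
      rw [inner_smul_right, L2.inner_indicatorConstLp_indicatorConstLp,
        (hsd y x hxy.symm).inter_eq]
      simp
    · simp
  · rw [← cutoff_eq_self_iff Ω hΩ.measurableSet, map_sum]
    refine Finset.sum_congr rfl fun x _ => ?_
    rw [map_smul]
    congr 1
    rw [cutoff_eq_self_iff]
    filter_upwards [indicatorConstLp_coeFn (p := 2) (hs := hsm x) (hμs := hst x) (c := (1 : ℂ))]
      with y hy hyΩ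
    rw [hy, Set.indicator_of_notMem fun h => hyΩ h.1.2]

theorem eq_zero_of_forall_inner_besselPotential {α : ℝ} (hα : 0 < α) (hα2 : α ≤ 2)
    {Ω : Set (Eucl d)} (hΩ : IsOpen Ω) {f : L2 d} (hf : ∀ᵐ x, x ∉ Ω → f x = 0)
    (h : ∀ g ∈ energySpace α Ω, inner ℂ (besselPotential α g) f = 0) : f = 0 := by
  refine eq_zero_of_forall_inner_testFunction hΩ hf fun φ hφ => ?_
  obtain ⟨g, hg⟩ := exists_besselPotential_eq
    (sobolevEnergy_lt_top_of_isTestFunction hα hα2 hφ)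
  rw [← hg]
  refine h g (Submodule.le_topologicalClosure _ ?_)
  change IsTestFunction Ω (besselPotential α g)
  rwa [hg]

/-- In finite dimension some nonzero `f` in `L²(Ω)` would be orthogonal to all of `H₀^{α/2}(Ω)`,
against the density of test functions. This is what makes the list of eigenvalues infinite. -/
theorem not_finiteDimensional_energySpace [NeZero d] {α : ℝ} (hα : 0 < α) (hα2 : α ≤ 2)
    {Ω : Set (Eucl d)} (hΩ : IsOpen Ω) (hne : Ω.Nonempty) :
    ¬ FiniteDimensional ℂ (energySpace α Ω) := by
  intro hfin
  let b := Module.finBasis ℂ (energySpace α Ω)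
  obtain ⟨f, hf0, hfΩ, hf⟩ := exists_ne_zero_forall_inner_eq_zero hΩ hne
    (fun i => besselPotential α (b i : L2 d))
  refine hf0 (eq_zero_of_forall_inner_besselPotential hα hα2 hΩ hfΩ fun g hg => ?_)
  have h1 := b.sum_repr ⟨g, hg⟩
  have h2 := congrArg (fun t : energySpace α Ω => besselPotential α (t : L2 d)) h1
  simp only [Submodule.coe_sum, Submodule.coe_smul, map_sum, map_smul] at h2
  rw [← h2, sum_inner]
  refine Finset.sum_eq_zero fun i _ => ?_
  rw [inner_smul_left, hf, mul_zero]

end Compactness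

/-! ### The spectrum and the variational principle -/

section Spectrum

variable {d : ℕ}

theorem norm_sq_eq_add_sobolevEnergy (α : ℝ) (h : L2 d) :
    ‖h‖ ^ 2 = ‖besselPotential α h‖ ^ 2 + (sobolevEnergy α (besselPotential α h)).toReal := by
  have h1 := enorm_sq_eq_add_sobolevEnergy α h
  have h2 : sobolevEnergy α (besselPotential α h) ≠ ⊤ := by
    refine ne_top_of_le_ne_top (ENNReal.pow_lt_top (n := 2) (enorm_lt_top (x := h))).ne ?_
    rw [h1]
    exact le_add_self
  have h3 := congrArg ENNReal.toReal h1
  rwa [ENNReal.toReal_add (ENNReal.pow_lt_top enorm_lt_top).ne h2, ENNReal.toReal_pow,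
    ENNReal.toReal_pow, toReal_enorm, toReal_enorm] at h3

/-- The spectral theorem applied to `J*J`, where `J` is the compact injective embedding of the
energy space in `L²`. -/
theorem exists_energy_eigenbasis [NeZero d] {α : ℝ} (hα : 0 < α) (hα2 : α ≤ 2)
    {Ω : Set (Eucl d)} (hΩ : IsOpen Ω) (hne : Ω.Nonempty) (hV : volume Ω ≠ ⊤) :
    ∃ (b : HilbertBasis ℕ ℂ (energySpace α Ω)) (κ : ℕ → ℝ), Antitone κ ∧ (∀ k, 0 < κ k) ∧
      ∀ (k) (g : energySpace α Ω), inner ℂ (besselPotential α (b k : L2 d))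
        (besselPotential α (g : L2 d)) = (κ k : ℂ) * inner ℂ (b k) g := by
  let J : energySpace α Ω →L[ℂ] L2 d := (besselPotential α).comp (energySpace α Ω).subtypeL
  have hJ : IsCompactOperator J := isCompactOperator_besselPotential hα hΩ.measurableSet hV
  have hinner : ∀ x y, inner ℂ ((J.adjoint.comp J) x) y = inner ℂ (J x) (J y) := fun x y => by
    rw [ContinuousLinearMap.comp_apply, ContinuousLinearMap.adjoint_inner_left]
  obtain ⟨b, κ, h1, h2, h3⟩ := exists_hilbertBasis_eigenvectors (M := J.adjoint.comp J)
    (by rw [ContinuousLinearMap.coe_comp]; exact hJ.clm_comp _) (ContinuousLinearMap.isPositive_adjoint_comp_self J) (by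
      rw [injective_iff_map_eq_zero]
      intro x hx
      have h4 := hinner x x
      rw [hx, inner_zero_left, eq_comm, inner_self_eq_zero] at h4
      exact Subtype.ext (besselPotential_injective α (h4.trans (map_zero _).symm)))
    (not_finiteDimensional_energySpace hα hα2 hΩ hne)
  refine ⟨b, κ, h1, h2, fun k g => ?_⟩
  have h4 := hinner (b k) g
  rw [h3, inner_smul_left, Complex.conj_ofReal] at h4
  exact h4.symm

/-- A complete orthonormal system of eigenfunctions, with the expansions of the norm and of the
energy. -/
theorem exists_dirichlet_eigenbasis [NeZero d] {α : ℝ} (hα : 0 < α) (hα2 : α ≤ 2)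
    {Ω : Set (Eucl d)} (hΩ : IsOpen Ω) (hne : Ω.Nonempty) (hV : volume Ω ≠ ⊤) :
    ∃ (lam : ℕ → ℝ) (u : ℕ → L2 d), Monotone lam ∧ Orthonormal ℂ u ∧
      (∀ k, IsDirichletEigenfunction α Ω (lam k) (u k)) ∧
      (∀ f : L2 d, (∀ᵐ x : Eucl d, x ∉ Ω → f x = 0) → (∀ k, inner ℂ (u k) f = 0) → f = 0) ∧
      (∀ v ∈ sobolevZero α Ω, HasSum (fun k => ‖inner ℂ (u k) v‖ ^ 2) (‖v‖ ^ 2)) ∧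
      ∀ v ∈ sobolevZero α Ω,
        HasSum (fun k => lam k * ‖inner ℂ (u k) v‖ ^ 2) (sobolevEnergy α v).toReal := by
  obtain ⟨b, κ, hanti, hpos, hb⟩ := exists_energy_eigenbasis hα hα2 hΩ hne hV
  -- The images of the `b k` are orthogonal in `L²` with squared norms `κ k`, hence the
  -- normalization.
  set u : ℕ → L2 d := fun k => ((√(κ k))⁻¹ : ℂ) • besselPotential α (b k : L2 d) with hu
  have hs0 : ∀ k, (√(κ k) : ℂ) ≠ 0 := fun k => by exact_mod_cast (Real.sqrt_pos.2 (hpos k)).ne'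
  have hs2 : ∀ k, (√(κ k) : ℂ) * √(κ k) = κ k := fun k => by
    exact_mod_cast Real.mul_self_sqrt (hpos k).le
  have hin : ∀ k (g : energySpace α Ω), inner ℂ (u k) (besselPotential α (g : L2 d)) =
      (√(κ k) : ℂ) * inner ℂ (b k) g := by
    intro k g
    rw [hu, inner_smul_left, hb, map_inv₀, Complex.conj_ofReal, ← hs2]
    field_simp [hs0 k]
  have hort : Orthonormal ℂ u := by
    rw [orthonormal_iff_ite]
    intro i j
    conv_lhs => rw [hu]
    rw [inner_smul_right]
    change _ * inner ℂ (u i) _ = _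
    rw [hin, orthonormal_iff_ite.1 b.orthonormal]
    split_ifs with h
    · subst h
      field_simp [hs0 i]
    · simp
  have hmem : ∀ k, u k ∈ sobolevZero α Ω := fun k =>
    (mem_sobolevZero_iff hα hα2).2 ⟨_, (((√(κ k))⁻¹ : ℂ) • b k).2, by simp [hu]⟩
  have hnorm : ∀ g : energySpace α Ω, HasSum (fun k => ‖inner ℂ (b k) g‖ ^ 2) (‖g‖ ^ 2) := by
    intro g
    have h1 := b.hasSum_inner_mul_inner g g
    rw [inner_self_eq_norm_sq_to_K] at h1
    have h2 : ∀ k, inner ℂ g (b k) * inner ℂ (b k) g = ((‖inner ℂ (b k) g‖ ^ 2 : ℝ) : ℂ) := by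
      intro k
      rw [← inner_conj_symm g (b k), RCLike.conj_mul]
      push_cast
      rfl
    simp_rw [h2] at h1
    refine Complex.hasSum_ofReal.1 ?_
    convert h1 using 1
    all_goals (push_cast; rfl)
  have hnorm' : ∀ g : energySpace α Ω, HasSum (fun k => κ k * ‖inner ℂ (b k) g‖ ^ 2)
      (‖besselPotential α (g : L2 d)‖ ^ 2) := by
    intro g
    have h1 := (((b.hasSum_repr g).mapL
      ((besselPotential α).comp (energySpace α Ω).subtypeL)).mapL
        (innerSL ℂ (besselPotential α (g : L2 d))))
    have h2 : ∀ k, inner ℂ (besselPotential α (g : L2 d))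
        (((besselPotential α).comp (energySpace α Ω).subtypeL) (b.repr g k • b k)) =
        ((κ k * ‖inner ℂ (b k) g‖ ^ 2 : ℝ) : ℂ) := by
      intro k
      rw [map_smul, inner_smul_right, b.repr_apply_apply]
      change _ * inner ℂ (besselPotential α (g : L2 d)) (besselPotential α (b k : L2 d)) = _
      rw [← inner_conj_symm (besselPotential α (g : L2 d)), hb, map_mul, Complex.conj_ofReal, mul_left_comm, RCLike.mul_conj]
      push_cast
      rfl
    simp only [innerSL_apply_apply] at h1
    simp_rw [h2] at h1
    change HasSum _ (inner ℂ (besselPotential α (g : L2 d)) (besselPotential α (g : L2 d))) at h1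
    rw [inner_self_eq_norm_sq_to_K] at h1
    refine Complex.hasSum_ofReal.1 ?_
    convert h1 using 1
    all_goals (push_cast; rfl)
  have hsq : ∀ k (g : energySpace α Ω), ‖inner ℂ (u k) (besselPotential α (g : L2 d))‖ ^ 2 =
      κ k * ‖inner ℂ (b k) g‖ ^ 2 := by
    intro k g
    rw [hin, norm_mul, mul_pow, Complex.norm_real, Real.norm_of_nonneg (Real.sqrt_nonneg _),
      Real.sq_sqrt (hpos k).le]
  -- The form norm includes the `L²` norm: a unit vector `b k` has an image with squared `L²` norm
  -- `κ k` and energy `1 - κ k`, so the quotient is `1/κ k - 1`.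
  refine ⟨fun k => (κ k)⁻¹ - 1, u, ?_, hort, ?_, ?_, ?_, ?_⟩
  · intro i j hij
    have := inv_anti₀ (hpos j) (hanti hij)
    simpa using this
  · intro k
    refine ⟨hort.ne_zero k, hmem k, fun v hv => ?_⟩
    obtain ⟨g, hg, rfl⟩ := (mem_sobolevZero_iff hα hα2).1 hv
    have h1 := hin k ⟨g, hg⟩
    have h2 : u k = besselPotential α (((((√(κ k))⁻¹ : ℂ) • b k : energySpace α Ω)) : L2 d) := by
      simp [hu]
    have h3 : inner ℂ (besselPotential α g) (u k) =
        (√(κ k) : ℂ) * inner ℂ g (b k : L2 d) := by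
      rw [← inner_conj_symm, h1, map_mul, Complex.conj_ofReal]
      congr 1
      exact inner_conj_symm (𝕜 := ℂ) g (b k : L2 d)
    rw [h2, fractionalForm_besselPotential, ← h2, h3, Submodule.coe_smul, inner_smul_right]
    push_cast
    rw [← hs2]
    field_simp [hs0 k]
  · intro f hf hfu
    refine eq_zero_of_forall_inner_besselPotential hα hα2 hΩ hf fun g hg => ?_
    have h1 := ((b.hasSum_repr ⟨g, hg⟩).mapL
      ((besselPotential α).comp (energySpace α Ω).subtypeL)).mapL (innerSL ℂ f)
    have h2 : ∀ k, innerSL ℂ f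
        (((besselPotential α).comp (energySpace α Ω).subtypeL) (b.repr ⟨g, hg⟩ k • b k)) = 0 := by
      intro k
      have h3 := hfu k
      rw [hu, inner_smul_left, mul_eq_zero] at h3
      rw [map_smul, innerSL_apply_apply, inner_smul_right, ← inner_conj_symm]
      rcases h3 with h3 | h3
      · simp [hs0 k] at h3
      · change _ * conj (inner ℂ (besselPotential α (b k : L2 d)) f) = 0
        rw [h3]
        simp
    simp_rw [h2] at h1
    have h4 := h1.unique hasSum_zero
    rw [← inner_conj_symm]
    change inner ℂ f (besselPotential α g) = 0 at h4
    rw [h4, map_zero]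
  · intro v hv
    obtain ⟨g, hg, rfl⟩ := (mem_sobolevZero_iff hα hα2).1 hv
    simp_rw [hsq _ ⟨g, hg⟩]
    exact hnorm' ⟨g, hg⟩
  · intro v hv
    obtain ⟨g, hg, rfl⟩ := (mem_sobolevZero_iff hα hα2).1 hv
    -- The energy is the squared form norm minus the squared `L²` norm, and each of the two has its
    -- own Parseval expansion.
    have h1 := (hnorm ⟨g, hg⟩).sub (hnorm' ⟨g, hg⟩)
    have h2 := norm_sq_eq_add_sobolevEnergy α g
    rw [show (sobolevEnergy α (besselPotential α g)).toReal =
      ‖(⟨g, hg⟩ : energySpace α Ω)‖ ^ 2 - ‖besselPotential α g‖ ^ 2 by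
        rw [Submodule.coe_norm]; linarith]
    refine h1.congr_fun fun k => ?_
    rw [hsq _ ⟨g, hg⟩]
    have := (hpos k).ne'
    field_simp

theorem fractionalForm_conj_symm (α : ℝ) (u v : L2 d) :
    conj (fractionalForm α v u) = fractionalForm α u v := by
  rw [fractionalForm, fractionalForm, ← integral_conj]
  refine integral_congr_ae (Filter.Eventually.of_forall fun ξ => ?_)
  simp [mul_comm]

theorem IsDirichletEigenfunction.sobolevEnergy_eq {α : ℝ} (hα : 0 < α) (hα2 : α ≤ 2)
    {Ω : Set (Eucl d)} {t : ℝ} {u : L2 d} (h : IsDirichletEigenfunction α Ω t u) :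
    (sobolevEnergy α u).toReal = t * ‖u‖ ^ 2 := by
  have h1 := h.2.2 u h.2.1
  rw [fractionalForm_self α u (sobolevEnergy_ne_top_of_mem hα hα2 h.2.1),
    inner_self_eq_norm_sq_to_K] at h1
  refine Complex.ofReal_injective (h1.trans ?_)
  push_cast
  rfl

theorem IsDirichletEigenfunction.inner_eq_zero {α : ℝ} {Ω : Set (Eucl d)} {s t : ℝ} {u v : L2 d}
    (hu : IsDirichletEigenfunction α Ω s u) (hv : IsDirichletEigenfunction α Ω t v)
    (hst : s ≠ t) : inner ℂ u v = 0 := by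
  have h1 := hu.2.2 v hv.2.1
  have h2 := hv.2.2 u hu.2.1
  rw [← fractionalForm_conj_symm, h1, map_mul, Complex.conj_ofReal, inner_conj_symm] at h2
  have h3 : ((s : ℂ) - t) * inner ℂ u v = 0 := by rw [sub_mul, h2, sub_self]
  exact (mul_eq_zero.1 h3).resolve_left (sub_ne_zero.2 (by exact_mod_cast hst))

/-- The bathtub principle: weights between 0 and 1 of total mass `n` cost least when they fill the
first `n` places. Subtracting `lam n`, the first value left out of the sum, makes the terms before
it nonpositive and the others nonnegative. -/
theorem sum_range_le_of_hasSum {lam a : ℕ → ℝ} (hlam : Monotone lam) (ha0 : ∀ k, 0 ≤ a k)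
    (ha1 : ∀ k, a k ≤ 1) {n : ℕ} {S : ℝ} (ha : HasSum a n) (hS : HasSum (fun k => lam k * a k) S) :
    ∑ k ∈ Finset.range n, lam k ≤ S := by
  have h1 : HasSum (fun k => (lam k - lam n) * a k) (S - lam n * n) := by
    simpa [sub_mul] using hS.sub (ha.mul_left (lam n))
  have h2 : ∑ k ∈ Finset.range n, (lam k - lam n) * a k ≤ S - lam n * n := by
    refine sum_le_hasSum _ (fun k hk => ?_) h1
    have : n ≤ k := by simpa using hk
    exact mul_nonneg (sub_nonneg.2 (hlam this)) (ha0 k)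
  have h3 : ∑ k ∈ Finset.range n, (lam k - lam n) ≤
      ∑ k ∈ Finset.range n, (lam k - lam n) * a k := by
    refine Finset.sum_le_sum fun k hk => ?_
    have : lam k ≤ lam n := hlam (Finset.mem_range.1 hk).le
    nlinarith [ha1 k]
  rw [Finset.sum_sub_distrib, Finset.sum_const, Finset.card_range, nsmul_eq_mul] at h3
  linarith

theorem Orthonormal.sum_norm_inner_sq_le {ι : Type*} [Fintype ι] {v : ι → L2 d}
    (hv : Orthonormal ℂ v) (u : L2 d) : ∑ i, ‖inner ℂ u (v i)‖ ^ 2 ≤ ‖u‖ ^ 2 := by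
  refine le_trans (le_of_eq ?_) (hv.sum_inner_products_le u (s := Finset.univ))
  refine Finset.sum_congr rfl fun i _ => ?_
  rw [← inner_conj_symm, RCLike.norm_conj]

/-- Suppose `k + 1` orthonormal eigenfunctions had eigenvalues below `lam k`. They would be
orthogonal to every `u j` with `j ≥ k`, so Parseval puts their total mass `k + 1` on the first `k`
basis functions, where Bessel allows only `k`. -/
theorem dirichletEigenvalue_eq {α : ℝ} {Ω : Set (Eucl d)} {lam : ℕ → ℝ} {u : ℕ → L2 d}
    (hlam : Monotone lam) (hu : Orthonormal ℂ u)
    (heig : ∀ k, IsDirichletEigenfunction α Ω (lam k) (u k))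
    (hsum : ∀ v ∈ sobolevZero α Ω, HasSum (fun k => ‖inner ℂ (u k) v‖ ^ 2) (‖v‖ ^ 2)) (k : ℕ) :
    dirichletEigenvalue α Ω (k + 1) = lam k := by
  refine IsLeast.csInf_eq ⟨⟨fun i => u i, hu.comp _ Fin.val_injective, fun i =>
    ⟨lam i, hlam (Nat.lt_succ_iff.1 i.2), heig i⟩⟩, ?_⟩
  rintro t ⟨v, hv, hve⟩
  by_contra! hlt
  choose μ hμ hve using hve
  have h1 : ∀ i, ∑ j ∈ Finset.range k, ‖inner ℂ (u j) (v i)‖ ^ 2 = 1 := by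
    intro i
    have h2 := hsum (v i) (hve i).2.1
    rw [hv.1 i, one_pow] at h2
    refine (hasSum_sum_of_ne_finset_zero fun j hj => ?_).unique h2
    have hj' : k ≤ j := by simpa using hj
    rw [(heig j).inner_eq_zero (hve i) (((hμ i).trans_lt hlt).trans_le (hlam hj')).ne']
    simp
  have h3 : ∑ i, ∑ j ∈ Finset.range k, ‖inner ℂ (u j) (v i)‖ ^ 2 = (k + 1 : ℝ) := by
    simp [h1]
  rw [Finset.sum_comm] at h3
  have h4 : ∑ j ∈ Finset.range k, ∑ i, ‖inner ℂ (u j) (v i)‖ ^ 2 ≤ ∑ j ∈ Finset.range k, (1 : ℝ) :=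
    Finset.sum_le_sum fun j _ => (hv.sum_norm_inner_sq_le (u j)).trans (by simp [hu.1 j])
  simp at h4
  linarith

theorem eigenvalueSum_eq_sum_range (α : ℝ) (n : ℕ) (Ω : Set (Eucl d)) :
    eigenvalueSum α n Ω = ∑ k ∈ Finset.range n, dirichletEigenvalue α Ω (k + 1) := by
  rw [eigenvalueSum, Finset.range_eq_Ico, Finset.sum_Ico_add' (fun k => dirichletEigenvalue α Ω k)]
  rfl

theorem isDirichletSpectrum_dirichletEigenvalue [NeZero d] {α : ℝ} (hα : 0 < α) (hα2 : α ≤ 2)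
    {Ω : Set (Eucl d)} (hΩ : IsOpen Ω) (hne : Ω.Nonempty) (hV : volume Ω ≠ ⊤) :
    IsDirichletSpectrum α Ω (dirichletEigenvalue α Ω) := by
  obtain ⟨lam, u, hlam, hu, heig, hcomp, hsum, -⟩ :=
    exists_dirichlet_eigenbasis hα hα2 hΩ hne hV
  have h := dirichletEigenvalue_eq hlam hu heig hsum
  refine ⟨fun j k hj hjk => ?_, u, hu, fun k => by rw [h]; exact heig k, hcomp⟩
  obtain ⟨j, rfl⟩ := Nat.exists_eq_add_of_le' hj
  obtain ⟨k, rfl⟩ := Nat.exists_eq_add_of_le' (hj.trans hjk)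
  rw [h, h]
  exact hlam (by omega)

/-- The variational principle for the sum of the first `n` eigenvalues. -/
theorem eigenvalueSum_le [NeZero d] {α : ℝ} (hα : 0 < α) (hα2 : α ≤ 2)
    {Ω : Set (Eucl d)} (hΩ : IsOpen Ω) (hne : Ω.Nonempty) (hV : volume Ω ≠ ⊤) {n : ℕ}
    {v : Fin n → L2 d} (hv : Orthonormal ℂ v) (hvΩ : ∀ i, v i ∈ sobolevZero α Ω) :
    eigenvalueSum α n Ω ≤ ∑ i, (sobolevEnergy α (v i)).toReal := by
  obtain ⟨lam, u, hlam, hu, heig, hcomp, hsum, hsumE⟩ :=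
    exists_dirichlet_eigenbasis hα hα2 hΩ hne hV
  have h := dirichletEigenvalue_eq hlam hu heig hsum
  rw [eigenvalueSum_eq_sum_range]
  simp_rw [h]
  -- The weight of `u k` is the squared norm of its projection onto the span of the trial functions:
  -- at most 1 by Bessel, with total `n` by Parseval.
  refine sum_range_le_of_hasSum (a := fun k => ∑ i, ‖inner ℂ (u k) (v i)‖ ^ 2) hlam
    (fun k => Finset.sum_nonneg fun i _ => sq_nonneg _)
    (fun k => (hv.sum_norm_inner_sq_le (u k)).trans (by simp [hu.1 k])) ?_ ?_
  · have h1 := hasSum_sum (s := Finset.univ) fun i _ => hsum (v i) (hvΩ i)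
    simpa [hv.1] using h1
  · have h1 := hasSum_sum (s := Finset.univ) fun i _ => hsumE (v i) (hvΩ i)
    simpa [Finset.mul_sum] using h1

/-- The sum of the first `n` eigenvalues is attained by an orthonormal family. -/
theorem exists_eigenvalueSum_eq [NeZero d] {α : ℝ} (hα : 0 < α) (hα2 : α ≤ 2)
    {Ω : Set (Eucl d)} (hΩ : IsOpen Ω) (hne : Ω.Nonempty) (hV : volume Ω ≠ ⊤) (n : ℕ) :
    ∃ v : Fin n → L2 d, Orthonormal ℂ v ∧ (∀ i, v i ∈ sobolevZero α Ω) ∧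
      eigenvalueSum α n Ω = ∑ i, (sobolevEnergy α (v i)).toReal := by
  obtain ⟨lam, u, hlam, hu, heig, hcomp, hsum, -⟩ :=
    exists_dirichlet_eigenbasis hα hα2 hΩ hne hV
  refine ⟨fun i => u i, hu.comp _ Fin.val_injective, fun i => (heig i).2.1, ?_⟩
  rw [eigenvalueSum_eq_sum_range, Finset.sum_range]
  refine Finset.sum_congr rfl fun i _ => ?_
  rw [dirichletEigenvalue_eq hlam hu heig hsum, (heig i).sobolevEnergy_eq hα hα2, hu.1]
  simp

end Spectrum

/-! ### Eigenvalue sums under affine maps -/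

section Transport

variable {d : ℕ}

/-- The energy of `u` with the symbol composed with a linear map. -/
def distortedEnergy (α : ℝ) (B : Eucl d →L[ℝ] Eucl d) (u : L2 d) : ℝ≥0∞ :=
  ∫⁻ ξ : Eucl d, ENNReal.ofReal (fracSymbol α (B ξ)) * ‖(𝓕 u : L2 d) ξ‖ₑ ^ 2

theorem fracSymbol_eq_mul (α : ℝ) (ξ : Eucl d) :
    fracSymbol α ξ = (2 * Real.pi) ^ α * ‖ξ‖ ^ α := by
  rw [fracSymbol, Real.mul_rpow (by positivity) (norm_nonneg _)]

theorem distortedEnergy_le {α : ℝ} (hα : 0 ≤ α) (B : Eucl d →L[ℝ] Eucl d) (u : L2 d) :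
    distortedEnergy α B u ≤ ENNReal.ofReal (‖B‖ ^ α) * sobolevEnergy α u := by
  unfold distortedEnergy sobolevEnergy
  rw [← lintegral_const_mul' _ _ ENNReal.ofReal_ne_top]
  refine lintegral_mono fun ξ => ?_
  rw [← mul_assoc, ← ENNReal.ofReal_mul (by positivity)]
  gcongr
  change fracSymbol α (B ξ) ≤ _ * fracSymbol α ξ
  rw [fracSymbol_eq_mul, fracSymbol_eq_mul, mul_left_comm, ← Real.mul_rpow (norm_nonneg _)
    (norm_nonneg _)]
  gcongr
  exact B.le_opNorm ξ

theorem measurableEmbedding_affine (T : Eucl d ≃L[ℝ] Eucl d) (c : Eucl d) :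
    MeasurableEmbedding fun x => T x + c :=
  (T.toHomeomorph.trans (Homeomorph.addRight c)).measurableEmbedding

/-- The homeomorphism inverse to `x ↦ T x + c`. -/
def affineInverse (T : Eucl d ≃L[ℝ] Eucl d) (c : Eucl d) : Eucl d ≃ₜ Eucl d :=
  (Homeomorph.subRight c).trans T.symm.toHomeomorph

theorem affineInverse_apply (T : Eucl d ≃L[ℝ] Eucl d) (c x : Eucl d) :
    affineInverse T c x = T.symm (x - c) := rfl

theorem preimage_affineInverse (T : Eucl d ≃L[ℝ] Eucl d) (c : Eucl d) (Ω : Set (Eucl d)) :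
    affineInverse T c ⁻¹' Ω = (fun x => T x + c) '' Ω := by
  ext x
  constructor
  · intro hx
    exact ⟨T.symm (x - c), hx, by simp⟩
  · rintro ⟨y, hy, rfl⟩
    simpa [affineInverse_apply] using hy

theorem isOpen_affine_image (T : Eucl d ≃L[ℝ] Eucl d) (c : Eucl d) {Ω : Set (Eucl d)}
    (hΩ : IsOpen Ω) : IsOpen ((fun x => T x + c) '' Ω) := by
  rw [← preimage_affineInverse]
  exact hΩ.preimage (affineInverse T c).continuous

theorem volume_affine_image (T : Eucl d ≃L[ℝ] Eucl d) (c : Eucl d) (Ω : Set (Eucl d)) :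
    volume ((fun x => T x + c) '' Ω) =
      ENNReal.ofReal |LinearMap.det (T : Eucl d →ₗ[ℝ] Eucl d)| * volume Ω := by
  rw [← preimage_affineInverse, ← (affineInverse T c).measurableEmbedding.map_apply]
  exact (congrArg (fun μ : Measure (Eucl d) => μ Ω) (map_affine_volume T c)).trans rfl

/-- Affine transport of functions: an isometry of `L²` that maps `H₀^{α/2}(Ω)` to `H₀^{α/2}` of the
image of `Ω` and distorts the energy. -/
theorem exists_transport {α : ℝ} (hα : 0 < α) (T : Eucl d ≃L[ℝ] Eucl d) (c : Eucl d)
    (Ω : Set (Eucl d)) :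
    ∃ Φ : L2 d →ₗᵢ[ℂ] L2 d,
      (∀ u, sobolevEnergy α (Φ u) =
        distortedEnergy α (ContinuousLinearMap.adjoint (T.symm : Eucl d →L[ℝ] Eucl d)) u) ∧
      ∀ u ∈ sobolevZero α Ω, Φ u ∈ sobolevZero α ((fun x => T x + c) '' Ω) := by
  obtain ⟨Φ, s, hs0, hs2, hΦ, hF⟩ := exists_affineIsometry T c
  set A : Eucl d →L[ℝ] Eucl d := ContinuousLinearMap.adjoint (T : Eucl d →L[ℝ] Eucl d) with hA
  set B : Eucl d →L[ℝ] Eucl d := ContinuousLinearMap.adjoint (T.symm : Eucl d →L[ℝ] Eucl d) with hB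
  -- The substitution `η = A ξ` turns the symbol at `ξ` into the symbol at `B η`; its Jacobian
  -- cancels the factor `s²`.
  have hBA : ∀ ξ, B (A ξ) = ξ := by
    intro ξ
    refine ext_inner_left ℝ fun x => ?_
    rw [hB, ContinuousLinearMap.adjoint_inner_right, hA, ContinuousLinearMap.adjoint_inner_right]
    simp
  have hE : ∀ u, sobolevEnergy α (Φ u) = distortedEnergy α B u := by
    intro u
    set D : ℝ := |LinearMap.det (T : Eucl d →ₗ[ℝ] Eucl d)| with hD
    have hD0 : 0 < D := by rw [← hs2]; positivity
    have hmapA : Measure.map A volume = ENNReal.ofReal D⁻¹ • (volume : Measure (Eucl d)) := by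
      have := Measure.map_linearMap_addHaar_eq_smul_addHaar (volume : Measure (Eucl d))
        (f := (A : Eucl d →ₗ[ℝ] Eucl d))
        (by rw [det_adjoint_eq]; exact (LinearEquiv.isUnit_det' T.toLinearEquiv).ne_zero)
      rw [det_adjoint_eq, abs_inv] at this
      exact this
    let G : Eucl d → ℝ≥0∞ := fun η =>
      ENNReal.ofReal (fracSymbol α (B η)) * ‖(𝓕 u : L2 d) η‖ₑ ^ 2
    have hG : AEMeasurable G volume :=
      (((measurable_fracSymbol α).comp B.continuous.measurable).ennreal_ofReal.aemeasurable).mul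
        ((Lp.aestronglyMeasurable _).enorm.pow_const 2)
    have h1 : ∫⁻ ξ, G (A ξ) = ENNReal.ofReal D⁻¹ * ∫⁻ η, G η := by
      rw [← lintegral_map' (by rw [hmapA]; exact hG.smul_measure _)
        A.continuous.measurable.aemeasurable, hmapA, lintegral_smul_measure, smul_eq_mul]
    have h2 : sobolevEnergy α (Φ u) = ENNReal.ofReal D * ∫⁻ ξ, G (A ξ) := by
      rw [sobolevEnergy, ← lintegral_const_mul' _ _ ENNReal.ofReal_ne_top]
      refine lintegral_congr_ae ?_
      filter_upwards [hF u] with ξ hξ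
      simp only [G]
      rw [hξ, hBA, mul_pow, ← ENNReal.ofReal_pow hs0.le, hs2]
      change ENNReal.ofReal (fracSymbol α ξ) * _ = _
      ring
    rw [h2, h1, ← mul_assoc, ← ENNReal.ofReal_mul hD0.le, mul_inv_cancel₀ hD0.ne',
      ENNReal.ofReal_one, one_mul]
    rfl
  have htest : ∀ φ, IsTestFunction Ω φ → IsTestFunction ((fun x => T x + c) '' Ω) (Φ φ) := by
    rintro φ ⟨f, hf, hfc, hfs, hfφ⟩
    have hq : Measure.QuasiMeasurePreserving (fun x => T.symm (x - c)) volume volume :=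
      ⟨(affineInverse T c).continuous.measurable,
        by rw [map_affine_volume]; exact Measure.smul_absolutelyContinuous⟩
    have hsupp : tsupport (fun x => ((s⁻¹ : ℝ) : ℂ) * f (affineInverse T c x)) ⊆
        tsupport (f ∘ affineInverse T c) := by
      refine closure_mono fun x hx => ?_
      exact right_ne_zero_of_mul hx
    refine ⟨fun x => ((s⁻¹ : ℝ) : ℂ) * f (affineInverse T c x), ?_, ?_, ?_, ?_⟩
    · refine contDiff_const.mul (hf.comp ?_)
      exact T.symm.contDiff.comp (contDiff_id.sub contDiff_const)
    · exact (hfc.comp_homeomorph (affineInverse T c)).mul_left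
    · refine hsupp.trans ?_
      rw [tsupport_comp_eq_preimage, ← preimage_affineInverse]
      exact Set.preimage_mono hfs
    · filter_upwards [hΦ φ, hq.ae_eq_comp hfφ] with x h1 h2
      simp only [Function.comp] at h2
      rw [h1, h2]
      rfl
  refine ⟨Φ, hE, fun u hu ε hε => ?_⟩
  set K : ℝ≥0∞ := ENNReal.ofReal (‖B‖ ^ α) with hK
  have hK1 : 1 + K ≠ ⊤ := by simp [hK]
  -- Transport enlarges the energy at most by the factor `K` and preserves the norm, so `1 + K`
  -- bounds the loss in the squared form norm.
  obtain ⟨φ, hφ, hlt⟩ := hu (ε / (1 + K)) (ENNReal.div_pos hε.ne' hK1)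
  refine ⟨Φ φ, htest φ hφ, ?_⟩
  rw [← map_sub, hE]
  have h1 : ‖Φ (u - φ)‖ₑ = ‖u - φ‖ₑ := by
    rw [← ofReal_norm, ← ofReal_norm, Φ.norm_map]
  calc ‖Φ (u - φ)‖ₑ ^ 2 + distortedEnergy α B (u - φ)
      ≤ (1 + K) * ‖u - φ‖ₑ ^ 2 + (1 + K) * sobolevEnergy α (u - φ) := by
        rw [h1]
        gcongr
        · exact le_mul_of_one_le_left zero_le le_self_add
        · exact (distortedEnergy_le hα.le B _).trans (by gcongr; exact le_add_self)
    _ = (1 + K) * (‖u - φ‖ₑ ^ 2 + sobolevEnergy α (u - φ)) := by ring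
    _ < ε := by
        rw [mul_comm]
        exact (ENNReal.lt_div_iff_mul_lt (by simp) (by simp [hK1])).1 hlt

/-- The transported functions are admissible and orthonormal on the image, so the variational
principle applies to them. -/
theorem eigenvalueSum_affine_image_le [NeZero d] {α : ℝ} (hα : 0 < α) (hα2 : α ≤ 2)
    {Ω : Set (Eucl d)} (hΩ : IsOpen Ω) (hne : Ω.Nonempty) (hV : volume Ω ≠ ⊤) {n : ℕ}
    {v : Fin n → L2 d} (hv : Orthonormal ℂ v) (hvΩ : ∀ i, v i ∈ sobolevZero α Ω)
    (T : Eucl d ≃L[ℝ] Eucl d) (c : Eucl d) :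
    eigenvalueSum α n ((fun x => T x + c) '' Ω) ≤ ∑ i, (distortedEnergy α
      (ContinuousLinearMap.adjoint (T.symm : Eucl d →L[ℝ] Eucl d)) (v i)).toReal := by
  obtain ⟨Φ, hE, hΦ⟩ := exists_transport hα T c Ω
  have h := eigenvalueSum_le hα hα2 (isOpen_affine_image T c hΩ) (hne.image _)
    (by rw [volume_affine_image]; exact ENNReal.mul_ne_top ENNReal.ofReal_ne_top hV)
    (hv.comp_linearIsometry Φ) (fun i => hΦ _ (hvΩ i))
  simpa [hE] using h

/-- Averaging the trial functions over symmetries of `Ω`. -/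
theorem eigenvalueSum_affine_image_le_of_average [NeZero d] {α : ℝ} (hα : 0 < α) (hα2 : α ≤ 2)
    {Ω : Set (Eucl d)} (hΩ : IsOpen Ω) (hne : Ω.Nonempty) (hV : volume Ω ≠ ⊤) (n : ℕ)
    (T : Eucl d ≃L[ℝ] Eucl d) (c : Eucl d) {ι : Type*} [Fintype ι] {p : ι → ℝ}
    (hp : ∀ j, 0 ≤ p j) (hp1 : ∑ j, p j = 1) {U : ι → Eucl d ≃ₗᵢ[ℝ] Eucl d}
    (hU : ∀ j, U j '' Ω = Ω) {C : ℝ} (hC : 0 ≤ C)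
    (hle : ∀ ξ, ∑ j, p j * ‖ContinuousLinearMap.adjoint (T.symm : Eucl d →L[ℝ] Eucl d) (U j ξ)‖ ^ 2
      ≤ C * ‖ξ‖ ^ 2) :
    eigenvalueSum α n ((fun x => T x + c) '' Ω) ≤ C ^ (α / 2) * eigenvalueSum α n Ω := by
  obtain ⟨v, hv, hvΩ, hsum⟩ := exists_eigenvalueSum_eq hα hα2 hΩ hne hV n
  set B : Eucl d →L[ℝ] Eucl d := ContinuousLinearMap.adjoint (T.symm : Eucl d →L[ℝ] Eucl d) with hB
  have hfin : ∀ i, sobolevEnergy α (v i) ≠ ⊤ := fun i =>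
    sobolevEnergy_ne_top_of_mem hα hα2 (hvΩ i)
  let BU : ι → Eucl d →L[ℝ] Eucl d := fun j =>
    B.comp ((U j).toContinuousLinearEquiv : Eucl d →L[ℝ] Eucl d)
  -- The map `T ∘ U j` has the same image of `Ω` as `T` but transports the trial functions
  -- differently, which gives one upper bound for each symmetry.
  have h1 : ∀ j, eigenvalueSum α n ((fun x => T x + c) '' Ω) ≤
      ∑ i, (distortedEnergy α (BU j) (v i)).toReal := by
    intro j
    have h := eigenvalueSum_affine_image_le hα hα2 hΩ hne hV hv hvΩ
      ((U j).toContinuousLinearEquiv.trans T) c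
    have himg : (fun x => ((U j).toContinuousLinearEquiv.trans T) x + c) '' Ω =
        (fun x => T x + c) '' Ω := by
      conv_rhs => rw [← hU j, Set.image_image]
      rfl
    have hadj : ContinuousLinearMap.adjoint
        (((U j).toContinuousLinearEquiv.trans T).symm : Eucl d →L[ℝ] Eucl d) = BU j := by
      ext1 ξ
      refine ext_inner_left ℝ fun x => ?_
      rw [ContinuousLinearMap.adjoint_inner_right]
      change inner ℝ ((U j).symm (T.symm x)) ξ = inner ℝ x (B (U j ξ))
      rw [hB, ContinuousLinearMap.adjoint_inner_right, ← (U j).inner_map_map]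
      simp
    rwa [himg, hadj] at h
  have hfinj : ∀ j i, distortedEnergy α (BU j) (v i) ≠ ⊤ := fun j i =>
    ne_top_of_le_ne_top (ENNReal.mul_ne_top ENNReal.ofReal_ne_top (hfin i))
      (distortedEnergy_le hα.le _ _)
  have hpt : ∀ ξ : Eucl d, ∑ j, p j * fracSymbol α (BU j ξ) ≤ C ^ (α / 2) * fracSymbol α ξ := by
    intro ξ
    have hpow : ∀ x : Eucl d, ‖x‖ ^ α = (‖x‖ ^ 2) ^ (α / 2) := fun x => by
      rw [← Real.rpow_natCast, ← Real.rpow_mul (norm_nonneg _)]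
      congr 1
      push_cast
      ring
    -- Jensen's inequality; concavity of `t ↦ t^(α/2)` is where `α ≤ 2` is essential.
    have hj := (Real.concaveOn_rpow (p := α / 2) (by positivity) (by linarith)).le_map_sum
      (t := Finset.univ) (w := p) (p := fun j => ‖BU j ξ‖ ^ 2) (fun j _ => hp j) hp1
      (fun j _ => by simp)
    simp only [smul_eq_mul] at hj
    simp_rw [fracSymbol_eq_mul, mul_left_comm (p _), ← Finset.mul_sum, hpow]
    rw [mul_left_comm]
    refine mul_le_mul_of_nonneg_left ?_ (by positivity)
    refine hj.trans ?_
    rw [← Real.mul_rpow hC (by positivity)]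
    exact Real.rpow_le_rpow (Finset.sum_nonneg fun j _ => mul_nonneg (hp j) (by positivity))
      (hle ξ) (by positivity)
  have h2 : ∀ i, ∑ j, p j * (distortedEnergy α (BU j) (v i)).toReal ≤
      C ^ (α / 2) * (sobolevEnergy α (v i)).toReal := by
    intro i
    have h3 : ∑ j, ENNReal.ofReal (p j) * distortedEnergy α (BU j) (v i) ≤
        ENNReal.ofReal (C ^ (α / 2)) * sobolevEnergy α (v i) := by
      unfold distortedEnergy sobolevEnergy
      simp_rw [← lintegral_const_mul' _ _ ENNReal.ofReal_ne_top]
      rw [← lintegral_finsetSum']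
      · refine lintegral_mono fun ξ => ?_
        simp_rw [← mul_assoc, ← ENNReal.ofReal_mul (hp _)]
        rw [← Finset.sum_mul, ← ENNReal.ofReal_sum_of_nonneg fun j _ =>
          mul_nonneg (hp j) (fracSymbol_nonneg _ _), ← ENNReal.ofReal_mul (by positivity)]
        gcongr
        exact hpt ξ
      · intro j _
        exact ((((measurable_fracSymbol α).comp
          (BU j).continuous.measurable).ennreal_ofReal.aemeasurable).mul
          ((Lp.aestronglyMeasurable _).enorm.pow_const 2)).const_mul _
    have h4 := ENNReal.toReal_mono (ENNReal.mul_ne_top ENNReal.ofReal_ne_top (hfin i)) h3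
    rw [ENNReal.toReal_sum fun j _ => ENNReal.mul_ne_top ENNReal.ofReal_ne_top (hfinj j i)] at h4
    simp_rw [ENNReal.toReal_mul, ENNReal.toReal_ofReal (hp _)] at h4
    rwa [ENNReal.toReal_ofReal (by positivity)] at h4
  calc eigenvalueSum α n ((fun x => T x + c) '' Ω)
      = ∑ j, p j * eigenvalueSum α n ((fun x => T x + c) '' Ω) := by
        rw [← Finset.sum_mul, hp1, one_mul]
    _ ≤ ∑ j, p j * ∑ i, (distortedEnergy α (BU j) (v i)).toReal :=
        Finset.sum_le_sum fun j _ => mul_le_mul_of_nonneg_left (h1 j) (hp j)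
    _ = ∑ i, ∑ j, p j * (distortedEnergy α (BU j) (v i)).toReal := by
        simp_rw [Finset.mul_sum]
        exact Finset.sum_comm
    _ ≤ ∑ i, C ^ (α / 2) * (sobolevEnergy α (v i)).toReal := Finset.sum_le_sum fun i _ => h2 i
    _ = C ^ (α / 2) * eigenvalueSum α n Ω := by rw [hsum, Finset.mul_sum]

theorem eigenvalueSum_nonneg [NeZero d] {α : ℝ} (hα : 0 < α) (hα2 : α ≤ 2)
    {Ω : Set (Eucl d)} (hΩ : IsOpen Ω) (hne : Ω.Nonempty) (hV : volume Ω ≠ ⊤) (n : ℕ) :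
    0 ≤ eigenvalueSum α n Ω := by
  obtain ⟨v, -, -, hsum⟩ := exists_eigenvalueSum_eq hα hα2 hΩ hne hV n
  rw [hsum]
  exact Finset.sum_nonneg fun i _ => ENNReal.toReal_nonneg

end Transport

/-! ### Averaging over an irreducible group of isometries -/

section Averaging

variable {d : ℕ}

/-- The squared Hilbert–Schmidt norm. -/
def hsSq (A : Eucl d →L[ℝ] Eucl d) : ℝ := ∑ i, ‖A (EuclideanSpace.basisFun (Fin d) ℝ i)‖ ^ 2

theorem hsSq_eq_trace (A : Eucl d →L[ℝ] Eucl d) :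
    hsSq A = LinearMap.trace ℝ _
      ((ContinuousLinearMap.adjoint A : Eucl d →ₗ[ℝ] Eucl d) ∘ₗ (A : Eucl d →ₗ[ℝ] Eucl d)) := by
  rw [LinearMap.trace_eq_sum_inner _ (EuclideanSpace.basisFun (Fin d) ℝ), hsSq]
  refine Finset.sum_congr rfl fun i _ => ?_
  rw [LinearMap.comp_apply, ContinuousLinearMap.coe_coe, ContinuousLinearMap.coe_coe,
    ContinuousLinearMap.adjoint_inner_right, real_inner_self_eq_norm_sq]

theorem hsSq_eq_sum (A : Eucl d →L[ℝ] Eucl d) {ι : Type*} [Fintype ι]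
    (b : OrthonormalBasis ι ℝ (Eucl d)) : hsSq A = ∑ i, ‖A (b i)‖ ^ 2 := by
  rw [hsSq_eq_trace, LinearMap.trace_eq_sum_inner _ b]
  refine Finset.sum_congr rfl fun i _ => ?_
  rw [LinearMap.comp_apply, ContinuousLinearMap.coe_coe, ContinuousLinearMap.coe_coe,
    ContinuousLinearMap.adjoint_inner_right, real_inner_self_eq_norm_sq]

theorem hsSq_adjoint (A : Eucl d →L[ℝ] Eucl d) :
    hsSq (ContinuousLinearMap.adjoint A) = hsSq A := by
  rw [hsSq_eq_trace, hsSq_eq_trace, ContinuousLinearMap.adjoint_adjoint, LinearMap.trace_comp_comm']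

theorem hsSq_comp_isometry (A : Eucl d →L[ℝ] Eucl d) (U : Eucl d ≃ₗᵢ[ℝ] Eucl d) :
    hsSq (A.comp (U.toContinuousLinearEquiv : Eucl d →L[ℝ] Eucl d)) = hsSq A := by
  rw [hsSq_eq_sum A ((EuclideanSpace.basisFun (Fin d) ℝ).map U), hsSq]
  rfl

theorem hsSq_isometry_comp (A : Eucl d →L[ℝ] Eucl d) (U : Eucl d ≃ₗᵢ[ℝ] Eucl d) :
    hsSq ((U.toContinuousLinearEquiv : Eucl d →L[ℝ] Eucl d).comp A) = hsSq A := by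
  unfold hsSq
  refine Finset.sum_congr rfl fun i _ => ?_
  congr 1
  exact U.norm_map _

theorem hsSq_nonneg (A : Eucl d →L[ℝ] Eucl d) : 0 ≤ hsSq A :=
  Finset.sum_nonneg fun _ _ => sq_nonneg _

theorem eq_zero_of_hsSq_le_zero {A : Eucl d →L[ℝ] Eucl d} (h : hsSq A ≤ 0) : A = 0 := by
  have h1 := (Finset.sum_eq_zero_iff_of_nonneg (fun i _ => sq_nonneg _)).1
    (le_antisymm h (hsSq_nonneg A))
  have h2 : (A : Eucl d →ₗ[ℝ] Eucl d) = 0 :=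
    (EuclideanSpace.basisFun (Fin d) ℝ).toBasis.ext fun i => by
      simpa using h1 i (Finset.mem_univ i)
  ext1 x
  exact congrArg (fun L : Eucl d →ₗ[ℝ] Eucl d => L x) h2

theorem continuous_hsSq : Continuous (hsSq (d := d)) := by
  unfold hsSq; fun_prop

/-- `AᵀA`. -/
def gramOp (A : Eucl d →L[ℝ] Eucl d) : Eucl d →L[ℝ] Eucl d :=
  (ContinuousLinearMap.adjoint A).comp A

theorem inner_gramOp (A : Eucl d →L[ℝ] Eucl d) (x y : Eucl d) :
    inner ℝ x (gramOp A y) = inner ℝ (A x) (A y) := by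
  rw [gramOp, ContinuousLinearMap.comp_apply, ContinuousLinearMap.adjoint_inner_right]

/-- A symmetric operator that commutes with an irreducible group of isometries is a scalar. -/
theorem exists_eq_smul_of_commute [NeZero d] {Ω : Set (Eucl d)} (hirr : HasIrreducibleIsometryGroup Ω)
    {A : Eucl d →L[ℝ] Eucl d} (hA : (A : Eucl d →ₗ[ℝ] Eucl d).IsSymmetric)
    (hcomm : ∀ U : Eucl d ≃ₗᵢ[ℝ] Eucl d, U '' Ω = Ω → ∀ x, A (U x) = U (A x)) :
    ∃ μ : ℝ, ∀ x, A x = μ • x := by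
  have : Nontrivial (Eucl d) := by
    have : Nonempty (Fin d) := ⟨0⟩
    infer_instance
  -- Schur's argument over the reals: symmetry supplies a real eigenvalue, and its eigenspace is
  -- invariant under the group, hence everything.
  obtain ⟨μ, hev⟩ : ∃ μ : ℝ, Module.End.HasEigenvalue (A : Eucl d →ₗ[ℝ] Eucl d) μ :=
    ⟨_, hA.hasEigenvalue_iSup_of_finiteDimensional⟩
  refine ⟨μ, fun x => ?_⟩
  have hinv : ∀ U : Eucl d ≃ₗᵢ[ℝ] Eucl d, U '' Ω = Ω →
      ∀ x ∈ Module.End.eigenspace (A : Eucl d →ₗ[ℝ] Eucl d) μ,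
        U x ∈ Module.End.eigenspace (A : Eucl d →ₗ[ℝ] Eucl d) μ := by
    intro U hU x hx
    rw [Module.End.mem_eigenspace_iff] at hx ⊢
    rw [ContinuousLinearMap.coe_coe] at hx ⊢
    rw [hcomm U hU, hx, map_smul]
  rcases hirr _ hinv with h | h
  · exact absurd h hev
  · have hx : x ∈ (⊤ : Submodule ℝ (Eucl d)) := trivial
    rw [← h, Module.End.mem_eigenspace_iff] at hx
    exact hx

/-- Averages of `‖B U ξ‖²` over finitely many symmetries `U` of an irreducible set come arbitrarily
close to a multiple of `‖ξ‖²`. -/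
theorem exists_average [NeZero d] {Ω : Set (Eucl d)} (hirr : HasIrreducibleIsometryGroup Ω)
    (B : Eucl d →L[ℝ] Eucl d) {ε : ℝ} (hε : 0 < ε) :
    ∃ (ι : Type) (_ : Fintype ι) (p : ι → ℝ) (U : ι → Eucl d ≃ₗᵢ[ℝ] Eucl d),
      (∀ j, 0 ≤ p j) ∧ ∑ j, p j = 1 ∧ (∀ j, U j '' Ω = Ω) ∧
      ∀ ξ, |∑ j, p j * ‖B (U j ξ)‖ ^ 2 - hsSq B / d * ‖ξ‖ ^ 2| ≤ ε * ‖ξ‖ ^ 2 := by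
  let E := Eucl d
  let toC : (E ≃ₗᵢ[ℝ] E) → E →L[ℝ] E := fun U => (U.toContinuousLinearEquiv : E →L[ℝ] E)
  -- The orbit of `BᵀB` under conjugation by symmetries of `Ω`. The element of least Hilbert–Schmidt
  -- norm in its closed convex hull `K` is unique, hence invariant, and plays the role of the
  -- average over the group.
  let S : Set (E →L[ℝ] E) :=
    {A | ∃ U : E ≃ₗᵢ[ℝ] E, U '' Ω = Ω ∧ A = gramOp (B.comp (toC U))}
  let K : Set (E →L[ℝ] E) := closure (convexHull ℝ S)
  -- Symmetry, the value of the trace and stability under conjugation are closed convex conditions,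
  -- so they need checking only on the orbit.
  have hmin : ∀ P : Set (E →L[ℝ] E), S ⊆ P → Convex ℝ P → IsClosed P → K ⊆ P :=
    fun P h1 h2 h3 => closure_minimal (convexHull_min h1 h2) h3
  have hKconv : Convex ℝ K := (convex_convexHull ℝ S).closure
  have hSne : S.Nonempty := ⟨_, LinearIsometryEquiv.refl ℝ E, by simp, rfl⟩
  have hKne : K.Nonempty := (hSne.mono (subset_convexHull ℝ S)).mono subset_closure
  have hcpt : IsCompact K := by
    have : ProperSpace (E →L[ℝ] E) := FiniteDimensional.proper ℝ _
    refine (isCompact_closedBall (0 : E →L[ℝ] E) (‖B‖ * ‖B‖)).of_isClosed_subset isClosed_closure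
      (hmin _ ?_ (convex_closedBall _ _) Metric.isClosed_closedBall)
    rintro A ⟨U, -, rfl⟩
    rw [mem_closedBall_zero_iff]
    have h1 : ‖B.comp (toC U)‖ ≤ ‖B‖ :=
      ContinuousLinearMap.opNorm_le_bound _ (norm_nonneg _) fun x => by
        refine (B.le_opNorm _).trans (le_of_eq ?_)
        congr 1
        exact U.norm_map x
    refine (ContinuousLinearMap.opNorm_comp_le _ _).trans ?_
    rw [LinearIsometryEquiv.norm_map]
    exact mul_le_mul h1 h1 (norm_nonneg _) (norm_nonneg _)
  obtain ⟨A, hAK, hAmin⟩ := hcpt.exists_isMinOn hKne continuous_hsSq.continuousOn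
  have hsymm : ∀ x y, inner ℝ (A x) y = inner ℝ x (A y) := by
    refine hmin {A | ∀ x y, inner ℝ (A x) y = inner ℝ x (A y)} ?_ ?_ ?_ hAK
    · rintro A ⟨U, -, rfl⟩ x y
      rw [inner_gramOp, real_inner_comm, inner_gramOp, real_inner_comm]
    · intro A hA A' hA' a b _ _ _ x y
      simp [inner_add_left, inner_add_right, inner_smul_left, inner_smul_right, hA x y, hA' x y]
    · simp only [Set.ofPred_forall]
      exact isClosed_iInter fun x => isClosed_iInter fun y =>
        isClosed_eq (by fun_prop) (by fun_prop)
  have htr : ∑ i, inner ℝ (EuclideanSpace.basisFun (Fin d) ℝ i)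
      (A (EuclideanSpace.basisFun (Fin d) ℝ i)) = hsSq B := by
    refine hmin {A | ∑ i, inner ℝ (EuclideanSpace.basisFun (Fin d) ℝ i)
      (A (EuclideanSpace.basisFun (Fin d) ℝ i)) = hsSq B} ?_ ?_ ?_ hAK
    · rintro A ⟨U, -, rfl⟩
      change ∑ i, inner ℝ (EuclideanSpace.basisFun (Fin d) ℝ i)
        (gramOp (B.comp (toC U)) (EuclideanSpace.basisFun (Fin d) ℝ i)) = hsSq B
      rw [← hsSq_comp_isometry B U, hsSq]
      refine Finset.sum_congr rfl fun i _ => ?_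
      rw [inner_gramOp, real_inner_self_eq_norm_sq]
    · intro A hA A' hA' a b _ _ hab
      simp only [Set.mem_ofPred_eq] at hA hA' ⊢
      simp only [add_apply, smul_apply, inner_add_right, inner_smul_right,
        Finset.sum_add_distrib, ← Finset.mul_sum, hA, hA', ← add_mul, hab, one_mul]
    · exact isClosed_eq (by fun_prop) continuous_const
  have hconj : ∀ U : E ≃ₗᵢ[ℝ] E, U '' Ω = Ω → (toC U.symm).comp (A.comp (toC U)) ∈ K := by
    intro U hU
    let cU : (E →L[ℝ] E) →L[ℝ] (E →L[ℝ] E) :=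
      (ContinuousLinearMap.compL ℝ E E E (toC U.symm)).comp
        ((ContinuousLinearMap.compL ℝ E E E).flip (toC U))
    refine hmin (cU ⁻¹' K) ?_ (hKconv.linear_preimage (cU : (E →L[ℝ] E) →ₗ[ℝ] (E →L[ℝ] E)))
      (isClosed_closure.preimage cU.continuous) hAK
    rintro A ⟨V, hV, rfl⟩
    refine subset_closure (subset_convexHull ℝ S ⟨U.trans V, ?_, ?_⟩)
    · conv_rhs => rw [← hV, ← hU, Set.image_image]
      rfl
    · ext1 y
      refine ext_inner_left ℝ fun x => ?_
      rw [inner_gramOp]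
      change inner ℝ x (U.symm (gramOp (B.comp (toC V)) (U y))) = inner ℝ (B (V (U x))) (B (V (U y)))
      rw [← U.inner_map_map, U.apply_symm_apply, inner_gramOp]
      rfl
  have hinv : ∀ U : E ≃ₗᵢ[ℝ] E, U '' Ω = Ω → (toC U.symm).comp (A.comp (toC U)) = A := by
    intro U hU
    set A' := (toC U.symm).comp (A.comp (toC U)) with hA'
    have h1 : hsSq A' = hsSq A := by
      rw [hA', hsSq_isometry_comp, hsSq_comp_isometry]
    have h2 : (1 / 2 : ℝ) • A + (1 / 2 : ℝ) • A' ∈ K :=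
      hKconv hAK (hconj U hU) (by norm_num) (by norm_num) (by norm_num)
    have h3 : hsSq A ≤ hsSq ((1 / 2 : ℝ) • A + (1 / 2 : ℝ) • A') := hAmin h2
    -- Parallelogram law: if the conjugate `A'`, of equal norm, differed from `A`, their midpoint in
    -- `K` would have smaller norm than the minimizer.
    have h4 : hsSq ((1 / 2 : ℝ) • A + (1 / 2 : ℝ) • A') + (1 / 4) * hsSq (A' - A) =
        (hsSq A + hsSq A') / 2 := by
      unfold hsSq
      rw [Finset.mul_sum, ← Finset.sum_add_distrib, ← Finset.sum_add_distrib, Finset.sum_div]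
      refine Finset.sum_congr rfl fun i _ => ?_
      set e := EuclideanSpace.basisFun (Fin d) ℝ i
      have h5 : ((1 / 2 : ℝ) • A + (1 / 2 : ℝ) • A') e = (1 / 2 : ℝ) • (A' e + A e) := by
        rw [add_apply, smul_apply, smul_apply, smul_add, add_comm]
      have h6 := parallelogram_law_with_norm ℝ (A' e) (A e)
      rw [h5, sub_apply, norm_smul, mul_pow]
      norm_num
      nlinarith
    exact sub_eq_zero.1 (eq_zero_of_hsSq_le_zero (by linarith))
  obtain ⟨μ, hμ⟩ := exists_eq_smul_of_commute hirr (A := A) hsymm fun U hU x => by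
    have h := congrArg (fun L : E →L[ℝ] E => U (L x)) (hinv U hU)
    change U (U.symm (A (U x))) = U (A x) at h
    rwa [U.apply_symm_apply] at h
  have hd : (d : ℝ) ≠ 0 := Nat.cast_ne_zero.2 (NeZero.ne d)
  -- Conjugation by isometries and convex combinations preserve the trace, so `d * μ` equals the
  -- trace of `BᵀB`.
  have hμ' : μ = hsSq B / d := by
    simp only [hμ, inner_smul_right, real_inner_self_eq_norm_sq, OrthonormalBasis.norm_eq_one] at htr
    simp at htr
    rw [← htr]
    field_simp
  -- The minimizer lies only in the closure of the convex hull; a nearby finite convex combination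
  -- supplies the weights, at the cost of the error `ε`.
  obtain ⟨A', hA', hdist⟩ := Metric.mem_closure_iff.1 hAK ε hε
  obtain ⟨ι, hι, p, z, hp, hp1, hz, hsum⟩ := mem_convexHull_iff_exists_fintype.1 hA'
  choose U hU hzU using hz
  refine ⟨ι, hι, p, U, hp, hp1, hU, fun ξ => ?_⟩
  have h1 : ∑ j, p j * ‖B (U j ξ)‖ ^ 2 = inner ℝ ξ (A' ξ) := by
    rw [← hsum, sum_apply, inner_sum]
    refine Finset.sum_congr rfl fun j _ => ?_
    rw [smul_apply, inner_smul_right, hzU, inner_gramOp, real_inner_self_eq_norm_sq]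
    rfl
  have h2 : hsSq B / d * ‖ξ‖ ^ 2 = inner ℝ ξ (A ξ) := by
    rw [hμ, inner_smul_right, real_inner_self_eq_norm_sq, hμ']
  rw [h1, h2, ← inner_sub_right, ← sub_apply]
  refine (abs_real_inner_le_norm _ _).trans ?_
  have h3 : ‖(A' - A) ξ‖ ≤ ε * ‖ξ‖ := by
    refine ((A' - A).le_opNorm ξ).trans (mul_le_mul_of_nonneg_right ?_ (norm_nonneg _))
    rw [dist_comm, dist_eq_norm] at hdist
    exact hdist.le
  nlinarith [norm_nonneg ξ]

end Averaging

/-! ### Moments and eigenvalues of linear images -/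

section LinearImages

variable {d : ℕ}

theorem setIntegral_affine_image {F : Type*} [NormedAddCommGroup F] [NormedSpace ℝ F]
    (T : Eucl d ≃L[ℝ] Eucl d) (c : Eucl d) {Ω : Set (Eucl d)} (hΩ : MeasurableSet Ω)
    (g : Eucl d → F) :
    ∫ x in (fun x => T x + c) '' Ω, g x =
      |LinearMap.det (T : Eucl d →ₗ[ℝ] Eucl d)| • ∫ x in Ω, g (T x + c) := by
  have h := integral_comp_affine T c (Ω.indicator fun y => g (T y + c))
  rw [integral_indicator hΩ] at h
  rw [← h, ← integral_indicator ((measurableEmbedding_affine T c).measurableSet_image' hΩ)]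
  congr 1
  ext x
  rw [← preimage_affineInverse]
  by_cases hx : T.symm (x - c) ∈ Ω
  · rw [Set.indicator_of_mem hx, Set.indicator_of_mem (show x ∈ affineInverse T c ⁻¹' Ω from hx)]
    simp
  · rw [Set.indicator_of_notMem hx,
      Set.indicator_of_notMem (show x ∉ affineInverse T c ⁻¹' Ω from hx)]

/-- The second moments of an irreducible set are isotropic. -/
theorem setIntegral_norm_sq_comp [NeZero d] {Ω : Set (Eucl d)}
    (hirr : HasIrreducibleIsometryGroup Ω) (hI : IntegrableOn (fun x => ‖x‖ ^ 2) Ω volume)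
    (B : Eucl d →L[ℝ] Eucl d) :
    ∫ x in Ω, ‖B x‖ ^ 2 = hsSq B / d * ∫ x in Ω, ‖x‖ ^ 2 := by
  set I : ℝ := ∫ x in Ω, ‖x‖ ^ 2 with hId
  have hI0 : 0 ≤ I := integral_nonneg fun x => sq_nonneg _
  have hint : ∀ L : Eucl d →L[ℝ] Eucl d, IntegrableOn (fun x => ‖L x‖ ^ 2) Ω volume := fun L => by
    refine Integrable.mono' (hI.const_mul (‖L‖ ^ 2)) (by fun_prop) ?_
    refine Filter.Eventually.of_forall fun x => ?_
    rw [Real.norm_of_nonneg (sq_nonneg _), ← mul_pow]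
    gcongr
    exact L.le_opNorm x
  have hinv : ∀ U : Eucl d ≃ₗᵢ[ℝ] Eucl d, U '' Ω = Ω →
      ∫ x in Ω, ‖B (U x)‖ ^ 2 = ∫ x in Ω, ‖B x‖ ^ 2 := by
    intro U hU
    conv_rhs => rw [← hU]
    exact (U.measurePreserving.setIntegral_image_emb U.toHomeomorph.measurableEmbedding
      (fun x => ‖B x‖ ^ 2) Ω).symm
  -- The integral does not change when `B` is composed with a symmetry of `Ω`, so the integrand may
  -- be replaced by an average that is nearly a multiple of `‖x‖²`.
  have hle : ∀ ε > 0, |(∫ x in Ω, ‖B x‖ ^ 2) - hsSq B / d * I| ≤ ε * I := by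
    intro ε hε
    obtain ⟨ι, hι, p, U, hp, hp1, hU, hav⟩ := exists_average hirr B hε
    have hintU : ∀ j, IntegrableOn (fun x => p j * ‖B (U j x)‖ ^ 2) Ω volume := fun j =>
      (hint (B.comp ((U j).toContinuousLinearEquiv : Eucl d →L[ℝ] Eucl d))).const_mul _
    have h1 : ∫ x in Ω, ‖B x‖ ^ 2 = ∫ x in Ω, ∑ j, p j * ‖B (U j x)‖ ^ 2 := by
      rw [integral_finsetSum _ fun j _ => hintU j]
      simp_rw [integral_const_mul, hinv _ (hU _)]
      rw [← Finset.sum_mul, hp1, one_mul]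
    rw [h1, hId, ← integral_const_mul, ← integral_sub
      (integrable_finsetSum _ fun j _ => hintU j) (hI.const_mul _), ← integral_const_mul]
    refine (abs_integral_le_integral_abs).trans (integral_mono_of_nonneg
      (Filter.Eventually.of_forall fun x => abs_nonneg _) (hI.const_mul _)
      (Filter.Eventually.of_forall fun x => hav x))
  have h0 : |(∫ x in Ω, ‖B x‖ ^ 2) - hsSq B / d * I| ≤ 0 := by
    refine le_of_forall_pos_le_add fun δ hδ => ?_
    refine (hle (δ / (I + 1)) (by positivity)).trans ?_
    rw [zero_add, div_mul_eq_mul_div, div_le_iff₀ (by positivity)]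
    nlinarith
  exact sub_eq_zero.1 (abs_nonpos_iff.1 h0)

theorem secondMoment_linear_image [NeZero d] {Ω : Set (Eucl d)} (hΩ : MeasurableSet Ω)
    (hirr : HasIrreducibleIsometryGroup Ω) (hI : IntegrableOn (fun x => ‖x‖ ^ 2) Ω volume)
    (T : Eucl d ≃L[ℝ] Eucl d) (c : Eucl d) :
    secondMoment c ((fun x => T x + c) '' Ω) =
      |LinearMap.det (T : Eucl d →ₗ[ℝ] Eucl d)| *
        (hsSq (T : Eucl d →L[ℝ] Eucl d) / d * secondMoment 0 Ω) := by
  rw [secondMoment, setIntegral_affine_image T c hΩ, smul_eq_mul]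
  congr 1
  simp only [add_sub_cancel_right]
  rw [secondMoment]
  simp only [sub_zero]
  exact setIntegral_norm_sq_comp hirr hI T

theorem secondMoment_pos {Ω : Set (Eucl d)} [NeZero d] (hΩ : IsOpen Ω) (hne : Ω.Nonempty)
    (hI : IntegrableOn (fun x => ‖x‖ ^ 2) Ω volume) : 0 < secondMoment 0 Ω := by
  rw [secondMoment]
  simp only [sub_zero]
  rw [integral_pos_iff_support_of_nonneg (fun x => sq_nonneg _) hI,
    Measure.restrict_apply' hΩ.measurableSet]
  have hs : Function.support (fun x : Eucl d => ‖x‖ ^ 2) = {0}ᶜ := by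
    ext x; simp
  have : Nonempty (Fin d) := ⟨0⟩
  rw [hs, Set.inter_comm, ← Set.sdiff_eq, measure_sdiff_null (measure_singleton _)]
  exact hΩ.measure_pos volume hne

/-- The unit ball has finite volume, and Chebyshev's inequality bounds the part of `Ω` outside it.
-/
theorem volume_ne_top_of_integrableOn_norm_sq {Ω : Set (Eucl d)} (hΩ : MeasurableSet Ω)
    (hI : IntegrableOn (fun x => ‖x‖ ^ 2) Ω volume) : volume Ω ≠ ⊤ := by
  have h1 : volume (Ω ∩ {x | (1 : ℝ) ≤ ‖x‖ ^ 2}) < ⊤ := by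
    have := hI.measure_norm_ge_lt_top one_pos
    rw [Measure.restrict_apply' hΩ] at this
    refine lt_of_le_of_lt (measure_mono ?_) this
    rintro x ⟨hx, hx'⟩
    refine ⟨?_, hx⟩
    simpa using hx'
  have h2 : Ω ⊆ Metric.closedBall 0 1 ∪ (Ω ∩ {x | (1 : ℝ) ≤ ‖x‖ ^ 2}) := by
    intro x hx
    by_cases h : ‖x‖ ≤ 1
    · left; simpa using h
    · right
      refine ⟨hx, ?_⟩
      have : 1 < ‖x‖ := not_le.1 h
      simp only [Set.mem_ofPred_eq]
      nlinarith
  exact ((measure_mono h2).trans_lt ((measure_union_le _ _).trans_lt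
    (ENNReal.add_lt_top.2 ⟨measure_closedBall_lt_top, h1⟩))).ne

/-- The eigenvalue sum of an affine image of an irreducible set. -/
theorem eigenvalueSum_rpow_le [NeZero d] {α : ℝ} (hα : 0 < α) (hα2 : α ≤ 2)
    {Ω : Set (Eucl d)} (hΩ : IsOpen Ω) (hne : Ω.Nonempty) (hV : volume Ω ≠ ⊤)
    (hirr : HasIrreducibleIsometryGroup Ω) (n : ℕ) (T : Eucl d ≃L[ℝ] Eucl d) (c : Eucl d) :
    eigenvalueSum α n ((fun x => T x + c) '' Ω) ^ (2 / α) ≤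
      hsSq (T.symm : Eucl d →L[ℝ] Eucl d) / d * eigenvalueSum α n Ω ^ (2 / α) := by
  set B : Eucl d →L[ℝ] Eucl d := ContinuousLinearMap.adjoint (T.symm : Eucl d →L[ℝ] Eucl d) with hB
  have hB0 : 0 ≤ hsSq B / d := div_nonneg (hsSq_nonneg _) (Nat.cast_nonneg _)
  rw [← hsSq_adjoint, ← hB]
  have h0 := eigenvalueSum_nonneg hα hα2 hΩ hne hV n
  have h0' := eigenvalueSum_nonneg hα hα2 (isOpen_affine_image T c hΩ) (hne.image _)
    (by rw [volume_affine_image]; exact ENNReal.mul_ne_top ENNReal.ofReal_ne_top hV) n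
  -- The exponent `2 / α` undoes the power `α / 2` of the averaged distortion; `ε` then tends to
  -- zero.
  have h1 : ∀ ε > 0, eigenvalueSum α n ((fun x => T x + c) '' Ω) ^ (2 / α) ≤
      (hsSq B / d + ε) * eigenvalueSum α n Ω ^ (2 / α) := by
    intro ε hε
    obtain ⟨ι, hι, p, U, hp, hp1, hU, hav⟩ := exists_average hirr B hε
    have h2 := eigenvalueSum_affine_image_le_of_average hα hα2 hΩ hne hV n T c hp hp1 hU
      (C := hsSq B / d + ε) (by positivity) fun ξ => by
        have := (abs_le.1 (hav ξ)).2
        rw [add_mul]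
        linarith
    refine (Real.rpow_le_rpow h0' h2 (by positivity)).trans (le_of_eq ?_)
    rw [Real.mul_rpow (by positivity) h0, ← Real.rpow_mul (by positivity),
      div_mul_div_cancel₀ two_ne_zero, div_self hα.ne', Real.rpow_one]
  have hlim : Filter.Tendsto (fun ε : ℝ => (hsSq B / d + ε) * eigenvalueSum α n Ω ^ (2 / α))
      (nhdsWithin 0 (Set.Ioi 0)) (nhds ((hsSq B / d + 0) * eigenvalueSum α n Ω ^ (2 / α))) := by
    refine Filter.Tendsto.mono_left ?_ nhdsWithin_le_nhds
    exact Continuous.tendsto (by fun_prop) 0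
  rw [add_zero] at hlim
  exact ge_of_tendsto hlim (Filter.eventually_of_mem self_mem_nhdsWithin h1)

/-- The eigenvalue sum of the image under a similarity. -/
theorem le_eigenvalueSum_rpow_similarity [NeZero d] {α : ℝ} (hα : 0 < α) (hα2 : α ≤ 2)
    {Ω : Set (Eucl d)} (hΩ : IsOpen Ω) (hne : Ω.Nonempty) (hV : volume Ω ≠ ⊤) (n : ℕ)
    (T : Eucl d ≃L[ℝ] Eucl d) (c : Eucl d) {r : ℝ} (hr : ∀ x, ‖T x‖ = r * ‖x‖) (hr0 : 0 < r) :
    eigenvalueSum α n Ω ^ (2 / α) ≤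
      r ^ 2 * eigenvalueSum α n ((fun x => T x + c) '' Ω) ^ (2 / α) := by
  have hV' : volume ((fun x => T x + c) '' Ω) ≠ ⊤ := by
    rw [volume_affine_image]; exact ENNReal.mul_ne_top ENNReal.ofReal_ne_top hV
  have hΩ' := isOpen_affine_image T c hΩ
  have h0 := eigenvalueSum_nonneg hα hα2 hΩ hne hV n
  have h0' := eigenvalueSum_nonneg hα hα2 hΩ' (hne.image _) hV' n
  have hadj : ‖ContinuousLinearMap.adjoint (T : Eucl d →L[ℝ] Eucl d)‖ ≤ r := by
    rw [LinearIsometryEquiv.norm_map]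
    exact ContinuousLinearMap.opNorm_le_bound _ hr0.le fun x => (hr x).le
  -- The transport bound for the inverse map, from the image back to `Ω`, with a single trivial
  -- symmetry. The distortion is now the adjoint of `T`, of norm at most `r`.
  have h1 := eigenvalueSum_affine_image_le_of_average hα hα2 hΩ' (hne.image _) hV' n T.symm
    (-T.symm c) (ι := Unit) (p := fun _ => 1) (fun _ => zero_le_one) (by simp)
    (U := fun _ => LinearIsometryEquiv.refl ℝ _) (fun _ => by simp) (C := r ^ 2) (by positivity)
    (fun ξ => by
      simp only [Finset.univ_unique, Finset.sum_singleton, one_mul, ← mul_pow]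
      gcongr
      exact (ContinuousLinearMap.le_opNorm _ _).trans (mul_le_mul_of_nonneg_right hadj (norm_nonneg _)))
  have himg : (fun x => T.symm x + -T.symm c) '' ((fun x => T x + c) '' Ω) = Ω := by
    rw [Set.image_image]
    simp
  rw [himg] at h1
  refine (Real.rpow_le_rpow h0 h1 (by positivity)).trans (le_of_eq ?_)
  rw [Real.mul_rpow (by positivity) h0', ← Real.rpow_mul (by positivity),
    div_mul_div_cancel₀ two_ne_zero, div_self hα.ne', Real.rpow_one]

end LinearImages

/-! ### The scale invariant functionals -/

section Functionals

variable {d : ℕ}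

theorem hsSq_pos [NeZero d] (T : Eucl d ≃L[ℝ] Eucl d) : 0 < hsSq (T : Eucl d →L[ℝ] Eucl d) := by
  refine lt_of_not_ge fun h => ?_
  have : Nonempty (Fin d) := ⟨0⟩
  obtain ⟨x, hx⟩ := exists_ne (0 : Eucl d)
  refine hx (T.injective ?_)
  rw [map_zero]
  exact congrArg (fun L : Eucl d →L[ℝ] Eucl d => L x) (eq_zero_of_hsSq_le_zero h)

theorem abs_det_pos (T : Eucl d ≃L[ℝ] Eucl d) :
    0 < |LinearMap.det (T : Eucl d →ₗ[ℝ] Eucl d)| :=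
  abs_pos.2 (LinearEquiv.isUnit_det' T.toLinearEquiv).ne_zero

theorem volume_real_affine_image (T : Eucl d ≃L[ℝ] Eucl d) (c : Eucl d) (Ω : Set (Eucl d)) :
    volume.real ((fun x => T x + c) '' Ω) =
      |LinearMap.det (T : Eucl d →ₗ[ℝ] Eucl d)| * volume.real Ω := by
  rw [measureReal_def, volume_affine_image, ENNReal.toReal_mul,
    ENNReal.toReal_ofReal (abs_nonneg _), measureReal_def]

theorem hsSq_symm_of_norm_eq {T : Eucl d ≃L[ℝ] Eucl d} {r : ℝ} (hr : ∀ x, ‖T x‖ = r * ‖x‖)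
    (hr0 : 0 < r) : hsSq (T.symm : Eucl d →L[ℝ] Eucl d) = d / r ^ 2 := by
  have h : ∀ x, ‖T.symm x‖ = ‖x‖ / r := fun x => by
    rw [eq_div_iff hr0.ne', mul_comm, ← hr, T.apply_symm_apply]
  simp [hsSq, h, div_eq_mul_inv]

/-- The eigenvalue sum of an affine image, normalized by the linear distortion. -/
def normalizedSum (α : ℝ) (n : ℕ) (Ω : Set (Eucl d)) (T : Eucl d ≃L[ℝ] Eucl d) (c : Eucl d) : ℝ :=
  eigenvalueSum α n ((fun x => T x + c) '' Ω) ^ (2 / α) /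
    (hsSq (T.symm : Eucl d →L[ℝ] Eucl d) / d)

/-- The value for `Ω` itself separates the two sides: it bounds the normalized sum of every affine
image from above, and that of a similar image from below by scaling. -/
theorem normalizedSum_le_of_similarity [NeZero d] {α : ℝ} (hα : 0 < α) (hα2 : α ≤ 2)
    {Ω : Set (Eucl d)} (hΩ : IsOpen Ω) (hne : Ω.Nonempty) (hV : volume Ω ≠ ⊤)
    (hirr : HasIrreducibleIsometryGroup Ω) (n : ℕ) (T S : Eucl d ≃L[ℝ] Eucl d) (c c' : Eucl d)
    {r : ℝ} (hr : ∀ x, ‖S x‖ = r * ‖x‖) (hr0 : 0 < r) :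
    normalizedSum α n Ω T c ≤ normalizedSum α n Ω S c' := by
  have hd : (0 : ℝ) < d := Nat.cast_pos.2 (NeZero.pos d)
  refine le_trans (b := eigenvalueSum α n Ω ^ (2 / α)) ?_ ?_
  · rw [normalizedSum, div_le_iff₀ (div_pos (hsSq_pos _) hd), mul_comm]
    exact eigenvalueSum_rpow_le hα hα2 hΩ hne hV hirr n T c
  · refine (le_eigenvalueSum_rpow_similarity hα hα2 hΩ hne hV n S c' hr hr0).trans (le_of_eq ?_)
    rw [normalizedSum, hsSq_symm_of_norm_eq hr hr0]
    field_simp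

/-- The moment of the inverse image produces the Hilbert–Schmidt factor by which `normalizedSum`
divides, and all powers of the determinant cancel. What remains besides `normalizedSum` does not
depend on `T`. -/
theorem spectralFunctional_eq [NeZero d] {α : ℝ} {Ω : Set (Eucl d)} (hΩ : IsOpen Ω)
    (hirr : HasIrreducibleIsometryGroup Ω) (hI : IntegrableOn (fun x => ‖x‖ ^ 2) Ω volume)
    (n : ℕ) (T : Eucl d ≃ₗ[ℝ] Eucl d) :
    spectralFunctional α n Ω T = normalizedSum α n Ω T.toContinuousLinearEquiv 0 *
      (volume.real Ω ^ (2 / (d : ℝ)) *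
        (volume.real Ω ^ (1 + 2 / (d : ℝ)) / secondMoment 0 Ω)) := by
  set L := T.toContinuousLinearEquiv with hL
  have h1 : T '' Ω = (fun x => L x + 0) '' Ω := by simp [hL]
  have h2 : T.symm '' Ω = (fun x => L.symm x + 0) '' Ω := by
    simp only [add_zero]; rfl
  rw [spectralFunctional, h2, secondMoment_linear_image hΩ.measurableSet hirr hI L.symm 0,
    volume_real_affine_image, h1, volume_real_affine_image, normalizedSum]
  set D := |LinearMap.det (L : Eucl d →ₗ[ℝ] Eucl d)| with hD
  have hD0 : 0 < D := abs_det_pos L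
  have hD' : |LinearMap.det (L.symm : Eucl d →ₗ[ℝ] Eucl d)| = D⁻¹ := by
    rw [hD, ← abs_inv]
    congr 1
    exact LinearEquiv.det_coe_symm L.toLinearEquiv
  have hh := hsSq_pos L.symm
  have hd : (0 : ℝ) < d := Nat.cast_pos.2 (NeZero.pos d)
  rw [hD', Real.mul_rpow hD0.le measureReal_nonneg,
    Real.mul_rpow (inv_nonneg.2 hD0.le) measureReal_nonneg, Real.inv_rpow hD0.le,
    Real.rpow_add hD0, Real.rpow_one]
  have := Real.rpow_pos_of_pos hD0 (2 / (d : ℝ))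
  set q := D ^ (2 / (d : ℝ))
  field_simp

theorem exists_norm_eq_of_isMultipleOfOrthogonal [NeZero d] {S : Eucl d ≃ₗ[ℝ] Eucl d}
    (hS : IsMultipleOfOrthogonal S) :
    ∃ r : ℝ, 0 < r ∧ ∀ x, ‖S.toContinuousLinearEquiv x‖ = r * ‖x‖ := by
  obtain ⟨c, R, h⟩ := hS
  refine ⟨|c|, abs_pos.2 ?_, fun x => ?_⟩
  · rintro rfl
    have : Nonempty (Fin d) := ⟨0⟩
    obtain ⟨x, hx⟩ := exists_ne (0 : Eucl d)
    refine hx (S.injective ?_)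
    rw [h, zero_smul, map_zero]
  · change ‖S x‖ = _
    rw [h, norm_smul, R.norm_map, Real.norm_eq_abs]

theorem spectralFunctional_le_of_isMultipleOfOrthogonal [NeZero d] {α : ℝ} (hα : 0 < α)
    (hα2 : α ≤ 2) {Ω : Set (Eucl d)} (hΩ : IsOpen Ω) (hne : Ω.Nonempty)
    (hI : IntegrableOn (fun x => ‖x‖ ^ 2) Ω volume) (hirr : HasIrreducibleIsometryGroup Ω)
    (n : ℕ) {S : Eucl d ≃ₗ[ℝ] Eucl d} (hS : IsMultipleOfOrthogonal S) (T : Eucl d ≃ₗ[ℝ] Eucl d) :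
    spectralFunctional α n Ω T ≤ spectralFunctional α n Ω S := by
  obtain ⟨r, hr0, hr⟩ := exists_norm_eq_of_isMultipleOfOrthogonal hS
  rw [spectralFunctional_eq hΩ hirr hI, spectralFunctional_eq hΩ hirr hI]
  refine mul_le_mul_of_nonneg_right (normalizedSum_le_of_similarity hα hα2 hΩ hne
    (volume_ne_top_of_integrableOn_norm_sq hΩ.measurableSet hI) hirr n _ _ 0 0 hr hr0) ?_
  have := (secondMoment_pos hΩ hne hI).le
  positivity

/-- The Hilbert–Schmidt norms of a planar map and of its inverse. -/
theorem hsSq_symm_mul_det_sq (T : Eucl 2 ≃L[ℝ] Eucl 2) :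
    hsSq (T.symm : Eucl 2 →L[ℝ] Eucl 2) * LinearMap.det (T : Eucl 2 →ₗ[ℝ] Eucl 2) ^ 2 =
      hsSq (T : Eucl 2 →L[ℝ] Eucl 2) := by
  set b := EuclideanSpace.basisFun (Fin 2) ℝ with hb
  set D := LinearMap.det (T : Eucl 2 →ₗ[ℝ] Eucl 2) with hD
  have hdet : D = T (b 0) 0 * T (b 1) 1 - T (b 1) 0 * T (b 0) 1 := by
    rw [hD, ← LinearMap.det_toMatrix b.toBasis, Matrix.det_fin_two]
    simp [LinearMap.toMatrix_apply, hb]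
  have hexp : ∀ x : Eucl 2, x = x 0 • b 0 + x 1 • b 1 := fun x => by
    conv_lhs => rw [← b.sum_repr x, Fin.sum_univ_two]
    simp [hb]
  have hcoord : ∀ s t : ℝ, (s • b 0 + t • b 1) 0 = s ∧ (s • b 0 + t • b 1) 1 = t := by
    intro s t
    simp [hb]
  have hT : ∀ s t : ℝ, T (s • b 0 + t • b 1) =
      (s * T (b 0) 0 + t * T (b 1) 0) • b 0 + (s * T (b 0) 1 + t * T (b 1) 1) • b 1 := by
    intro s t
    rw [map_add, map_smul, map_smul]
    conv_lhs => rw [hexp (T (b 0)), hexp (T (b 1))]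
    module
  have hnorm : ∀ s t : ℝ, ‖s • b 0 + t • b 1‖ ^ 2 = s ^ 2 + t ^ 2 := fun s t => by
    rw [EuclideanSpace.norm_sq_eq, Fin.sum_univ_two, (hcoord s t).1, (hcoord s t).2]
    simp
  -- Cramer's rule: in the plane the adjugate has the entries of the matrix up to order and sign,
  -- hence the same Hilbert–Schmidt norm.
  have h0 : D • T.symm (b 0) = T (b 1) 1 • b 0 + (-T (b 0) 1) • b 1 := by
    rw [← map_smul, T.symm_apply_eq, hT, hdet]
    ring_nf
    simp
  have h1 : D • T.symm (b 1) = (-T (b 1) 0) • b 0 + T (b 0) 0 • b 1 := by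
    rw [← map_smul, T.symm_apply_eq, hT, hdet]
    ring_nf
    simp
  have n0 : ‖D • T.symm (b 0)‖ ^ 2 = T (b 1) 1 ^ 2 + T (b 0) 1 ^ 2 := by rw [h0, hnorm]; ring
  have n1 : ‖D • T.symm (b 1)‖ ^ 2 = T (b 1) 0 ^ 2 + T (b 0) 0 ^ 2 := by rw [h1, hnorm]; ring
  rw [norm_smul, mul_pow, Real.norm_eq_abs, sq_abs] at n0 n1
  have m0 : ‖T (b 0)‖ ^ 2 = T (b 0) 0 ^ 2 + T (b 0) 1 ^ 2 := by
    conv_lhs => rw [hexp (T (b 0)), hnorm]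
  have m1 : ‖T (b 1)‖ ^ 2 = T (b 1) 0 ^ 2 + T (b 1) 1 ^ 2 := by
    conv_lhs => rw [hexp (T (b 1)), hnorm]
  simp only [hsSq, Fin.sum_univ_two, ContinuousLinearEquiv.coe_coe]
  linear_combination n0 + n1 - m0 - m1

/-- Here the moment of the direct image contributes the norm of `T`, which `hsSq_symm_mul_det_sq`
converts into that of the inverse. The squared determinant goes into the area factors. -/
theorem planarFunctional_eq {α : ℝ} {Ω : Set (Eucl 2)} (hΩ : IsOpen Ω)
    (hirr : HasIrreducibleIsometryGroup Ω) (hI : IntegrableOn (fun x => ‖x‖ ^ 2) Ω volume)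
    (n : ℕ) (T : Eucl 2 ≃L[ℝ] Eucl 2) (c : Eucl 2) :
    planarFunctional α n c ((fun x => T x + c) '' Ω) = normalizedSum α n Ω T c *
      (volume.real Ω * (volume.real Ω ^ 2 / secondMoment 0 Ω)) := by
  have hD := abs_det_pos T
  have hh := hsSq_pos T.symm
  rw [planarFunctional, secondMoment_linear_image hΩ.measurableSet hirr hI T c,
    volume_real_affine_image, normalizedSum, ← hsSq_symm_mul_det_sq, ← sq_abs (LinearMap.det _)]
  field_simp

theorem planarFunctional_le_of_similarity {α : ℝ} (hα : 0 < α)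
    (hα2 : α ≤ 2) {Ω : Set (Eucl 2)} (hΩ : IsOpen Ω) (hne : Ω.Nonempty)
    (hI : IntegrableOn (fun x => ‖x‖ ^ 2) Ω volume) (hirr : HasIrreducibleIsometryGroup Ω)
    (n : ℕ) (T S : Eucl 2 ≃L[ℝ] Eucl 2) (c c' : Eucl 2)
    {r : ℝ} (hr : ∀ x, ‖S x‖ = r * ‖x‖) (hr0 : 0 < r) :
    planarFunctional α n c ((fun x => T x + c) '' Ω) ≤
      planarFunctional α n c' ((fun x => S x + c') '' Ω) := by
  rw [planarFunctional_eq hΩ hirr hI, planarFunctional_eq hΩ hirr hI]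
  refine mul_le_mul_of_nonneg_right (normalizedSum_le_of_similarity hα hα2 hΩ hne
    (volume_ne_top_of_integrableOn_norm_sq hΩ.measurableSet hI) hirr n _ _ c c' hr hr0) ?_
  have := (secondMoment_pos hΩ hne hI).le
  positivity

theorem planarFunctional_le_of_isMultipleOfOrthogonal {α : ℝ} (hα : 0 < α)
    (hα2 : α ≤ 2) {Ω : Set (Eucl 2)} (hΩ : IsOpen Ω) (hne : Ω.Nonempty)
    (hI : IntegrableOn (fun x => ‖x‖ ^ 2) Ω volume) (hirr : HasIrreducibleIsometryGroup Ω)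
    (n : ℕ) {S : Eucl 2 ≃ₗ[ℝ] Eucl 2} (hS : IsMultipleOfOrthogonal S) (T : Eucl 2 ≃ₗ[ℝ] Eucl 2) :
    planarFunctional α n 0 (T '' Ω) ≤ planarFunctional α n 0 (S '' Ω) := by
  obtain ⟨r, hr0, hr⟩ := exists_norm_eq_of_isMultipleOfOrthogonal hS
  have h := planarFunctional_le_of_similarity hα hα2 hΩ hne hI hirr n T.toContinuousLinearEquiv
    S.toContinuousLinearEquiv 0 0 hr hr0
  simp only [add_zero] at h
  exact h

end Functionals

/-! ### Planar shapes -/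

section Shapes

theorem exists_eq_add_smul {v w : Eucl 2} (h : LinearIndependent ℝ ![v, w]) (x : Eucl 2) :
    ∃ s t : ℝ, x = s • v + t • w := by
  let b := basisOfLinearIndependentOfCardEqFinrank h (by simp)
  refine ⟨b.repr x 0, b.repr x 1, ?_⟩
  conv_lhs => rw [← b.sum_repr x, Fin.sum_univ_two]
  simp [b]

theorem exists_linearEquiv_pair {v w v' w' : Eucl 2} (h : LinearIndependent ℝ ![v, w])
    (h' : LinearIndependent ℝ ![v', w']) :
    ∃ T : Eucl 2 ≃L[ℝ] Eucl 2, T v = v' ∧ T w = w' := by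
  let b := basisOfLinearIndependentOfCardEqFinrank h (by simp)
  let b' := basisOfLinearIndependentOfCardEqFinrank h' (by simp)
  have hb0 : b 0 = v := by simp [b]
  have hb1 : b 1 = w := by simp [b]
  refine ⟨(b.equiv b' (Equiv.refl _)).toContinuousLinearEquiv, ?_, ?_⟩
  · change b.equiv b' (Equiv.refl _) v = v'
    rw [← hb0, Module.Basis.equiv_apply]
    simp [b']
  · change b.equiv b' (Equiv.refl _) w = w'
    rw [← hb1, Module.Basis.equiv_apply]
    simp [b']

theorem norm_sq_smul_add_smul (v w : Eucl 2) (s t : ℝ) :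
    ‖s • v + t • w‖ ^ 2 = s ^ 2 * ‖v‖ ^ 2 + 2 * (s * t * inner ℝ v w) + t ^ 2 * ‖w‖ ^ 2 := by
  rw [norm_add_sq_real, inner_smul_left, inner_smul_right, norm_smul, norm_smul, mul_pow, mul_pow,
    Real.norm_eq_abs, Real.norm_eq_abs, sq_abs, sq_abs]
  simp only [conj_trivial]
  ring

/-- The norm of a combination depends only on the Gram matrix of the pair. This produces the
rotations of the square and of the equilateral triangle without coordinates. -/
theorem exists_linearIsometryEquiv_pair {v w v' w' : Eucl 2} (h : LinearIndependent ℝ ![v, w])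
    (hv : ‖v‖ = ‖v'‖) (hw : ‖w‖ = ‖w'‖) (hvw : inner ℝ v w = inner ℝ v' w')
    (h' : LinearIndependent ℝ ![v', w']) :
    ∃ R : Eucl 2 ≃ₗᵢ[ℝ] Eucl 2, R v = v' ∧ R w = w' := by
  obtain ⟨T, hTv, hTw⟩ := exists_linearEquiv_pair h h'
  refine ⟨⟨T.toLinearEquiv, fun x => ?_⟩, hTv, hTw⟩
  obtain ⟨s, t, rfl⟩ := exists_eq_add_smul h x
  change ‖T (s • v + t • w)‖ = _
  rw [map_add, map_smul, map_smul, hTv, hTw, ← sq_eq_sq₀ (norm_nonneg _) (norm_nonneg _),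
    norm_sq_smul_add_smul, norm_sq_smul_add_smul, hv, hw, hvw]

theorem linearIndependent_pair_of_orthogonal {v w : Eucl 2} (hv : v ≠ 0) (hw : w ≠ 0)
    (h : inner ℝ v w = 0) : LinearIndependent ℝ ![v, w] := by
  rw [LinearIndependent.pair_iff]
  intro s t hst
  have h2 : ‖s • v + t • w‖ ^ 2 = 0 := by rw [hst]; simp
  rw [norm_sq_smul_add_smul, h] at h2
  have hv' : 0 < ‖v‖ ^ 2 := by positivity
  have hw' : 0 < ‖w‖ ^ 2 := by positivity
  constructor
  · have : s ^ 2 * ‖v‖ ^ 2 = 0 := by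
      nlinarith [mul_nonneg (sq_nonneg s) hv'.le, mul_nonneg (sq_nonneg t) hw'.le]
    simpa [hv'.ne', hv] using this
  · have : t ^ 2 * ‖w‖ ^ 2 = 0 := by
      nlinarith [mul_nonneg (sq_nonneg s) hv'.le, mul_nonneg (sq_nonneg t) hw'.le]
    simpa [hw'.ne', hw] using this

/-- Two orthogonal vectors of the same length are exchanged, up to sign, by a quarter turn. -/
theorem exists_quarterTurn {v w : Eucl 2} (hv : v ≠ 0) (hvw : ‖v‖ = ‖w‖) (h : inner ℝ v w = 0) :
    ∃ R : Eucl 2 ≃ₗᵢ[ℝ] Eucl 2, R v = w ∧ R w = -v ∧ ∀ x, R (R x) = x → x = 0 := by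
  have hw : w ≠ 0 := by rw [← norm_ne_zero_iff, ← hvw]; simpa using hv
  have hi := linearIndependent_pair_of_orthogonal hv hw h
  obtain ⟨R, hRv, hRw⟩ := exists_linearIsometryEquiv_pair hi hvw (w' := -v) (by simp [hvw])
    (by rw [inner_neg_right, real_inner_comm v w, h, neg_zero])
    (linearIndependent_pair_of_orthogonal hw (neg_ne_zero.2 hv)
      (by rw [inner_neg_right, real_inner_comm v w, h, neg_zero]))
  refine ⟨R, hRv, hRw, fun x hx => ?_⟩
  obtain ⟨s, t, rfl⟩ := exists_eq_add_smul hi x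
  have h1 : R (R (s • v + t • w)) = -(s • v + t • w) := by
    simp only [map_add, map_smul, hRv, hRw, map_neg]
    module
  rw [h1, neg_eq_iff_add_eq_zero, ← two_smul ℝ] at hx
  exact (smul_eq_zero.1 hx).resolve_left two_ne_zero

/-- A planar set with a rotational symmetry that is not an involution is irreducible. -/
theorem hasIrreducibleIsometryGroup_of_rotation {Ω : Set (Eucl 2)} {R : Eucl 2 ≃ₗᵢ[ℝ] Eucl 2}
    (hR : R '' Ω = Ω) (hRR : ∀ x, R (R x) = x → x = 0) : HasIrreducibleIsometryGroup Ω := by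
  intro W hW
  by_contra! hcon
  obtain ⟨hbot, htop⟩ := hcon
  have h1 : Module.finrank ℝ W = 1 := by
    have h2 := Submodule.finrank_lt htop
    have h3 := Submodule.one_le_finrank_iff.2 hbot
    rw [finrank_euclideanSpace_fin] at h2
    omega
  obtain ⟨⟨x, hxW⟩, hx0, hx⟩ := finrank_eq_one_iff'.1 h1
  obtain ⟨k, hk⟩ := hx ⟨R x, hW R hR x hxW⟩
  have hk' : k • x = R x := congrArg Subtype.val hk
  have hx0' : x ≠ 0 := fun h => hx0 (Subtype.ext h)
  have hn : ‖R x‖ = ‖x‖ := R.norm_map x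
  -- An isometry acts on an invariant line by a factor of modulus 1, so its square fixes the line
  -- pointwise.
  rw [← hk', norm_smul, mul_eq_right₀ (norm_ne_zero_iff.2 hx0'), Real.norm_eq_abs] at hn
  refine hx0' (hRR x ?_)
  rw [← hk', map_smul, ← hk', smul_smul, ← sq, ← sq_abs, hn, one_pow, one_smul]

/-- The first moment of `Ω` is fixed by `R`, hence by its square, hence zero. The centroid of the
image is then the translation part `c`. -/
theorem centroidOf_affine_image {Ω : Set (Eucl 2)} (hΩ : IsOpen Ω) (hne : Ω.Nonempty)
    (hb : Bornology.IsBounded Ω) {R : Eucl 2 ≃ₗᵢ[ℝ] Eucl 2}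
    (hR : R '' Ω = Ω) (hRR : ∀ x, R (R x) = x → x = 0) (T : Eucl 2 ≃L[ℝ] Eucl 2) (c : Eucl 2) :
    centroidOf ((fun x => T x + c) '' Ω) = c := by
  have hVtop : volume Ω ≠ ⊤ := hb.measure_lt_top.ne
  have hV : volume.real Ω ≠ 0 :=
    (ENNReal.toReal_pos (hΩ.measure_pos volume hne).ne' hVtop).ne'
  have hint : IntegrableOn (fun x : Eucl 2 => x) Ω volume :=
    (continuous_id.locallyIntegrable.integrableOn_isCompact
      (Metric.isCompact_of_isClosed_isBounded isClosed_closure hb.closure)).mono_set subset_closure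
  have hm : ∫ x in Ω, x = 0 := by
    have h1 : R (∫ x in Ω, x) = ∫ x in Ω, x := by
      conv_rhs => rw [← hR]
      rw [R.measurePreserving.setIntegral_image_emb R.toHomeomorph.measurableEmbedding
        (fun x => x) Ω]
      exact (R.toContinuousLinearEquiv.integral_comp_comm (fun x : Eucl 2 => x)).symm
    exact hRR _ (by rw [h1, h1])
  have hc : IntegrableOn (fun _ : Eucl 2 => c) Ω volume := integrableOn_const hVtop
  have hT : ∫ x in Ω, T x + c = volume.real Ω • c := by
    have h1 : ∫ x in Ω, T x = 0 :=
      (T.integral_comp_comm (fun x : Eucl 2 => x)).trans (by rw [hm, map_zero])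
    have hTint : IntegrableOn (fun x => T x) Ω volume :=
      T.toContinuousLinearMap.integrable_comp hint
    rw [integral_add hTint hc, setIntegral_const, h1, zero_add]
  rw [centroidOf, setAverage_eq, setIntegral_affine_image T c hΩ.measurableSet,
    volume_real_affine_image, hT, smul_smul, smul_smul]
  have := (abs_det_pos T).ne'
  rw [show (|LinearMap.det (T : Eucl 2 →ₗ[ℝ] Eucl 2)| * volume.real Ω)⁻¹ *
      |LinearMap.det (T : Eucl 2 →ₗ[ℝ] Eucl 2)| * volume.real Ω = 1 by field_simp, one_smul]

/-- Among the affine images of a planar set with a rotational symmetry, the functional is maximal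
for the set itself. -/
theorem planarFunctional_affine_image_le {α : ℝ} (hα : 0 < α) (hα2 : α ≤ 2) {Ω : Set (Eucl 2)}
    (hΩ : IsOpen Ω) (hne : Ω.Nonempty) (hb : Bornology.IsBounded Ω) {R : Eucl 2 ≃ₗᵢ[ℝ] Eucl 2}
    (hR : R '' Ω = Ω) (hRR : ∀ x, R (R x) = x → x = 0) (n : ℕ) {T : Eucl 2 ≃L[ℝ] Eucl 2}
    {c c₀ : Eucl 2} {X X₀ : Set (Eucl 2)} (hX : X = (fun x => T x + c) '' Ω)
    (hX₀ : X₀ = (fun x => x + c₀) '' Ω) :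
    planarFunctional α n (centroidOf X) X ≤ planarFunctional α n (centroidOf X₀) X₀ := by
  have hX₀' : X₀ = (fun x => ContinuousLinearEquiv.refl ℝ (Eucl 2) x + c₀) '' Ω := hX₀
  have hI : IntegrableOn (fun x : Eucl 2 => ‖x‖ ^ 2) Ω volume :=
    ((continuous_norm.pow 2).locallyIntegrable.integrableOn_isCompact
      (Metric.isCompact_of_isClosed_isBounded isClosed_closure hb.closure)).mono_set subset_closure
  rw [hX, hX₀', centroidOf_affine_image hΩ hne hb hR hRR,
    centroidOf_affine_image hΩ hne hb hR hRR]
  exact planarFunctional_le_of_similarity hα hα2 hΩ hne hI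
    (hasIrreducibleIsometryGroup_of_rotation hR hRR) n T _ c c₀ (r := 1) (fun x => by simp) one_pos

theorem planarFunctional_ellipse_le {α : ℝ} (hα : 0 < α) (hα2 : α ≤ 2) (n : ℕ) (c₀ : Eucl 2)
    {r : ℝ} (hr : 0 < r) (c : Eucl 2) (e : OrthonormalBasis (Fin 2) ℝ (Eucl 2)) {a b : ℝ}
    (ha : 0 < a) (hb : 0 < b) :
    planarFunctional α n (centroidOf (openEllipse c e a b)) (openEllipse c e a b) ≤
      planarFunctional α n (centroidOf (Metric.ball c₀ r)) (Metric.ball c₀ r) := by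
  have h01 : inner ℝ (e 0) (e 1) = 0 := e.orthonormal.2 (by decide)
  have h0 : e 0 ≠ 0 := e.orthonormal.ne_zero 0
  have h1 : e 1 ≠ 0 := e.orthonormal.ne_zero 1
  -- Every linear isometry preserves the centred disk; a quarter turn is one whose square fixes only
  -- the origin.
  obtain ⟨R, -, -, hRR⟩ := exists_quarterTurn h0 (by simp) h01
  have hi := linearIndependent_pair_of_orthogonal h0 h1 h01
  have har : a / r ≠ 0 := (div_pos ha hr).ne'
  have hbr : b / r ≠ 0 := (div_pos hb hr).ne'
  -- Stretching by `a / r` and `b / r` along the axes carries the disk of radius `r` to semiaxes `a`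
  -- and `b`.
  obtain ⟨T, hT0, hT1⟩ := exists_linearEquiv_pair hi (v' := (a / r) • e 0) (w' := (b / r) • e 1)
    (linearIndependent_pair_of_orthogonal (smul_ne_zero har h0) (smul_ne_zero hbr h1)
      (by rw [inner_smul_left, inner_smul_right, h01, mul_zero, mul_zero]))
  refine planarFunctional_affine_image_le hα hα2 (Ω := Metric.ball 0 r) (R := R) Metric.isOpen_ball
    ⟨0, by simpa using hr⟩ Metric.isBounded_ball (by rw [R.image_ball, map_zero]) hRR n
    (T := T) (c := c) (c₀ := c₀) ?_ ?_
  · rw [← preimage_affineInverse]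
    ext x
    rw [Set.mem_preimage, affineInverse_apply, mem_ball_zero_iff]
    have hx : x - c = T (T.symm (x - c)) := (T.apply_symm_apply _).symm
    set y := T.symm (x - c)
    have hy : y = inner ℝ (e 0) y • e 0 + inner ℝ (e 1) y • e 1 := by
      conv_lhs => rw [← e.sum_repr' y, Fin.sum_univ_two]
    have hTy : T y = (inner ℝ (e 0) y * (a / r)) • e 0 + (inner ℝ (e 1) y * (b / r)) • e 1 := by
      conv_lhs => rw [hy, map_add, map_smul, map_smul, hT0, hT1, smul_smul, smul_smul]
    have h10 : inner ℝ (e 1) (e 0) = 0 := by rw [real_inner_comm, h01]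
    have hny : ‖y‖ ^ 2 = inner ℝ (e 0) y ^ 2 + inner ℝ (e 1) y ^ 2 := by
      conv_lhs => rw [hy, norm_sq_smul_add_smul, h01]
      simp
    change (inner ℝ (e 0) (x - c) / a) ^ 2 + (inner ℝ (e 1) (x - c) / b) ^ 2 < 1 ↔ _
    rw [hx, hTy]
    simp only [inner_add_right, inner_smul_right, h01, h10, real_inner_self_eq_norm_sq,
      e.norm_eq_one]
    rw [← sq_lt_sq₀ (norm_nonneg _) hr.le, hny, ← div_lt_one (pow_pos hr 2)]
    refine iff_of_eq (congrArg (· < (1 : ℝ)) ?_)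
    field_simp
    ring
  · ext x
    simp [Metric.mem_ball, dist_eq_norm, ← sub_eq_add_neg]

/-- The open parallelogram with centre `0` and edge vectors `v`, `w`. -/
def centredParallelogram (v w : Eucl 2) : Set (Eucl 2) :=
  {x | ∃ s t : ℝ, |s| < 1 / 2 ∧ |t| < 1 / 2 ∧ x = s • v + t • w}

theorem openParallelogram_eq (p v w : Eucl 2) :
    openParallelogram p v w =
      (fun x => x + (p + (1 / 2 : ℝ) • v + (1 / 2 : ℝ) • w)) '' centredParallelogram v w := by
  ext x
  constructor
  · rintro ⟨s, t, hs, hs', ht, ht', rfl⟩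
    refine ⟨_, ⟨s - 1 / 2, t - 1 / 2, ?_, ?_, rfl⟩, ?_⟩
    · rw [abs_lt]; constructor <;> linarith
    · rw [abs_lt]; constructor <;> linarith
    · module
  · rintro ⟨_, ⟨s, t, hs, ht, rfl⟩, rfl⟩
    rw [abs_lt] at hs ht
    refine ⟨s + 1 / 2, t + 1 / 2, by linarith, by linarith, by linarith, by linarith, ?_⟩
    module

theorem image_centredParallelogram (T : Eucl 2 ≃L[ℝ] Eucl 2) (v w : Eucl 2) :
    T '' centredParallelogram v w = centredParallelogram (T v) (T w) := by
  ext x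
  constructor
  · rintro ⟨_, ⟨s, t, hs, ht, rfl⟩, rfl⟩
    exact ⟨s, t, hs, ht, by simp⟩
  · rintro ⟨s, t, hs, ht, rfl⟩
    exact ⟨_, ⟨s, t, hs, ht, rfl⟩, by simp⟩

theorem isOpen_centredParallelogram {v w : Eucl 2} (h : LinearIndependent ℝ ![v, w]) :
    IsOpen (centredParallelogram v w) := by
  have hstd : LinearIndependent ℝ ![EuclideanSpace.single (0 : Fin 2) (1 : ℝ),
      EuclideanSpace.single (1 : Fin 2) (1 : ℝ)] :=
    linearIndependent_pair_of_orthogonal (by simp) (by simp)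
      (by simp [EuclideanSpace.inner_single_left])
  obtain ⟨T, hTv, hTw⟩ := exists_linearEquiv_pair hstd h
  rw [← hTv, ← hTw, ← image_centredParallelogram]
  refine T.toHomeomorph.isOpenMap _ ?_
  have : centredParallelogram (EuclideanSpace.single (0 : Fin 2) (1 : ℝ))
      (EuclideanSpace.single (1 : Fin 2) (1 : ℝ)) =
      {x : Eucl 2 | |x 0| < 1 / 2} ∩ {x : Eucl 2 | |x 1| < 1 / 2} := by
    ext x
    constructor
    · rintro ⟨s, t, hs, ht, rfl⟩
      constructor
      · simpa using hs
      · simpa using ht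
    · rintro ⟨h0, h1⟩
      refine ⟨x 0, x 1, h0, h1, ?_⟩
      ext i
      fin_cases i <;> simp
  rw [this]
  exact (isOpen_lt (by fun_prop) continuous_const).inter
    (isOpen_lt (by fun_prop) continuous_const)

theorem isBounded_centredParallelogram (v w : Eucl 2) :
    Bornology.IsBounded (centredParallelogram v w) := by
  refine (Metric.isBounded_closedBall (x := (0 : Eucl 2)) (r := ‖v‖ + ‖w‖)).subset ?_
  rintro _ ⟨s, t, hs, ht, rfl⟩
  rw [mem_closedBall_zero_iff]
  refine (norm_add_le _ _).trans (add_le_add ?_ ?_)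
  · rw [norm_smul, Real.norm_eq_abs]
    nlinarith [norm_nonneg v]
  · rw [norm_smul, Real.norm_eq_abs]
    nlinarith [norm_nonneg w]

theorem planarFunctional_parallelogram_le {α : ℝ} (hα : 0 < α) (hα2 : α ≤ 2) (n : ℕ)
    {p₀ v₀ w₀ : Eucl 2} (hv₀ : v₀ ≠ 0) (hvw₀ : ‖v₀‖ = ‖w₀‖) (horth : inner ℝ v₀ w₀ = 0)
    {p v w : Eucl 2} (h : LinearIndependent ℝ ![v, w]) :
    planarFunctional α n (centroidOf (openParallelogram p v w)) (openParallelogram p v w) ≤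
      planarFunctional α n (centroidOf (openParallelogram p₀ v₀ w₀))
        (openParallelogram p₀ v₀ w₀) := by
  obtain ⟨R, hRv, hRw, hRR⟩ := exists_quarterTurn hv₀ hvw₀ horth
  have hw₀ : w₀ ≠ 0 := by rw [← norm_ne_zero_iff, ← hvw₀]; simpa using hv₀
  have hi := linearIndependent_pair_of_orthogonal hv₀ hw₀ horth
  obtain ⟨T, hTv, hTw⟩ := exists_linearEquiv_pair hi h
  refine planarFunctional_affine_image_le hα hα2 (R := R) (isOpen_centredParallelogram hi)
    ⟨0, 0, 0, by simp⟩ (isBounded_centredParallelogram v₀ w₀) ?_ hRR n (T := T)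
    (c := p + (1 / 2 : ℝ) • v + (1 / 2 : ℝ) • w) ?_ (openParallelogram_eq p₀ v₀ w₀)
  · refine (image_centredParallelogram R.toContinuousLinearEquiv v₀ w₀).trans ?_
    change centredParallelogram (R v₀) (R w₀) = _
    rw [hRv, hRw]
    ext x
    constructor
    · rintro ⟨s, t, hs, ht, rfl⟩
      -- The quarter turn sends `v₀` to `w₀` and `w₀` to `-v₀`, so the coordinates `(s, t)` become
      -- `(-t, s)`.
      exact ⟨-t, s, by rwa [abs_neg], hs, by module⟩
    · rintro ⟨s, t, hs, ht, rfl⟩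
      exact ⟨t, -s, ht, by rwa [abs_neg], by module⟩
  · rw [openParallelogram_eq, ← hTv, ← hTw, ← image_centredParallelogram, Set.image_image]

end Shapes

/-! ### Triangles and their rotations of order three -/

section Triangles

/-- The open triangle with centroid `0` and edge vectors `v`, `w` from one of its vertices. -/
def centredTriangle (v w : Eucl 2) : Set (Eucl 2) :=
  {x | ∃ s t : ℝ, 0 < s ∧ 0 < t ∧ s + t < 1 ∧ x = (s - 1 / 3) • v + (t - 1 / 3) • w}

theorem triangle_interior_eq (t : Affine.Triangle ℝ (Eucl 2)) :
    t.interior = (fun x => x + (1 / 3 : ℝ) • (t.points 0 + t.points 1 + t.points 2)) ''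
      centredTriangle (t.points 1 - t.points 0) (t.points 2 - t.points 0) := by
  ext x
  constructor
  · rintro ⟨w, hw, hw01, rfl⟩
    have hw0 := hw01 0
    have hw1 := hw01 1
    have hw2 := hw01 2
    refine ⟨_, ⟨w 1, w 2, hw1.1, hw2.1, ?_, rfl⟩, ?_⟩
    · rw [Fin.sum_univ_three] at hw
      linarith [hw0.1]
    · rw [Finset.affineCombination_eq_linear_combination _ _ _ hw, Fin.sum_univ_three]
      rw [Fin.sum_univ_three] at hw
      rw [show w 0 = 1 - w 1 - w 2 by linarith]
      module
  · rintro ⟨_, ⟨a, b, ha, hb, hab, rfl⟩, rfl⟩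
    have hsum : ∑ i, (![1 - a - b, a, b] : Fin 3 → ℝ) i = 1 := by
      rw [Fin.sum_univ_three]
      simp only [Matrix.cons_val]
      ring
    refine ⟨![1 - a - b, a, b], hsum, ?_, ?_⟩
    · intro i
      fin_cases i
      · exact ⟨by simp; linarith, by simp; linarith⟩
      · exact ⟨by simpa using ha, by simp; linarith⟩
      · exact ⟨by simpa using hb, by simp; linarith⟩
    · rw [Finset.affineCombination_eq_linear_combination _ _ _ hsum, Fin.sum_univ_three]
      simp only [Matrix.cons_val]
      module

theorem triangle_linearIndependent (t : Affine.Triangle ℝ (Eucl 2)) :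
    LinearIndependent ℝ ![t.points 1 - t.points 0, t.points 2 - t.points 0] := by
  have h := (affineIndependent_iff_linearIndependent_vsub ℝ t.points 0).1 t.independent
  have h2 := h.comp (![⟨1, by decide⟩, ⟨2, by decide⟩] : Fin 2 → {x : Fin 3 // x ≠ 0})
    (by intro i j; fin_cases i <;> fin_cases j <;> simp)
  have h3 : ![t.points 1 - t.points 0, t.points 2 - t.points 0] =
      (fun i : {x : Fin 3 // x ≠ 0} => t.points i -ᵥ t.points 0) ∘
        (![⟨1, by decide⟩, ⟨2, by decide⟩] : Fin 2 → {x : Fin 3 // x ≠ 0}) := by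
    ext i : 1
    fin_cases i <;> rfl
  rw [h3]
  exact h2

theorem image_centredTriangle (T : Eucl 2 ≃L[ℝ] Eucl 2) (v w : Eucl 2) :
    T '' centredTriangle v w = centredTriangle (T v) (T w) := by
  ext x
  constructor
  · rintro ⟨_, ⟨s, t, hs, ht, hst, rfl⟩, rfl⟩
    exact ⟨s, t, hs, ht, hst, by rw [map_add, map_smul, map_smul]⟩
  · rintro ⟨s, t, hs, ht, hst, rfl⟩
    exact ⟨_, ⟨s, t, hs, ht, hst, rfl⟩, by rw [map_add, map_smul, map_smul]⟩

theorem isOpen_centredTriangle {v w : Eucl 2} (h : LinearIndependent ℝ ![v, w]) :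
    IsOpen (centredTriangle v w) := by
  have hstd : LinearIndependent ℝ ![EuclideanSpace.single (0 : Fin 2) (1 : ℝ),
      EuclideanSpace.single (1 : Fin 2) (1 : ℝ)] :=
    linearIndependent_pair_of_orthogonal (by simp) (by simp)
      (by simp [EuclideanSpace.inner_single_left])
  obtain ⟨T, hTv, hTw⟩ := exists_linearEquiv_pair hstd h
  rw [← hTv, ← hTw, ← image_centredTriangle]
  refine T.toHomeomorph.isOpenMap _ ?_
  have : centredTriangle (EuclideanSpace.single (0 : Fin 2) (1 : ℝ))
      (EuclideanSpace.single (1 : Fin 2) (1 : ℝ)) =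
      {x : Eucl 2 | -(1 / 3) < x 0} ∩ {x : Eucl 2 | -(1 / 3) < x 1} ∩
        {x : Eucl 2 | x 0 + x 1 < 1 / 3} := by
    ext x
    constructor
    · rintro ⟨s, t, hs, ht, hst, rfl⟩
      refine ⟨⟨?_, ?_⟩, ?_⟩ <;> simp <;> linarith
    · rintro ⟨⟨h0, h1⟩, h2⟩
      rw [Set.mem_ofPred_eq] at h0 h1 h2
      refine ⟨x 0 + 1 / 3, x 1 + 1 / 3, by linarith, by linarith, by linarith, ?_⟩
      ext i
      fin_cases i <;> simp
  rw [this]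
  exact ((isOpen_lt continuous_const (by fun_prop)).inter
    (isOpen_lt continuous_const (by fun_prop))).inter (isOpen_lt (by fun_prop) continuous_const)

theorem isBounded_centredTriangle (v w : Eucl 2) :
    Bornology.IsBounded (centredTriangle v w) := by
  refine (Metric.isBounded_closedBall (x := (0 : Eucl 2)) (r := ‖v‖ + ‖w‖)).subset ?_
  rintro _ ⟨s, t, hs, ht, hst, rfl⟩
  rw [mem_closedBall_zero_iff]
  refine (norm_add_le _ _).trans (add_le_add ?_ ?_)
  · rw [norm_smul, Real.norm_eq_abs]
    exact mul_le_of_le_one_left (norm_nonneg _) (abs_le.2 ⟨by linarith, by linarith⟩)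
  · rw [norm_smul, Real.norm_eq_abs]
    exact mul_le_of_le_one_left (norm_nonneg _) (abs_le.2 ⟨by linarith, by linarith⟩)

theorem planarFunctional_triangle_le {α : ℝ} (hα : 0 < α) (hα2 : α ≤ 2) (n : ℕ)
    {t₀ : Affine.Triangle ℝ (Eucl 2)} (ht₀ : t₀.Equilateral) (t : Affine.Triangle ℝ (Eucl 2)) :
    planarFunctional α n (centroidOf t.interior) t.interior ≤
      planarFunctional α n (centroidOf t₀.interior) t₀.interior := by
  have hi := triangle_linearIndependent t₀
  obtain ⟨T, hTv, hTw⟩ := exists_linearEquiv_pair hi (triangle_linearIndependent t)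
  have hX₀ := triangle_interior_eq t₀
  obtain ⟨ℓ, hℓ⟩ := ht₀
  have hv : ‖t₀.points 1 - t₀.points 0‖ = ℓ := by
    rw [← dist_eq_norm]; exact hℓ 1 0 (by decide)
  have hw : ‖t₀.points 2 - t₀.points 0‖ = ℓ := by
    rw [← dist_eq_norm]; exact hℓ 2 0 (by decide)
  have hwv : ‖(t₀.points 2 - t₀.points 0) - (t₀.points 1 - t₀.points 0)‖ = ℓ := by
    rw [sub_sub_sub_cancel_right, ← dist_eq_norm]; exact hℓ 2 1 (by decide)
  set v := t₀.points 1 - t₀.points 0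
  set w := t₀.points 2 - t₀.points 0
  have hinner : 2 * inner ℝ v w = ℓ ^ 2 := by
    have := norm_sub_sq_real w v
    rw [hwv, hv, hw, real_inner_comm] at this
    linarith
  have hi' : LinearIndependent ℝ ![w - v, -v] := by
    rw [LinearIndependent.pair_iff] at hi ⊢
    intro a b hab
    obtain ⟨h1, h2⟩ := hi (-a - b) a (by rw [← hab]; module)
    exact ⟨h2, by linarith⟩
  -- The rotation that permutes the vertices cyclically: the edges `v` and `w` from vertex 0 go to
  -- the edges from vertex 1 to vertices 2 and 0. The Gram matrices agree because twice the inner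
  -- product of `v` and `w` is `ℓ²`.
  obtain ⟨R, hRv, hRw⟩ := exists_linearIsometryEquiv_pair hi (v' := w - v) (w' := -v)
    (by rw [hv, hwv]) (by rw [norm_neg, hv, hw])
    (by
      rw [inner_neg_right, inner_sub_left w v v, real_inner_self_eq_norm_sq, hv,
        real_inner_comm v w]
      linarith) hi'
  refine planarFunctional_affine_image_le hα hα2 (R := R) (isOpen_centredTriangle hi)
    ⟨0, 1 / 3, 1 / 3, by norm_num⟩ (isBounded_centredTriangle v w) ?_ ?_ n (T := T)
    (c := (1 / 3 : ℝ) • (t.points 0 + t.points 1 + t.points 2)) ?_ hX₀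
  · refine (image_centredTriangle R.toContinuousLinearEquiv v w).trans ?_
    change centredTriangle (R v) (R w) = _
    rw [hRv, hRw]
    ext x
    constructor
    · rintro ⟨a, b, ha, hb, hab, rfl⟩
      -- The rotation permutes the barycentric coordinates `(1 - a - b, a, b)` cyclically.
      exact ⟨1 - a - b, a, by linarith, ha, by linarith, by module⟩
    · rintro ⟨a, b, ha, hb, hab, rfl⟩
      exact ⟨b, 1 - a - b, hb, by linarith, by linarith, by module⟩
  · intro x hx
    -- The rotation of order three satisfies `R² + R + 1 = 0`. If `R²x = x`, then `R x = -2x`, which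
    -- an isometry allows only for `x = 0`.
    have h1 : R (R x) = -x - R x := by
      obtain ⟨a, b, rfl⟩ := exists_eq_add_smul hi x
      simp only [map_add, map_smul, map_sub, map_neg, hRv, hRw]
      module
    have h2 : R x = (-2 : ℝ) • x := by
      rw [h1, sub_eq_iff_eq_add] at hx
      rw [eq_sub_of_add_eq' hx.symm]
      module
    have h3 := R.norm_map x
    rw [h2, norm_smul] at h3
    norm_num at h3
    rw [← norm_eq_zero]
    linarith
  · rw [triangle_interior_eq, ← hTv, ← hTw, ← image_centredTriangle, Set.image_image]

end Triangles

end

theorem mainTheorem9 (α : ℝ) (hα : 0 < α) (hα2 : α ≤ 2) :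
    -- the spectrum is discrete, and `dirichletEigenvalue` lists it
    (∀ (d : ℕ), 1 ≤ d → ∀ Ω : Set (Eucl d), IsOpen Ω → Ω.Nonempty → volume Ω ≠ ⊤ →
      IsDirichletSpectrum α Ω (dirichletEigenvalue α Ω)) ∧
    -- any dimension
    (∀ (d n : ℕ), 1 ≤ d → ∀ Ω : Set (Eucl d), IsOpen Ω → Ω.Nonempty →
      IntegrableOn (fun x => ‖x‖ ^ 2) Ω volume → HasIrreducibleIsometryGroup Ω →
      ∀ S : Eucl d ≃ₗ[ℝ] Eucl d, IsMultipleOfOrthogonal S →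
        ∀ T : Eucl d ≃ₗ[ℝ] Eucl d,
          spectralFunctional α n Ω T ≤ spectralFunctional α n Ω S) ∧
    -- the plane
    (∀ (n : ℕ) (Ω : Set (Eucl 2)), IsOpen Ω → Ω.Nonempty →
      IntegrableOn (fun x => ‖x‖ ^ 2) Ω volume → HasIrreducibleIsometryGroup Ω →
      ∀ S : Eucl 2 ≃ₗ[ℝ] Eucl 2, IsMultipleOfOrthogonal S →
        ∀ T : Eucl 2 ≃ₗ[ℝ] Eucl 2,
          planarFunctional α n 0 (T '' Ω) ≤ planarFunctional α n 0 (S '' Ω)) ∧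
    -- disks among ellipses
    (∀ (n : ℕ) (c₀ : Eucl 2) (r : ℝ), 0 < r →
      ∀ (c : Eucl 2) (e : OrthonormalBasis (Fin 2) ℝ (Eucl 2)) (a b : ℝ), 0 < a → 0 < b →
        planarFunctional α n (centroidOf (openEllipse c e a b)) (openEllipse c e a b) ≤
          planarFunctional α n (centroidOf (Metric.ball c₀ r)) (Metric.ball c₀ r)) ∧
    -- squares among parallelograms
    (∀ (n : ℕ) (p₀ v₀ w₀ : Eucl 2), v₀ ≠ 0 → ‖v₀‖ = ‖w₀‖ → inner ℝ v₀ w₀ = 0 →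
      ∀ p v w : Eucl 2, LinearIndependent ℝ ![v, w] →
        planarFunctional α n (centroidOf (openParallelogram p v w)) (openParallelogram p v w) ≤
          planarFunctional α n (centroidOf (openParallelogram p₀ v₀ w₀))
            (openParallelogram p₀ v₀ w₀)) ∧
    -- equilateral triangles among triangles
    (∀ (n : ℕ) (t₀ : Affine.Triangle ℝ (Eucl 2)), t₀.Equilateral →
      ∀ t : Affine.Triangle ℝ (Eucl 2),
        planarFunctional α n (centroidOf t.interior) t.interior ≤
          planarFunctional α n (centroidOf t₀.interior) t₀.interior) := by
  refine ⟨fun d hd Ω hΩ hne hV => ?_, fun d n hd Ω hΩ hne hI hirr S hS T => ?_,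
    fun n Ω hΩ hne hI hirr S hS T =>
      planarFunctional_le_of_isMultipleOfOrthogonal hα hα2 hΩ hne hI hirr n hS T,
    fun n c₀ r hr c e a b ha hb => planarFunctional_ellipse_le hα hα2 n c₀ hr c e ha hb,
    fun n p₀ v₀ w₀ hv₀ hvw h0 p v w h =>
      planarFunctional_parallelogram_le hα hα2 n hv₀ hvw h0 h,
    fun n t₀ ht₀ t => planarFunctional_triangle_le hα hα2 n ht₀ t⟩
  · have : NeZero d := ⟨by omega⟩
    exact isDirichletSpectrum_dirichletEigenvalue hα hα2 hΩ hne hV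
  · have : NeZero d := ⟨by omega⟩
    exact spectralFunctional_le_of_isMultipleOfOrthogonal hα hα2 hΩ hne hI hirr n hS T
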